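/- Let $V$ be a complex vector space of finite dimension $r$, let $G\subset \mathrm{GL}(V)$ be a complex reflection group (a finite subgroup generated by reflections, i.e. by elements of finite order fixing a hyperplane pointwise), let $N\trianglelefteq G$ be a normal subgroup generated by reflections, and put $H=G/N$. Let $\zeta_G$ be a primitive $|G|$-th root of unity and let $\sigma\in\mathrm{Gal}(\mathbb{Q}(\zeta_G)/\mathbb{Q})$. Notation. For a group $\Gamma$ acting linearly on a complex vector space $X$ of dimension $r$: * The degrees $d_1^\Gamma,\dots,d_r^\Gamma$ are the degrees of homogeneous algebraically independent generators of $S(X^*)^\Gamma$ (here $X=V$ for $\Gamma=G,N$ and $X=E$ for $\Gamma=H$). * $\mathcal{C}_\Gamma\subset S(X^*)$ is the space of $\Gamma$-harmonic polynomials, i.e. those annihilated by all $\Gamma$-invariant polynomial (constant-coefficient) differential operators with no constant term, and $(\mathcal{C}_\Gamma)_k$ is its part of degree $k$. * For a finite-dimensional $\Gamma$-module $M$, the $M$-exponents $e_1^\Gamma(M),\dots,e_m^\Gamma(M)$ of $\Gamma$ are the integers, listed with multiplicity, such that $\sum_{k\ge 0}\dim\mathrm{Hom}_\Gamma\bigl(M,(\mathcal{C}_\Gamma)_k\bigr)\,q^k=\sum_{i=1}^m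 q^{e_i^\Gamma(M)}$. * $M^\sigma$ denotes the Galois twist of $M$, obtained by applying to all matrix entries (in any basis) a field automorphism of $\mathbb{C}$ that extends $\sigma$. * $U^N_\sigma$ is the $G$-module dual to $\bigl(\mathcal{C}_N\otimes (V^\sigma)^*\bigr)^N$. * $E=V/N$ is regarded as an $H$-module as follows: choose homogeneous algebraically independent generators $N_1,\dots,N_r$ of $S(V^*)^N$ whose span $E^*$ is $G$-stable; then $H$ acts linearly on $E^*$ and on its dual $E$, and $S(E^*)=S(V^*)^N$. ($E$ and $E^\sigma$ are also regarded as $G$-modules through $G\to H$.) Then such generators $N_1,\dots,N_r$ exist, and for every choice of them there are indexings by $i=1,\dots,r$ of the $V^\sigma$-exponents of $N$, the $U^N_\sigma$-exponents of $G$, the $V^\sigma$-exponents of $G$, the $E^\sigma$-exponents of $H$, the $E^\sigma$-exponents of $G$, and the degrees of $N$, $H$ and $G$, such that for all $i=1,\dots,r$ \begin{align*} e_i^N(V^\sigma)+e_i^G(U^N_\sigma)&=e_i^G(V^\sigma),\\ d_i^N\cdot e_i^H(E^\sigma)&=e_i^G(E^\sigma),\\ d_i^N\cdot d_i^H&=d_i^G.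 \end{align*} -/

import Mathlib

open MvPolynomial

noncomputable section

namespace ReflectionNumerology

/-! ### Reflection groups -/

/-- A reflection of `V = ℂⁿ`: an element of `GL(V)` of finite order that fixes some hyperplane
pointwise. -/
def IsReflection {n : ℕ} (g : GL (Fin n) ℂ) : Prop :=
  IsOfFinOrder g ∧ ∃ W : Submodule ℂ (Fin n → ℂ), Module.finrank ℂ W + 1 = n ∧
    ∀ v ∈ W, g.val.mulVec v = v

/-- A subgroup of `GL(V)` that is generated by the reflections it contains. -/
def IsGeneratedByReflections {n : ℕ} (K : Subgroup (GL (Fin n) ℂ)) : Prop :=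
  Subgroup.closure {g | g ∈ K ∧ IsReflection g} = K

/-! ### The action on polynomial functions

For `V = ℂⁿ` the symmetric algebra `S(V*)` is `MvPolynomial (Fin n) ℂ`, where `X i` is the `i`-th
coordinate function on `V`. -/

/-- The action `(g f)(v) = f (g⁻¹ v)` of `GL(V)` on `S(V*)`. -/
def polyAct {n : ℕ} : GL (Fin n) ℂ →* (MvPolynomial (Fin n) ℂ →ₐ[ℂ] MvPolynomial (Fin n) ℂ) where
  toFun g := aeval fun i => ∑ j, (g⁻¹).val i j • X j
  map_one' := by
    refine MvPolynomial.algHom_ext fun i => ?_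
    simp [Matrix.one_apply]
  map_mul' g h := by
    refine MvPolynomial.algHom_ext fun i => ?_
    rw [AlgHom.mul_apply, aeval_X, aeval_X, map_sum, mul_inv_rev, Units.val_mul]
    simp_rw [map_smul, aeval_X, Matrix.mul_apply, Finset.sum_smul, Finset.smul_sum, smul_smul]
    exact Finset.sum_comm

theorem polyAct_X {n : ℕ} (g : GL (Fin n) ℂ) (i : Fin n) :
    polyAct g (X i) = ∑ j, (g⁻¹).val i j • X j :=
  aeval_X _ i

/-- The representation of `Γ` on `S(V*)` attached to a representation `ρ : Γ → GL(V)`. -/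
def polyRep {Γ : Type*} [Group Γ] {n : ℕ} (ρ : Γ →* GL (Fin n) ℂ) :
    Representation ℂ Γ (MvPolynomial (Fin n) ℂ) where
  toFun g := (polyAct (ρ g)).toLinearMap
  map_one' := by
    rw [map_one, map_one]
    rfl
  map_mul' g h := by
    rw [map_mul, map_mul]
    rfl

@[simp] theorem polyRep_apply {Γ : Type*} [Group Γ] {n : ℕ} (ρ : Γ →* GL (Fin n) ℂ) (g : Γ)
    (f : MvPolynomial (Fin n) ℂ) : polyRep ρ g f = polyAct (ρ g) f := rfl

/-- The ring of invariants `S(V*)^Γ`. -/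
def invariantRing {Γ : Type*} [Group Γ] {n : ℕ} (ρ : Γ →* GL (Fin n) ℂ) :
    Subalgebra ℂ (MvPolynomial (Fin n) ℂ) where
  carrier := {f | ∀ g, polyAct (ρ g) f = f}
  mul_mem' ha hb g := by rw [map_mul, ha g, hb g]
  add_mem' ha hb g := by rw [map_add, ha g, hb g]
  algebraMap_mem' c g := (polyAct (ρ g)).commutes c

/-- `F₁, …, Fₙ` are fundamental invariants of degrees `d₁, …, dₙ`: they are homogeneous,
algebraically independent, and generate `S(V*)^Γ`. -/
def IsFundamentalInvariants {Γ : Type*} [Group Γ] {n : ℕ} (ρ : Γ →* GL (Fin n) ℂ)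
    (F : Fin n → MvPolynomial (Fin n) ℂ) (d : Fin n → ℕ) : Prop :=
  (∀ i, (F i).IsHomogeneous (d i)) ∧ AlgebraicIndependent ℂ F ∧
    Algebra.adjoin ℂ (Set.range F) = invariantRing ρ

/-- `d₁, …, dₙ` is an indexing of the degrees of the group `ρ(Γ)` acting on `V`. -/
def IsDegrees {Γ : Type*} [Group Γ] {n : ℕ} (ρ : Γ →* GL (Fin n) ℂ) (d : Fin n → ℕ) : Prop :=
  ∃ F, IsFundamentalInvariants ρ F d

/-! ### Harmonic polynomials -/

/-- The algebra of polynomial (constant coefficient) differential operators on `S(V*)`. -/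
def diffOps (n : ℕ) : Subalgebra ℂ (Module.End ℂ (MvPolynomial (Fin n) ℂ)) :=
  Algebra.adjoin ℂ (Set.range fun i : Fin n => (pderiv (R := ℂ) i).toLinearMap)

/-- The space `𝒞` of `Γ`-harmonic polynomials: those annihilated by every `Γ`-invariant
polynomial differential operator `D` with no constant term (the constant term of `D` is `D 1`). -/
def harmonics {Γ : Type*} [Group Γ] {n : ℕ} (ρ : Γ →* GL (Fin n) ℂ) :
    Submodule ℂ (MvPolynomial (Fin n) ℂ) where
  carrier := {f | ∀ D ∈ diffOps n, (∀ g, polyRep ρ g ∘ₗ D = D ∘ₗ polyRep ρ g) → D 1 = 0 → D f = 0}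
  zero_mem' D _ _ _ := map_zero D
  add_mem' ha hb D h₁ h₂ h₃ := by rw [map_add, ha D h₁ h₂ h₃, hb D h₁ h₂ h₃, add_zero]
  smul_mem' c f hf D h₁ h₂ h₃ := by rw [map_smul, hf D h₁ h₂ h₃, smul_zero]

theorem polyAct_inv_apply {n : ℕ} (a : GL (Fin n) ℂ) (f : MvPolynomial (Fin n) ℂ) :
    polyAct a⁻¹ (polyAct a f) = f := by
  rw [← AlgHom.mul_apply, ← map_mul]; simp

theorem polyAct_apply_inv {n : ℕ} (a : GL (Fin n) ℂ) (f : MvPolynomial (Fin n) ℂ) :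
    polyAct a (polyAct a⁻¹ f) = f := by
  rw [← AlgHom.mul_apply, ← map_mul]; simp

theorem pderiv_polyAct {n : ℕ} (a : GL (Fin n) ℂ) (i : Fin n) (f : MvPolynomial (Fin n) ℂ) :
    pderiv i (polyAct a f) = polyAct a (∑ j, (a⁻¹).val j i • pderiv j f) := by
  induction f using MvPolynomial.induction_on with
  | C c =>
    have h : polyAct a (C c) = C c := (polyAct a).commutes c
    simp [h]
  | add p q hp hq => simp [hp, hq, smul_add, Finset.sum_add_distrib]
  | mul_X p k hp =>
    have h1 : pderiv i (polyAct a (X k)) = C ((a⁻¹).val k i) := by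
      rw [polyAct_X, map_sum, Finset.sum_eq_single i]
      · rw [Derivation.map_smul, pderiv_X_self, smul_eq_C_mul, mul_one]
      · intro j _ hj
        rw [Derivation.map_smul, pderiv_X_of_ne hj, smul_zero]
      · simp
    have h2 : ∑ j, (a⁻¹).val j i • pderiv j (p * X k) =
        p * C ((a⁻¹).val k i) + X k * ∑ j, (a⁻¹).val j i • pderiv j p := by
      simp_rw [Derivation.leibniz, smul_add, Finset.sum_add_distrib, smul_eq_mul,
        Finset.mul_sum, mul_smul_comm]
      congr 1
      rw [Finset.sum_eq_single k]
      · rw [pderiv_X_self, mul_one, smul_eq_C_mul, mul_comm]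
      · intro j _ hj
        rw [pderiv_X_of_ne (Ne.symm hj), mul_zero, smul_zero]
      · simp
    have h3 : polyAct a (C ((a⁻¹).val k i)) = C ((a⁻¹).val k i) := (polyAct a).commutes _
    rw [h2, map_mul, Derivation.leibniz, h1, hp, map_add, map_mul, map_mul, h3, smul_eq_mul,
      smul_eq_mul]

theorem conj_mem_diffOps {n : ℕ} (a : GL (Fin n) ℂ) {D : Module.End ℂ (MvPolynomial (Fin n) ℂ)}
    (hD : D ∈ diffOps n) :
    (polyAct a⁻¹).toLinearMap ∘ₗ D ∘ₗ (polyAct a).toLinearMap ∈ diffOps n := by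
  induction hD using Algebra.adjoin_induction with
  | mem x hx =>
    obtain ⟨i, rfl⟩ := hx
    have : (polyAct a⁻¹).toLinearMap ∘ₗ (pderiv (R := ℂ) i).toLinearMap ∘ₗ
        (polyAct a).toLinearMap = ∑ j, (a⁻¹).val j i • (pderiv (R := ℂ) j).toLinearMap := by
      refine LinearMap.ext fun f => ?_
      simp [pderiv_polyAct, polyAct_inv_apply, -map_sum]
    rw [this]
    exact sum_mem fun j _ => Subalgebra.smul_mem _ (Algebra.subset_adjoin (Set.mem_range_self j)) _
  | algebraMap c =>
    have : (polyAct a⁻¹).toLinearMap ∘ₗ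
        (algebraMap ℂ (Module.End ℂ (MvPolynomial (Fin n) ℂ)) c) ∘ₗ (polyAct a).toLinearMap =
        algebraMap ℂ _ c := by
      refine LinearMap.ext fun f => ?_
      simp [Module.algebraMap_end_apply, polyAct_inv_apply]
    rw [this]
    exact Subalgebra.algebraMap_mem _ c
  | add x y _ _ hx hy =>
    rw [LinearMap.add_comp, LinearMap.comp_add]
    exact add_mem hx hy
  | mul x y _ _ hx hy =>
    convert mul_mem hx hy using 1
    refine LinearMap.ext fun f => ?_
    simp [polyAct_apply_inv]

/-- Harmonic polynomials are stable under the normalizer of the group. -/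
theorem polyAct_mem_harmonics {Γ : Type*} [Group Γ] {n : ℕ} (ρ : Γ →* GL (Fin n) ℂ)
    (a : GL (Fin n) ℂ) (ha : ∀ g, ∃ g', ρ g' = a * ρ g * a⁻¹) {f : MvPolynomial (Fin n) ℂ}
    (hf : f ∈ harmonics ρ) : polyAct a f ∈ harmonics ρ := by
  intro D hD hinv hone
  have key := hf ((polyAct a⁻¹).toLinearMap ∘ₗ D ∘ₗ (polyAct a).toLinearMap)
    (conj_mem_diffOps a hD) ?_ ?_
  · have h := congrArg (polyAct a) key
    simpa [polyAct_apply_inv] using h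
  · intro g
    obtain ⟨g', hg'⟩ := ha g
    refine LinearMap.ext fun p => ?_
    have h1 := LinearMap.congr_fun (hinv g') (polyAct a p)
    simp only [LinearMap.comp_apply, polyRep_apply, hg', map_mul, AlgHom.mul_apply,
      polyAct_inv_apply] at h1
    have h2 := congrArg (polyAct a⁻¹) h1
    simpa [polyAct_inv_apply] using h2
  · simp [hone]

theorem polyAct_mem_homogeneous {n : ℕ} (a : GL (Fin n) ℂ) (k : ℕ) {f : MvPolynomial (Fin n) ℂ}
    (hf : f ∈ homogeneousSubmodule (Fin n) ℂ k) :
    polyAct a f ∈ homogeneousSubmodule (Fin n) ℂ k := by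
  have h : (polyAct a f).IsHomogeneous (1 * k) := by
    refine MvPolynomial.IsHomogeneous.aeval hf _ fun i => ?_
    refine MvPolynomial.IsHomogeneous.sum _ _ _ fun j _ => ?_
    rw [MvPolynomial.smul_eq_C_mul]
    simpa using (isHomogeneous_C (Fin n) ((a⁻¹).val i j)).mul (isHomogeneous_X ℂ j)
  simpa using h

/-- The graded piece `𝒞ₖ` of degree `k` of the space of `Γ`-harmonic polynomials, as a
representation of `Γ`. -/
def harmonicPiece {Γ : Type*} [Group Γ] {n : ℕ} (ρ : Γ →* GL (Fin n) ℂ) (k : ℕ) :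
    Subrepresentation (polyRep ρ) where
  toSubmodule := harmonics ρ ⊓ homogeneousSubmodule (Fin n) ℂ k
  apply_mem_toSubmodule g _ hv :=
    ⟨polyAct_mem_harmonics ρ (ρ g) (fun h => ⟨g * h * g⁻¹, by simp⟩) hv.1,
      polyAct_mem_homogeneous (ρ g) k hv.2⟩

/-- For `N` normal in `Γ`, the space of `N`-harmonic polynomials, as a representation of `Γ`. -/
def normalHarmonics {Γ : Type*} [Group Γ] {n : ℕ} (ρ : Γ →* GL (Fin n) ℂ) (N : Subgroup Γ)
    [hN : N.Normal] : Subrepresentation (polyRep ρ) where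
  toSubmodule := harmonics (ρ.comp N.subtype)
  apply_mem_toSubmodule g _ hv :=
    polyAct_mem_harmonics (ρ.comp N.subtype) (ρ g)
      (fun h => ⟨⟨g * h * g⁻¹, hN.conj_mem h h.2 g⟩, by simp⟩) hv

/-! ### Exponents -/

/-- The fake degree `f_M(q) = ∑ₖ (𝒞ₖ, M) qᵏ` of a finite-dimensional `Γ`-module `M`, where
`(𝒞ₖ, M) = dim Hom_Γ(M, 𝒞ₖ)` (the multiplicity of `M` in `𝒞ₖ` when `M` is simple); it is additive
over direct sums in `M`. -/
def fakeDegree {Γ : Type*} [Group Γ] {n : ℕ} (ρ : Γ →* GL (Fin n) ℂ)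
    {M : Type*} [AddCommGroup M] [Module ℂ M] (μ : Representation ℂ Γ M) : PowerSeries ℕ :=
  PowerSeries.mk fun k =>
    Module.finrank ℂ (Representation.IntertwiningMap μ (harmonicPiece ρ k).toRepresentation)

/-- `e₁, …, eₘ` is an indexing of the `M`-exponents of `Γ`: `f_M(q) = ∑ᵢ q ^ eᵢ`. -/
def IsExponents {Γ : Type*} [Group Γ] {n : ℕ} (ρ : Γ →* GL (Fin n) ℂ)
    {M : Type*} [AddCommGroup M] [Module ℂ M] (μ : Representation ℂ Γ M)
    {m : ℕ} (e : Fin m → ℕ) : Prop :=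
  fakeDegree ρ μ = ∑ i, PowerSeries.X ^ e i

/-! ### The modules in the statement -/

/-- The module `ℂⁿ` attached to a matrix representation. -/
def matrixModule {Γ : Type*} [Group Γ] {n : ℕ} (ρ : Γ →* GL (Fin n) ℂ) :
    Representation ℂ Γ (Fin n → ℂ) where
  toFun g := (ρ g).val.mulVecLin
  map_one' := by simp [Module.End.one_eq_id]
  map_mul' g h := by simp [Matrix.mulVecLin_mul, Module.End.mul_eq_comp]

/-- The Galois twist of a matrix representation by a field automorphism `τ` of `ℂ`: apply `τ` to
all matrix entries. -/
def galoisTwist (τ : ℂ ≃+* ℂ) {Γ : Type*} [Group Γ] {n : ℕ} (ρ : Γ →* GL (Fin n) ℂ) :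
    Γ →* GL (Fin n) ℂ :=
  (Matrix.GeneralLinearGroup.map (n := Fin n) (τ : ℂ →+* ℂ)).comp ρ

/-- The `Γ`-module `𝒞_N ⊗ M*`, for `N` normal in `Γ` and `M` a `Γ`-module. -/
def harmonicTensorDual {Γ : Type*} [Group Γ] {n : ℕ} (ρ : Γ →* GL (Fin n) ℂ) (N : Subgroup Γ)
    [N.Normal] {M : Type*} [AddCommGroup M] [Module ℂ M] (μ : Representation ℂ Γ M) :
    Representation ℂ Γ
      (TensorProduct ℂ (normalHarmonics ρ N).toSubmodule (Module.Dual ℂ M)) :=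
  (normalHarmonics ρ N).toRepresentation.tprod μ.dual

/-- The invariants `W^N` of a normal subgroup `N` of `Γ` in a `Γ`-module `W`, as a `Γ`-module. -/
def normalInvariants {Γ : Type*} [Group Γ] (N : Subgroup Γ) [hN : N.Normal]
    {W : Type*} [AddCommMonoid W] [Module ℂ W] (ν : Representation ℂ Γ W) :
    Subrepresentation ν where
  toSubmodule :=
    { carrier := {w | ∀ h ∈ N, ν h w = w}
      zero_mem' := fun h _ => map_zero (ν h)
      add_mem' := fun ha hb h hh => by rw [map_add, ha h hh, hb h hh]
      smul_mem' := fun c w hw h hh => by rw [map_smul, hw h hh] }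
  apply_mem_toSubmodule g w hw h hh := by
    have h1 := hw (g⁻¹ * h * g) (by simpa using hN.conj_mem h hh g⁻¹)
    have h2 : ν g (ν (g⁻¹ * h * g) w) = ν h (ν g w) := by
      rw [← Module.End.mul_apply, ← Module.End.mul_apply, ← map_mul, ← map_mul]
      congr 2
      group
    rw [← h2, h1]

/-- The Orlik-Solomon space `U_M^N`: the dual of the `Γ`-module `(U_M^N)* = (𝒞_N ⊗ M*)^N`. -/
def orlikSolomon {Γ : Type*} [Group Γ] {n : ℕ} (ρ : Γ →* GL (Fin n) ℂ) (N : Subgroup Γ)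
    [N.Normal] {M : Type*} [AddCommGroup M] [Module ℂ M] (μ : Representation ℂ Γ M) :
    Representation ℂ Γ
      (Module.Dual ℂ (normalInvariants N (harmonicTensorDual ρ N μ)).toSubmodule) :=
  (normalInvariants N (harmonicTensorDual ρ N μ)).toRepresentation.dual

/-- Linear coordinates on the quotient `E = V/N`: fundamental `N`-invariants `F₁, …, Fₙ` whose
span `E*` is stable under `Γ`, identify `E` with `ℂⁿ` through `v ↦ (F₁(v), …, Fₙ(v))` and `S(E*)`
with `S(V*)^N` through `X i ↦ F i`; and `η` is the matrix, in these coordinates, of the action of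
`Γ/N` on `E`. -/
def IsLinearQuotient {Γ : Type*} [Group Γ] {n : ℕ} (ρ : Γ →* GL (Fin n) ℂ) (N : Subgroup Γ)
    [N.Normal] (F : Fin n → MvPolynomial (Fin n) ℂ) (η : Γ ⧸ N →* GL (Fin n) ℂ) : Prop :=
  (∃ d, IsFundamentalInvariants (ρ.comp N.subtype) F d) ∧
    ∀ (g : Γ) (i : Fin n), polyAct (ρ g) (F i) = aeval F (polyAct (η (g : Γ ⧸ N)) (X i))

end ReflectionNumerology

end

/-!
Write `S = S(V*)`, let `I` be the ideal of `S` generated by the invariants without constant term,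
and let `Hom_Γ(M, S)` be the module of covariants of a `Γ`-module `M` over the ring of invariants.

For any finite linear group the harmonic polynomials are the orthogonal complement of `I` for an
invariant Hermitian form (`isCompl_harmonics_invIdeal`). Hence, once the covariants are free over
the invariants, the `M`-exponents are the degrees of any homogeneous basis of them
(`isExponents_of_basis`), and all three identities reduce to choosing good bases.

The bases come from one property of the group, `FlatOverInvariants`. It holds for reflection
groups, by divided differences (`flatOverInvariants`), and it passes from a group to its quotient
by a normal reflection subgroup acting on `E` (`flatOverInvariants_quotient`), so that it is never
needed that the quotient is a reflection group. It implies that covariants that are independent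
modulo `I` are linearly independent over `S`; together with a graded Nakayama lemma this shows
that the covariants of a faithful group have a basis of `dim M` elements, which can be taken from
any set of homogeneous covariants that spans modulo `I` (`exists_basis_equivHom`). Applied to
differentials, with Euler's identity, the same independence yields fundamental invariants
(`linearIndependent_grad`, `exists_isFundamentalInvariants`). Averaging their span over `G` gives
linear coordinates on `V/N` (`exists_isLinearQuotient`).

In each identity the degrees have to be matched index by index.

* The action of `H` on `E` preserves the decomposition of `E*` according to the degrees of `N`.
  There are fundamental invariants of `H`, and bases of covariants of `E^σ`, each of whose members
  only involves the coordinates of one degree (`exists_block_fundamental_invariants`,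
  `exists_block_basis_equivHom`): members that involve several degrees are superfluous, because
  there are enough covariants, with prescribed values at a generic point, that do not. Since
  `S(E*)` sits in `S(V*)` by substitution of the generators, a member of degree `k` in the
  coordinates of degree `d` acquires the degree `d * k`. This gives the two identities with
  products.
* The `N`-covariants of `V^σ` have a homogeneous basis `bᵢ` with harmonic values, which is a basis
  of `(𝒞_N ⊗ (V^σ)*)^N`. If `εᵢ` is the dual basis of `U^N_σ`, then `u ↦ ∑ u(εᵢ) bᵢ` identifies
  the `G`-covariants of `U^N_σ` with those of `V^σ` (`contraction_mem_equivHom_iff`), and a basis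
  that is homogeneous in both gradings gives the identity with sums (`exists_isExponents_add`).

A nonvanishing term of the determinant of a basis matches its members with the coordinates
(`exists_perm_of_linearIndependent`). The twist `σ` enters only through the facts that the twisted
modules have the same dimension, and that a twisted matrix has zero entries and trivial rows where
the original one has.
-/

noncomputable section

namespace ReflectionNumerology

/-! ### Averaging over a finite group -/

section Averaging

variable {Γ : Type*} [Group Γ] [Finite Γ] {X : Type*} [AddCommGroup X] [Module ℂ X]

/-- The Reynolds operator of a representation of a finite group. -/
def avg (ν : Representation ℂ Γ X) : X →ₗ[ℂ] X :=
  letI := Fintype.ofFinite Γ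
  (Nat.card Γ : ℂ)⁻¹ • ∑ g : Γ, ν g

theorem natCard_ne_zero : (Nat.card Γ : ℂ) ≠ 0 := by
  exact_mod_cast Nat.card_pos.ne'

theorem avg_apply [Fintype Γ] (ν : Representation ℂ Γ X) (x : X) :
    avg ν x = (Nat.card Γ : ℂ)⁻¹ • ∑ g : Γ, ν g x := by
  obtain rfl := Subsingleton.elim ‹Fintype Γ› (Fintype.ofFinite Γ)
  simp [avg, LinearMap.sum_apply]

theorem apply_avg (ν : Representation ℂ Γ X) (g : Γ) (x : X) : ν g (avg ν x) = avg ν x := by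
  have := Fintype.ofFinite Γ
  rw [avg_apply, map_smul, map_sum]
  congr 1
  exact Fintype.sum_equiv (Equiv.mulLeft g) _ _ fun h => by simp [map_mul]

theorem avg_eq_self (ν : Representation ℂ Γ X) {x : X} (hx : ∀ g, ν g x = x) : avg ν x = x := by
  have := Fintype.ofFinite Γ
  rw [avg_apply, Finset.sum_congr rfl fun g _ => hx g, Finset.sum_const, Finset.card_univ,
    ← Nat.card_eq_fintype_card, ← Nat.cast_smul_eq_nsmul ℂ, smul_smul,
    inv_mul_cancel₀ natCard_ne_zero, one_smul]

/-- Equivariant maps commute with averaging. -/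
theorem map_avg {Y : Type*} [AddCommGroup Y] [Module ℂ Y] (ν : Representation ℂ Γ X)
    (ν' : Representation ℂ Γ Y) (T : X →ₗ[ℂ] Y) (hT : ∀ g x, T (ν g x) = ν' g (T x)) (x : X) :
    T (avg ν x) = avg ν' (T x) := by
  have := Fintype.ofFinite Γ
  simp [avg_apply, hT]

theorem avg_mem (ν : Representation ℂ Γ X) (K : Submodule ℂ X) {x : X} (hx : ∀ g, ν g x ∈ K) :
    avg ν x ∈ K := by
  have := Fintype.ofFinite Γ
  rw [avg_apply]
  exact K.smul_mem _ (K.sum_mem fun g _ => hx g)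

theorem sub_avg_mem (ν : Representation ℂ Γ X) (K : Submodule ℂ X) {x : X}
    (hx : ∀ g, x - ν g x ∈ K) : x - avg ν x ∈ K := by
  have := Fintype.ofFinite Γ
  have : x - avg ν x = (Nat.card Γ : ℂ)⁻¹ • ∑ g : Γ, (x - ν g x) := by
    rw [avg_apply, Finset.sum_sub_distrib, smul_sub, Finset.sum_const, Finset.card_univ,
      ← Nat.card_eq_fintype_card, ← Nat.cast_smul_eq_nsmul ℂ, smul_smul,
      inv_mul_cancel₀ natCard_ne_zero, one_smul]
  rw [this]
  exact K.smul_mem _ (K.sum_mem fun g _ => hx g)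

end Averaging

/-! ### Invariants and the ideal they generate -/

section Action

variable {n : ℕ}

@[simp] theorem polyAct_C (a : GL (Fin n) ℂ) (c : ℂ) : polyAct a (C c) = C c :=
  (polyAct a).commutes c

theorem constantCoeff_polyAct (a : GL (Fin n) ℂ) (f : MvPolynomial (Fin n) ℂ) :
    constantCoeff (polyAct a f) = constantCoeff f := by
  induction f using MvPolynomial.induction_on with
  | C c => simp
  | add p q hp hq => simp [hp, hq]
  | mul_X p i hp => simp [polyAct_X, constantCoeff_X]

theorem polyAct_injective (a : GL (Fin n) ℂ) : Function.Injective (polyAct a) :=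
  Function.LeftInverse.injective (polyAct_inv_apply a)

theorem polyAct_homogeneousComponent (a : GL (Fin n) ℂ) (k : ℕ) (f : MvPolynomial (Fin n) ℂ) :
    polyAct a (homogeneousComponent k f) = homogeneousComponent k (polyAct a f) := by
  classical
  conv_rhs => rw [← sum_homogeneousComponent f, map_sum, map_sum]
  have h : ∀ i, homogeneousComponent k (polyAct a (homogeneousComponent i f)) =
      if k = i then polyAct a (homogeneousComponent i f) else 0 := fun i =>
    homogeneousComponent_of_mem
      (polyAct_mem_homogeneous a i (homogeneousComponent_mem i f))
  simp_rw [h]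
  rw [Finset.sum_ite_eq]
  split_ifs with hk
  · rfl
  · rw [homogeneousComponent_eq_zero _ _ (by simpa using hk), map_zero]

theorem totalDegree_polyAct_le (a : GL (Fin n) ℂ) (f : MvPolynomial (Fin n) ℂ) :
    (polyAct a f).totalDegree ≤ f.totalDegree := by
  conv_lhs => rw [← sum_homogeneousComponent f, map_sum]
  refine totalDegree_finsetSum_le fun i hi => ?_
  exact (IsHomogeneous.totalDegree_le
    (polyAct_mem_homogeneous a i (homogeneousComponent_mem i f))).trans
    (Nat.lt_succ_iff.1 (Finset.mem_range.1 hi))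

theorem eval_polyAct (a : GL (Fin n) ℂ) (v : Fin n → ℂ) (f : MvPolynomial (Fin n) ℂ) :
    eval v (polyAct a f) = eval ((a⁻¹).val.mulVec v) f := by
  induction f using MvPolynomial.induction_on with
  | C c => simp
  | add p q hp hq => simp [hp, hq]
  | mul_X p i hp =>
    simp only [map_mul, hp, polyAct_X, eval_X, map_sum, smul_eval, Matrix.mulVec, dotProduct]

variable {Γ : Type*} [Group Γ] (ρ : Γ →* GL (Fin n) ℂ)

theorem homogeneousComponent_mem_invariantRing {f : MvPolynomial (Fin n) ℂ}
    (hf : f ∈ invariantRing ρ) (k : ℕ) : homogeneousComponent k f ∈ invariantRing ρ := fun g => by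
  rw [polyAct_homogeneousComponent, hf g]

/-- The invariants without constant term. -/
def posInv : Submodule ℂ (MvPolynomial (Fin n) ℂ) where
  carrier := {u | u ∈ invariantRing ρ ∧ constantCoeff u = 0}
  zero_mem' := ⟨zero_mem _, map_zero _⟩
  add_mem' ha hb := ⟨add_mem ha.1 hb.1, by rw [map_add, ha.2, hb.2, add_zero]⟩
  smul_mem' c u hu := ⟨Subalgebra.smul_mem _ hu.1 c, by rw [constantCoeff_smul, hu.2, smul_zero]⟩

theorem sub_C_mem_posInv {f : MvPolynomial (Fin n) ℂ} (hf : f ∈ invariantRing ρ) :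
    f - C (constantCoeff f) ∈ posInv ρ :=
  ⟨sub_mem hf (Subalgebra.algebraMap_mem _ _), by simp⟩

theorem homogeneousComponent_mem_posInv {u : MvPolynomial (Fin n) ℂ} (hu : u ∈ posInv ρ) (k : ℕ) :
    homogeneousComponent k u ∈ posInv ρ := by
  refine ⟨homogeneousComponent_mem_invariantRing ρ hu.1 k, ?_⟩
  rw [constantCoeff_eq, coeff_homogeneousComponent]
  have := hu.2
  rw [constantCoeff_eq] at this
  simp [this]

/-- The ideal of `S(V*)` generated by the invariants without constant term. -/
def invIdeal : Ideal (MvPolynomial (Fin n) ℂ) := Ideal.span (posInv ρ)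

theorem posInv_subset_invIdeal {u : MvPolynomial (Fin n) ℂ} (hu : u ∈ posInv ρ) :
    u ∈ invIdeal ρ := Ideal.subset_span hu

/-- The invariant ideal is stable under the normalizer of the group. -/
theorem polyAct_mem_invIdeal (a : GL (Fin n) ℂ) (ha : ∀ g, ∃ g', ρ g * a = a * ρ g')
    {f : MvPolynomial (Fin n) ℂ} (hf : f ∈ invIdeal ρ) : polyAct a f ∈ invIdeal ρ := by
  have : invIdeal ρ ≤ (invIdeal ρ).comap (polyAct a).toRingHom := by
    refine Ideal.span_le.2 fun u hu => ?_
    refine posInv_subset_invIdeal ρ ⟨fun g => ?_, (constantCoeff_polyAct a u).trans hu.2⟩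
    obtain ⟨g', hg'⟩ := ha g
    change polyAct (ρ g) (polyAct a u) = polyAct a u
    rw [← AlgHom.mul_apply, ← map_mul, hg', map_mul, AlgHom.mul_apply, hu.1 g']
  exact this hf

theorem polyAct_mem_invIdeal' (g : Γ) {f : MvPolynomial (Fin n) ℂ} (hf : f ∈ invIdeal ρ) :
    polyAct (ρ g) f ∈ invIdeal ρ :=
  polyAct_mem_invIdeal ρ (ρ g) (fun h => ⟨g⁻¹ * h * g, by simp [mul_assoc]⟩) hf

theorem avg_mem_invariantRing [Finite Γ] (f : MvPolynomial (Fin n) ℂ) :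
    avg (polyRep ρ) f ∈ invariantRing ρ := fun g => apply_avg (polyRep ρ) g f

theorem avg_mul_of_mem [Finite Γ] {u : MvPolynomial (Fin n) ℂ} (hu : u ∈ invariantRing ρ)
    (f : MvPolynomial (Fin n) ℂ) : avg (polyRep ρ) (u * f) = u * avg (polyRep ρ) f :=
  (map_avg (polyRep ρ) (polyRep ρ) (LinearMap.mulLeft ℂ u)
    (fun g x => by simp [hu g]) f).symm

theorem constantCoeff_avg [Finite Γ] (f : MvPolynomial (Fin n) ℂ) :
    constantCoeff (avg (polyRep ρ) f) = constantCoeff f := by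
  have := Fintype.ofFinite Γ
  rw [avg_apply, constantCoeff_smul, map_sum]
  simp_rw [polyRep_apply, constantCoeff_polyAct]
  rw [Finset.sum_const, Finset.card_univ, ← Nat.card_eq_fintype_card, nsmul_eq_mul, smul_eq_mul,
    inv_mul_cancel_left₀ natCard_ne_zero]

attribute [local instance] MvPolynomial.gradedAlgebra in
theorem homogeneousComponent_mem_invIdeal {f : MvPolynomial (Fin n) ℂ} (hf : f ∈ invIdeal ρ)
    (k : ℕ) : homogeneousComponent k f ∈ invIdeal ρ := by
  have h : invIdeal ρ = Ideal.span {u | u ∈ posInv ρ ∧ ∃ k, u.IsHomogeneous k} := by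
    refine le_antisymm (Ideal.span_le.2 fun u hu => ?_) (Ideal.span_mono fun u hu => hu.1)
    rw [SetLike.mem_coe, ← sum_homogeneousComponent u]
    exact sum_mem fun i _ => Ideal.subset_span
      ⟨homogeneousComponent_mem_posInv ρ hu i, i, homogeneousComponent_isHomogeneous i u⟩
  refine homogeneousComponent_mem_of_mem ?_ hf k
  rw [h]
  refine Ideal.homogeneous_span _ _ fun u hu => ?_
  obtain ⟨-, k, hk⟩ := hu
  exact ⟨k, hk⟩

end Action

/-! ### Flatness over the invariants of a reflection group -/

section Flat

variable {n : ℕ}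

/-- A form of flatness of `S(V*)` over `S(V*)^Γ`: for every nonzero tuple `r` of invariants there is
a nonzero tuple `α` of scalars such that every relation `∑ rⱼ hⱼ = 0` in `S(V*)` implies
`∑ αⱼ hⱼ = 0` in the coinvariant algebra. Nothing is required to be homogeneous. -/
def FlatOverInvariants {Γ : Type*} [Group Γ] (ρ : Γ →* GL (Fin n) ℂ) : Prop :=
  ∀ (t : ℕ) (r : Fin t → MvPolynomial (Fin n) ℂ), (∀ j, r j ∈ invariantRing ρ) → r ≠ 0 →
    ∃ α : Fin t → ℂ, α ≠ 0 ∧ ∀ h : Fin t → MvPolynomial (Fin n) ℂ,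
      ∑ j, r j * h j = 0 → ∑ j, α j • h j ∈ invIdeal ρ

/-- A reflection `s` moves every polynomial `p` by a multiple of one fixed nonzero linear form; the
quotient is the divided difference of `p`. -/
theorem IsReflection.exists_dvd {s : GL (Fin n) ℂ} (hs : IsReflection s) :
    ∃ l : MvPolynomial (Fin n) ℂ, l ≠ 0 ∧ l.IsHomogeneous 1 ∧ ∀ p, l ∣ p - polyAct s p := by
  obtain ⟨-, W, hW, hfix⟩ := hs
  have hlt : W < ⊤ := by
    rw [lt_top_iff_ne_top]
    rintro rfl
    rw [finrank_top, Module.finrank_fin_fun] at hW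
    omega
  obtain ⟨a, ha0, haW⟩ := Submodule.exists_le_ker_of_lt_top W hlt
  have hker : LinearMap.ker a = W := by
    refine (Submodule.eq_of_le_of_finrank_le haW ?_).symm
    have h1 := LinearMap.finrank_range_add_finrank_ker a
    have h2 : Module.finrank ℂ (LinearMap.range a) ≠ 0 := by
      intro h
      exact ha0 (LinearMap.range_eq_bot.1 (Submodule.finrank_eq_zero.1 h))
    rw [Module.finrank_fin_fun] at h1
    omega
  have hfix' : ∀ v ∈ W, (s⁻¹).val.mulVec v = v := fun v hv => by
    conv_lhs => rw [← hfix v hv]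
    rw [Matrix.mulVec_mulVec, ← Units.val_mul, inv_mul_cancel, Units.val_one, Matrix.one_mulVec]
  have hc : ∀ i, ∃ c : ℂ, ∀ v, v i - (s⁻¹).val.mulVec v i = c * a v := by
    intro i
    let b : (Fin n → ℂ) →ₗ[ℂ] ℂ := LinearMap.proj i ∘ₗ (LinearMap.id - (s⁻¹).val.mulVecLin)
    have hb : LinearMap.ker a ≤ LinearMap.ker b := by
      intro v hv
      rw [hker] at hv
      exact sub_eq_zero.2 (congrFun (hfix' v hv) i).symm
    have hb' := mem_span_of_iInf_ker_le_ker (L := fun _ : Unit => a) (K := b) (by simpa using hb)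
    rw [Set.range_const, Submodule.mem_span_singleton] at hb'
    obtain ⟨c, hc⟩ := hb'
    exact ⟨c, fun v => (LinearMap.congr_fun hc v).symm⟩
  choose c hc using hc
  have hl : ∀ v, eval v (∑ j, C (a (Pi.single j 1)) * X j : MvPolynomial (Fin n) ℂ) = a v := by
    intro v
    conv_rhs => rw [LinearMap.pi_apply_eq_sum_univ a v]
    rw [map_sum]
    refine Finset.sum_congr rfl fun j _ => ?_
    have : (fun i => if j = i then (1 : ℂ) else 0) = Pi.single j 1 := by
      ext i; simp [Pi.single_apply, eq_comm]
    rw [this, map_mul, eval_C, eval_X, smul_eq_mul, mul_comm]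
  refine ⟨∑ j, C (a (Pi.single j 1)) * X j, ?_, ?_, ?_⟩
  · intro h
    refine ha0 (LinearMap.ext fun v => ?_)
    rw [← hl v, h]
    simp
  · exact IsHomogeneous.sum _ _ _ fun j _ => isHomogeneous_C_mul_X _ j
  · intro p
    induction p using MvPolynomial.induction_on with
    | C c => simp
    | add p q hp hq =>
      rw [map_add, add_sub_add_comm]
      exact dvd_add hp hq
    | mul_X p i hp =>
      have h1 : X i - polyAct s (X i) = C (c i) * ∑ j, C (a (Pi.single j 1)) * X j := by
        refine MvPolynomial.funext fun v => ?_
        rw [map_sub, eval_polyAct, map_mul, hl, eval_X, eval_X, eval_C, hc]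
      have h2 : p * X i - polyAct s (p * X i) =
          (p - polyAct s p) * X i + polyAct s p * (X i - polyAct s (X i)) := by
        rw [map_mul]; ring
      rw [h2, h1]
      exact dvd_add (hp.mul_right _) ((dvd_mul_left _ _).mul_left _)

/-- The range of `ρ` is generated by reflections, so an element of `S(V*)` that is invariant modulo
an ideal (stable under `ρ`) under all reflections of the range is so under all of `Γ`. -/
theorem sub_polyAct_mem_of_reflections {Γ : Type*} [Group Γ] {ρ : Γ →* GL (Fin n) ℂ}
    (hρ : IsGeneratedByReflections ρ.range) {y : MvPolynomial (Fin n) ℂ}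
    (hy : ∀ s ∈ ρ.range, IsReflection s → y - polyAct s y ∈ invIdeal ρ) (g : Γ) :
    y - polyAct (ρ g) y ∈ invIdeal ρ := by
  have hstab : ∀ a ∈ ρ.range, ∀ f ∈ invIdeal ρ, polyAct a f ∈ invIdeal ρ := by
    rintro _ ⟨h, rfl⟩ f hf
    exact polyAct_mem_invIdeal' ρ h hf
  have hg : ρ g ∈ Subgroup.closure {s | s ∈ ρ.range ∧ IsReflection s} := by
    rw [hρ]; exact ⟨g, rfl⟩
  generalize ρ g = a at hg ⊢
  induction hg using Subgroup.closure_induction with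
  | mem s hs => exact hy s hs.1 hs.2
  | one => simp
  | mul a b ha hb iha ihb =>
    have ha' : a ∈ ρ.range := by rwa [← hρ]
    have : y - polyAct (a * b) y = (y - polyAct a y) + polyAct a (y - polyAct b y) := by
      rw [map_mul, AlgHom.mul_apply, map_sub]; ring
    rw [this]
    exact add_mem iha (hstab a ha' _ ihb)
  | inv a ha iha =>
    have ha' : a⁻¹ ∈ ρ.range := by rw [← hρ]; exact inv_mem ha
    have : y - polyAct a⁻¹ y = -polyAct a⁻¹ (y - polyAct a y) := by
      rw [map_sub, polyAct_inv_apply]; ring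
    rw [this]
    exact neg_mem (hstab _ ha' _ iha)

/-- `S(V*)` is flat over the invariants of a reflection group. The scalars are the coefficients of
the given invariants at a monomial of least degree; the conclusion follows by applying divided
differences to the relation, which lowers the degree of the `hⱼ`. -/
theorem flatOverInvariants {Γ : Type*} [Group Γ] [Finite Γ] {ρ : Γ →* GL (Fin n) ℂ}
    (hρ : IsGeneratedByReflections ρ.range) : FlatOverInvariants ρ := by
  classical
  intro t r hr hr0
  obtain ⟨m, ⟨j₀, hj₀⟩, hmin⟩ : ∃ m, (∃ j, coeff m (r j) ≠ 0) ∧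
      ∀ m', (∃ j, coeff m' (r j) ≠ 0) → m.degree ≤ m'.degree := by
    have hne : {m | ∃ j, coeff m (r j) ≠ 0}.Nonempty := by
      obtain ⟨j, hj⟩ := Function.ne_iff.1 hr0
      obtain ⟨m, hm⟩ := MvPolynomial.ne_zero_iff.1 hj
      exact ⟨m, j, hm⟩
    exact ⟨_, Function.argminOn_mem (fun m : Fin n →₀ ℕ => m.degree) _ hne,
      fun m' hm' => Function.argminOn_le (fun m : Fin n →₀ ℕ => m.degree) _ hm'⟩
  refine ⟨fun j => coeff m (r j), fun h => hj₀ (congrFun h j₀), ?_⟩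
  suffices H : ∀ D : ℕ, ∀ h : Fin t → MvPolynomial (Fin n) ℂ,
      (∀ j, h j ≠ 0 → (h j).totalDegree < D) → ∑ j, r j * h j = 0 →
      ∑ j, coeff m (r j) • h j ∈ invIdeal ρ by
    intro h hh
    refine H (Finset.univ.sup (fun j => (h j).totalDegree) + 1) h (fun j _ => ?_) hh
    exact Nat.lt_succ_iff.2 (Finset.le_sup (f := fun j => (h j).totalDegree) (Finset.mem_univ j))
  intro D
  induction D with
  | zero =>
    intro h hD _
    have : ∀ j, h j = 0 := fun j => by
      by_contra hj
      exact absurd (hD j hj) (Nat.not_lt_zero _)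
    simp [this]
  | succ D ih =>
    intro h hD hrel
    set y := ∑ j, coeff m (r j) • h j with hy
    -- The divided differences of the `h j` satisfy the same relation and have smaller degree.
    have hrefl : ∀ s ∈ ρ.range, IsReflection s → y - polyAct s y ∈ invIdeal ρ := by
      rintro _ ⟨g, rfl⟩ hs
      obtain ⟨l, hl0, hl1, hl⟩ := hs.exists_dvd
      choose q hq using fun j => hl (h j)
      have hq1 : ∑ j, coeff m (r j) • q j ∈ invIdeal ρ := by
        refine ih q (fun j hj => ?_) ?_
        · have hne : h j ≠ 0 := by
            intro h0
            have := hq j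
            rw [h0, map_zero, sub_zero] at this
            exact (mul_ne_zero hl0 hj) this.symm
          have h1 : (l * q j).totalDegree = l.totalDegree + (q j).totalDegree :=
            totalDegree_mul_of_isDomain hl0 hj
          rw [hl1.totalDegree hl0, ← hq j] at h1
          have h2 := totalDegree_sub (h j) (polyAct (ρ g) (h j))
          have h3 := totalDegree_polyAct_le (ρ g) (h j)
          have h4 := hD j hne
          rw [max_eq_left h3] at h2
          omega
        · refine (mul_eq_zero.1 ?_).resolve_left hl0
          have : l * ∑ j, r j * q j =
              ∑ j, r j * h j - polyAct (ρ g) (∑ j, r j * h j) := by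
            rw [Finset.mul_sum, map_sum, ← Finset.sum_sub_distrib]
            refine Finset.sum_congr rfl fun j _ => ?_
            rw [map_mul, hr j g, ← mul_sub, hq j]
            ring
          rw [this, hrel, map_zero, sub_zero]
      have : y - polyAct (ρ g) y = l * ∑ j, coeff m (r j) • q j := by
        rw [hy, map_sum, ← Finset.sum_sub_distrib, Finset.mul_sum]
        refine Finset.sum_congr rfl fun j _ => ?_
        rw [map_smul, ← smul_sub, hq j, mul_smul_comm]
      rw [this]
      exact Ideal.mul_mem_left _ _ hq1
    -- By minimality of `m`, the coefficient of the relation at `m` is the constant term of `y`.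
    have hconst : constantCoeff y = 0 := by
      have h1 : coeff m (∑ j, r j * h j) = ∑ j, coeff m (r j) * constantCoeff (h j) := by
        rw [coeff_sum]
        refine Finset.sum_congr rfl fun j _ => ?_
        rw [coeff_mul, Finset.sum_eq_single (m, 0)]
        · rfl
        · rintro ⟨a, b⟩ hab hne
          have hab : a + b = m := Finset.HasAntidiagonal.mem_antidiagonal.1 hab
          have hb : b ≠ 0 := by
            rintro rfl
            exact hne (by rw [← hab, add_zero])
          have : coeff a (r j) = 0 := by
            by_contra ha
            have h2 := hmin a ⟨j, ha⟩
            have h3 : a.degree + b.degree = m.degree := by rw [← hab, map_add]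
            have h4 : b.degree ≠ 0 := fun h => hb ((Finsupp.degree_eq_zero_iff b).1 h)
            omega
          simp [this]
        · simp
      rw [hy, map_sum]
      simp_rw [constantCoeff_smul, smul_eq_mul]
      rw [← h1, hrel, coeff_zero]
    -- So `y` is congruent to its average, which is an invariant without constant term.
    have h1 : y - avg (polyRep ρ) y ∈ (invIdeal ρ).restrictScalars ℂ :=
      sub_avg_mem _ _ fun g => sub_polyAct_mem_of_reflections hρ hrefl g
    have h2 : avg (polyRep ρ) y ∈ invIdeal ρ := posInv_subset_invIdeal ρ
      ⟨avg_mem_invariantRing ρ y, (constantCoeff_avg ρ y).trans hconst⟩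
    have := add_mem (show y - avg (polyRep ρ) y ∈ invIdeal ρ from h1) h2
    rwa [sub_add_cancel] at this

end Flat

/-! ### The apolar pairing -/

section Apolar

variable {n : ℕ}

/-- The apolar pairing `∑ m! fₘ hₘ`, for which `∂ᵢ` is adjoint to multiplication by `X i`. -/
def apolar (f h : MvPolynomial (Fin n) ℂ) : ℂ :=
  ∑ m ∈ f.support, (∏ i, ((m i).factorial : ℂ)) * (coeff m f * coeff m h)

theorem apolar_eq_sum {f : MvPolynomial (Fin n) ℂ} (h : MvPolynomial (Fin n) ℂ)
    {s : Finset (Fin n →₀ ℕ)} (hs : f.support ⊆ s) :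
    apolar f h = ∑ m ∈ s, (∏ i, ((m i).factorial : ℂ)) * (coeff m f * coeff m h) := by
  refine Finset.sum_subset hs fun m _ hm => ?_
  rw [notMem_support_iff.1 hm, zero_mul, mul_zero]

theorem apolar_comm (f h : MvPolynomial (Fin n) ℂ) : apolar f h = apolar h f := by
  classical
  rw [apolar_eq_sum h (Finset.subset_union_left (s₂ := h.support)),
    apolar_eq_sum f (Finset.subset_union_right (s₁ := f.support))]
  exact Finset.sum_congr rfl fun m _ => by rw [mul_comm (coeff m f)]

theorem apolar_add_right (f h k : MvPolynomial (Fin n) ℂ) :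
    apolar f (h + k) = apolar f h + apolar f k := by
  simp_rw [apolar, coeff_add, mul_add, Finset.sum_add_distrib]

theorem apolar_smul_right (c : ℂ) (f h : MvPolynomial (Fin n) ℂ) :
    apolar f (c • h) = c * apolar f h := by
  simp_rw [apolar, coeff_smul, smul_eq_mul, Finset.mul_sum]
  exact Finset.sum_congr rfl fun m _ => by ring

theorem apolar_add_left (f h k : MvPolynomial (Fin n) ℂ) :
    apolar (f + h) k = apolar f k + apolar h k := by
  rw [apolar_comm, apolar_add_right, apolar_comm k, apolar_comm k]

theorem apolar_smul_left (c : ℂ) (f h : MvPolynomial (Fin n) ℂ) :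
    apolar (c • f) h = c * apolar f h := by
  rw [apolar_comm, apolar_smul_right, apolar_comm]

/-- The apolar pairing as a bilinear map. -/
def apolarBilin : MvPolynomial (Fin n) ℂ →ₗ[ℂ] MvPolynomial (Fin n) ℂ →ₗ[ℂ] ℂ :=
  LinearMap.mk₂ ℂ apolar apolar_add_left apolar_smul_left apolar_add_right apolar_smul_right

@[simp] theorem apolarBilin_apply (f h : MvPolynomial (Fin n) ℂ) :
    apolarBilin f h = apolar f h := rfl

theorem apolar_monomial (m : Fin n →₀ ℕ) (a : ℂ) (h : MvPolynomial (Fin n) ℂ) :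
    apolar (monomial m a) h = (∏ i, ((m i).factorial : ℂ)) * (a * coeff m h) := by
  classical
  rw [apolar_eq_sum h support_monomial_subset, Finset.sum_singleton, coeff_monomial, if_pos rfl]

theorem apolar_one (h : MvPolynomial (Fin n) ℂ) : apolar 1 h = constantCoeff h := by
  rw [← C_1, C_apply, apolar_monomial]
  simp [constantCoeff_eq]

theorem apolar_C (f : MvPolynomial (Fin n) ℂ) (c : ℂ) : apolar f (C c) = constantCoeff f * c := by
  rw [apolar_comm, C_apply, apolar_monomial]
  simp [constantCoeff_eq, mul_comm]

theorem eq_of_apolar_eq {f h : MvPolynomial (Fin n) ℂ} (H : ∀ p, apolar f p = apolar h p) :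
    f = h := by
  ext m
  have := H (monomial m 1)
  rw [apolar_comm, apolar_comm h, apolar_monomial, apolar_monomial, one_mul, one_mul] at this
  exact mul_left_cancel₀ (Finset.prod_ne_zero_iff.2 fun i _ =>
    Nat.cast_ne_zero.2 (Nat.factorial_ne_zero _)) this

theorem apolar_pderiv (i : Fin n) (f h : MvPolynomial (Fin n) ℂ) :
    apolar (pderiv i f) h = apolar f (X i * h) := by
  classical
  induction f using MvPolynomial.induction_on' with
  | add p q hp hq => rw [map_add, apolar_add_left, apolar_add_left, hp, hq]
  | monomial m a =>
    rw [pderiv_monomial, apolar_monomial, apolar_monomial, coeff_X_mul']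
    by_cases hm : m i = 0
    · simp [hm]
    · rw [if_pos (Finsupp.mem_support_iff.2 hm),
        ← Finset.mul_prod_erase _ (fun j => ((m j).factorial : ℂ)) (Finset.mem_univ i),
        ← Finset.mul_prod_erase _ _ (Finset.mem_univ i)]
      have h1 : ∏ j ∈ Finset.univ.erase i,
          (((m - Finsupp.single i 1 : Fin n →₀ ℕ) j).factorial : ℂ) =
          ∏ j ∈ Finset.univ.erase i, ((m j).factorial : ℂ) :=
        Finset.prod_congr rfl fun j hj => by
          simp [(Finset.ne_of_mem_erase hj).symm]
      have h2 : ((m i).factorial : ℂ) =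
          m i * ((m - Finsupp.single i 1 : Fin n →₀ ℕ) i).factorial := by
        have : (m - Finsupp.single i 1 : Fin n →₀ ℕ) i = m i - 1 := by simp
        rw [this, ← Nat.mul_factorial_pred hm]
        push_cast; ring
      rw [h1, h2]
      ring

theorem apolar_homogeneousComponent (k : ℕ) (f h : MvPolynomial (Fin n) ℂ) :
    apolar (homogeneousComponent k f) h = apolar f (homogeneousComponent k h) := by
  classical
  have hs : (homogeneousComponent k f).support ⊆ f.support := by
    intro m hm
    rw [mem_support_iff, coeff_homogeneousComponent] at hm
    exact mem_support_iff.2 fun h => hm (by simp [h])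
  rw [apolar_eq_sum h hs, apolar]
  refine Finset.sum_congr rfl fun m _ => ?_
  rw [coeff_homogeneousComponent, coeff_homogeneousComponent]
  split_ifs <;> simp

/-- The transpose of an invertible matrix. -/
def glTranspose (a : GL (Fin n) ℂ) : GL (Fin n) ℂ where
  val := a.val.transpose
  inv := (a⁻¹).val.transpose
  val_inv := by rw [← Matrix.transpose_mul, ← Units.val_mul, inv_mul_cancel]; simp
  inv_val := by rw [← Matrix.transpose_mul, ← Units.val_mul, mul_inv_cancel]; simp

theorem glTranspose_mul (a b : GL (Fin n) ℂ) :
    glTranspose (a * b) = glTranspose b * glTranspose a :=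
  Units.ext (Matrix.transpose_mul _ _)

theorem apolar_polyAct (a : GL (Fin n) ℂ) (f p : MvPolynomial (Fin n) ℂ) :
    apolar (polyAct a f) p = apolar f (polyAct (glTranspose a) p) := by
  induction p using MvPolynomial.induction_on generalizing f with
  | C c => rw [polyAct_C, apolar_C, apolar_C, constantCoeff_polyAct]
  | add p q hp hq => rw [map_add, apolar_add_right, apolar_add_right, hp, hq]
  | mul_X p i hp =>
    rw [mul_comm, ← apolar_pderiv, pderiv_polyAct, hp, map_mul, polyAct_X, ← apolarBilin_apply,
      ← apolarBilin_apply, map_sum, LinearMap.sum_apply, Finset.sum_mul, map_sum]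
    refine Finset.sum_congr rfl fun j _ => ?_
    rw [map_smul, LinearMap.smul_apply, apolarBilin_apply, apolar_pderiv, smul_mul_assoc, map_smul,
      apolarBilin_apply]
    rfl

/-- Every constant-coefficient differential operator is adjoint to multiplication by a
polynomial. -/
theorem exists_adjoint_of_mem_diffOps {D : Module.End ℂ (MvPolynomial (Fin n) ℂ)}
    (hD : D ∈ diffOps n) : ∃ h, ∀ f p, apolar (D f) p = apolar f (h * p) := by
  induction hD using Algebra.adjoin_induction with
  | mem x hx =>
    obtain ⟨i, rfl⟩ := hx
    exact ⟨X i, apolar_pderiv i⟩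
  | algebraMap c =>
    refine ⟨C c, fun f p => ?_⟩
    rw [Module.algebraMap_end_apply, apolar_smul_left, ← smul_eq_C_mul, apolar_smul_right]
  | add x y _ _ hx hy =>
    obtain ⟨h, hh⟩ := hx
    obtain ⟨k, hk⟩ := hy
    refine ⟨h + k, fun f p => ?_⟩
    rw [LinearMap.add_apply, apolar_add_left, hh, hk, add_mul, apolar_add_right]
  | mul x y _ _ hx hy =>
    obtain ⟨h, hh⟩ := hx
    obtain ⟨k, hk⟩ := hy
    refine ⟨k * h, fun f p => ?_⟩
    rw [Module.End.mul_apply, hh, hk, mul_assoc]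

/-- Multiplication by a polynomial is adjoint to a constant-coefficient differential operator. -/
theorem exists_diffOp_adjoint (h : MvPolynomial (Fin n) ℂ) :
    ∃ D ∈ diffOps n, ∀ f p, apolar (D f) p = apolar f (h * p) := by
  induction h using MvPolynomial.induction_on with
  | C c =>
    refine ⟨algebraMap ℂ _ c, Subalgebra.algebraMap_mem _ c, fun f p => ?_⟩
    rw [Module.algebraMap_end_apply, apolar_smul_left, ← smul_eq_C_mul, apolar_smul_right]
  | add h k hh hk =>
    obtain ⟨D, hD, hh⟩ := hh
    obtain ⟨D', hD', hk⟩ := hk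
    refine ⟨D + D', add_mem hD hD', fun f p => ?_⟩
    rw [LinearMap.add_apply, apolar_add_left, hh, hk, add_mul, apolar_add_right]
  | mul_X h i hh =>
    obtain ⟨D, hD, hh⟩ := hh
    refine ⟨(pderiv (R := ℂ) i).toLinearMap * D,
      mul_mem (Algebra.subset_adjoin (Set.mem_range_self i)) hD, fun f p => ?_⟩
    rw [Module.End.mul_apply, mul_assoc, ← hh]
    exact apolar_pderiv i (D f) p

/-! ### Harmonic polynomials complement the invariant ideal -/

/-- Complex conjugation of the coefficients. -/
abbrev conjPoly : MvPolynomial (Fin n) ℂ →+* MvPolynomial (Fin n) ℂ := map (starRingEnd ℂ)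

theorem conjPoly_polyAct (a : GL (Fin n) ℂ) (f : MvPolynomial (Fin n) ℂ) :
    conjPoly (polyAct a f) =
      polyAct (Matrix.GeneralLinearGroup.map (starRingEnd ℂ) a) (conjPoly f) := by
  induction f using MvPolynomial.induction_on with
  | C c => simp [conjPoly]
  | add p q hp hq => simp [hp, hq]
  | mul_X p i hp =>
    rw [map_mul, map_mul, map_mul, map_mul, hp, polyAct_X, conjPoly, map_X, polyAct_X, map_sum]
    congr 1
    refine Finset.sum_congr rfl fun j _ => ?_
    rw [smul_eq_C_mul, smul_eq_C_mul, map_mul, map_C, map_X]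
    rfl

theorem conjPoly_conjPoly (f : MvPolynomial (Fin n) ℂ) : conjPoly (conjPoly f) = f := by
  ext m; simp [conjPoly, coeff_map]

theorem eq_zero_of_apolar_conjPoly {f : MvPolynomial (Fin n) ℂ} (h : apolar f (conjPoly f) = 0) :
    f = 0 := by
  have h1 : apolar f (conjPoly f) =
      ((∑ m ∈ f.support, (∏ i, ((m i).factorial : ℝ)) * Complex.normSq (coeff m f) : ℝ) : ℂ) := by
    rw [apolar]
    push_cast
    refine Finset.sum_congr rfl fun m _ => ?_
    rw [coeff_map, Complex.mul_conj]
  rw [h1, Complex.ofReal_eq_zero, Finset.sum_eq_zero_iff_of_nonneg] at h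
  · ext m
    by_contra hm
    have := h m (mem_support_iff.2 hm)
    rw [mul_eq_zero, Complex.normSq_eq_zero] at this
    refine this.resolve_right hm |> fun h0 => ?_
    exact (Finset.prod_ne_zero_iff.2 fun i _ =>
      Nat.cast_ne_zero.2 (Nat.factorial_ne_zero _)) h0
  · intro m _
    exact mul_nonneg (Finset.prod_nonneg fun i _ => Nat.cast_nonneg _) (Complex.normSq_nonneg _)

/-- The conjugate-linear ring homomorphism `θ` for which `⟨f, h⟩ = apolar f (θ h)` is the Hermitian
form on `S(V*)` attached to the form `b* b` on `V`. -/
def hermTwist (b : GL (Fin n) ℂ) : MvPolynomial (Fin n) ℂ →+* MvPolynomial (Fin n) ℂ :=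
  ((polyAct (glTranspose b)).toRingHom.comp conjPoly).comp (polyAct b).toRingHom

theorem hermTwist_apply (b : GL (Fin n) ℂ) (f : MvPolynomial (Fin n) ℂ) :
    hermTwist b f = polyAct (glTranspose b) (conjPoly (polyAct b f)) := rfl

theorem hermTwist_smul (b : GL (Fin n) ℂ) (c : ℂ) (f : MvPolynomial (Fin n) ℂ) :
    hermTwist b (c • f) = (starRingEnd ℂ c) • hermTwist b f := by
  simp only [hermTwist_apply, map_smul]
  rw [smul_eq_C_mul, map_mul, conjPoly, map_C, ← smul_eq_C_mul, map_smul]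

theorem hermTwist_surjective (b : GL (Fin n) ℂ) : Function.Surjective (hermTwist b) := fun f =>
  ⟨polyAct b⁻¹ (conjPoly (polyAct (glTranspose b)⁻¹ f)), by
    rw [hermTwist_apply, polyAct_apply_inv, conjPoly_conjPoly, polyAct_apply_inv]⟩

theorem constantCoeff_hermTwist (b : GL (Fin n) ℂ) (f : MvPolynomial (Fin n) ℂ) :
    constantCoeff (hermTwist b f) = starRingEnd ℂ (constantCoeff f) := by
  rw [hermTwist_apply, constantCoeff_polyAct, conjPoly, constantCoeff_map, constantCoeff_polyAct]

theorem hermTwist_homogeneousComponent (b : GL (Fin n) ℂ) (k : ℕ) (f : MvPolynomial (Fin n) ℂ) :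
    hermTwist b (homogeneousComponent k f) = homogeneousComponent k (hermTwist b f) := by
  rw [hermTwist_apply, polyAct_homogeneousComponent]
  have : ∀ p : MvPolynomial (Fin n) ℂ,
      conjPoly (homogeneousComponent k p) = homogeneousComponent k (conjPoly p) := fun p => by
    ext m
    rw [coeff_map, coeff_homogeneousComponent, coeff_homogeneousComponent, coeff_map]
    split_ifs <;> simp
  rw [this, polyAct_homogeneousComponent, hermTwist_apply]

theorem eq_zero_of_apolar_hermTwist (b : GL (Fin n) ℂ) {f : MvPolynomial (Fin n) ℂ}
    (h : apolar f (hermTwist b f) = 0) : f = 0 := by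
  rw [hermTwist_apply, ← apolar_polyAct] at h
  exact polyAct_injective b ((eq_zero_of_apolar_conjPoly h).trans (map_zero _).symm)

variable {Γ : Type*} [Group Γ] (ρ : Γ →* GL (Fin n) ℂ)

/-- A finite linear group preserves a positive definite Hermitian form `b* b`; equivalently, its
transposes preserve the twist `θ`. -/
theorem exists_polyAct_hermTwist [Finite Γ] :
    ∃ b : GL (Fin n) ℂ, ∀ (g : Γ) (f : MvPolynomial (Fin n) ℂ),
      polyAct (glTranspose (ρ g)) (hermTwist b (polyAct (ρ g) f)) = hermTwist b f := by
  classical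
  have := Fintype.ofFinite Γ
  open scoped MatrixOrder ComplexOrder in
  let A : Matrix (Fin n) (Fin n) ℂ := ∑ g : Γ, (ρ g).val.conjTranspose * (ρ g).val
  have hA : ∀ g, (ρ g).val.conjTranspose * A * (ρ g).val = A := by
    intro g
    simp only [A, Finset.mul_sum, Finset.sum_mul]
    refine Fintype.sum_equiv (Equiv.mulRight g) _ _ fun h => ?_
    simp only [Equiv.coe_mulRight, map_mul, Units.val_mul, Matrix.conjTranspose_mul,
      Matrix.mul_assoc]
  obtain ⟨b, hb⟩ : ∃ b : GL (Fin n) ℂ, A = b.val.conjTranspose * b.val := by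
    have hpos : A.PosDef := by
      rw [show A = _ from (Finset.add_sum_erase _ _ (Finset.mem_univ (1 : Γ))).symm]
      refine Matrix.PosDef.add_posSemidef ?_ (Matrix.posSemidef_sum _ fun g _ =>
        Matrix.posSemidef_conjTranspose_mul_self _)
      simpa using Matrix.PosDef.one
    obtain ⟨B, hB⟩ := CStarAlgebra.nonneg_iff_eq_star_mul_self.mp hpos.posSemidef.nonneg
    have hBu : IsUnit B := by
      rw [Matrix.isUnit_iff_isUnit_det]
      have h1 := (Matrix.isUnit_iff_isUnit_det _).1 hpos.isUnit
      rw [hB, Matrix.det_mul] at h1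
      exact isUnit_of_mul_isUnit_right h1
    obtain ⟨b, rfl⟩ := hBu
    exact ⟨b, hB⟩
  refine ⟨b, fun g f => ?_⟩
  have key : glTranspose (b * ρ g) * Matrix.GeneralLinearGroup.map (starRingEnd ℂ) (b * ρ g) =
      glTranspose b * Matrix.GeneralLinearGroup.map (starRingEnd ℂ) b := by
    have h1 : ∀ c : GL (Fin n) ℂ, (glTranspose c *
        Matrix.GeneralLinearGroup.map (starRingEnd ℂ) c).val =
        (c.val.conjTranspose * c.val).map (starRingEnd ℂ) := fun c => by
      rw [Units.val_mul, Matrix.map_mul]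
      congr 1
      ext i j
      simp [glTranspose]
    refine Units.ext ?_
    rw [h1, h1, ← hb, Units.val_mul, Matrix.conjTranspose_mul, Matrix.mul_assoc,
      ← Matrix.mul_assoc b.val.conjTranspose, ← hb, ← Matrix.mul_assoc, hA]
  simp only [hermTwist_apply, conjPoly_polyAct, ← AlgHom.mul_apply, ← map_mul]
  congr 2
  rw [← mul_assoc, ← glTranspose_mul, key]

/-- The harmonic polynomials are the orthogonal complement of the invariant ideal with respect to an
invariant Hermitian form. -/
theorem mem_harmonics_iff {b : GL (Fin n) ℂ} (hb : ∀ (g : Γ) (f : MvPolynomial (Fin n) ℂ),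
    polyAct (glTranspose (ρ g)) (hermTwist b (polyAct (ρ g) f)) = hermTwist b f)
    {f : MvPolynomial (Fin n) ℂ} :
    f ∈ harmonics ρ ↔ ∀ p ∈ invIdeal ρ, apolar f (hermTwist b p) = 0 := by
  constructor
  · intro hf p hp
    suffices H : ∀ s, apolar f (hermTwist b (s * p)) = 0 by simpa using H 1
    induction hp using Submodule.span_induction with
    | zero => intro s; simp [← apolarBilin_apply]
    | add p q _ _ hp hq =>
      intro s
      rw [mul_add, map_add, apolar_add_right, hp, hq, add_zero]
    | smul a p _ hp =>
      intro s
      rw [smul_eq_mul, ← mul_assoc, hp]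
    | mem u hu =>
      intro s
      obtain ⟨D, hD, hadj⟩ := exists_diffOp_adjoint (hermTwist b u)
      have hDf : D f = 0 := by
        refine hf D hD (fun g => ?_) ?_
        · refine LinearMap.ext fun q => eq_of_apolar_eq fun p => ?_
          have hu' : polyAct (glTranspose (ρ g)) (hermTwist b u) = hermTwist b u := by
            conv_lhs => rw [← hu.1 g]
            exact hb g u
          rw [LinearMap.comp_apply, LinearMap.comp_apply, polyRep_apply, polyRep_apply,
            apolar_polyAct, hadj, hadj, apolar_polyAct, map_mul, hu']
        · refine eq_of_apolar_eq fun p => ?_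
          rw [hadj, apolar_one, map_mul, constantCoeff_hermTwist, hu.2, map_zero, zero_mul]
          simp [← apolarBilin_apply]
      rw [map_mul, mul_comm, ← hadj, hDf]
      simp [← apolarBilin_apply]
  · intro hf D hD hinv hone
    obtain ⟨h, hadj⟩ := exists_adjoint_of_mem_diffOps hD
    obtain ⟨u, rfl⟩ := hermTwist_surjective b h
    -- Equivariance of `D` says that the transposes of the group fix its symbol `hermTwist b u`.
    have hu : u ∈ posInv ρ := by
      refine ⟨fun g => ?_, ?_⟩
      · have h1 : polyAct (glTranspose (ρ g)) (hermTwist b u) = hermTwist b u := by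
          refine eq_of_apolar_eq fun q => ?_
          rw [apolar_comm, apolar_comm _ q]
          have h2 := congrArg (fun T => apolar (T q) 1) (hinv g)
          simp only [LinearMap.comp_apply, polyRep_apply, apolar_polyAct, hadj, map_one,
            mul_one] at h2
          exact h2.symm
        have h2 : hermTwist b (polyAct (ρ g) u) = hermTwist b u := by
          refine polyAct_injective (glTranspose (ρ g)) ?_
          rw [hb g u, h1]
        rw [hermTwist_apply, hermTwist_apply] at h2
        have h3 := congrArg conjPoly (polyAct_injective _ h2)
        rw [conjPoly_conjPoly, conjPoly_conjPoly] at h3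
        exact polyAct_injective b h3
      · have h1 := hadj 1 1
        rw [hone, mul_one, apolar_one, constantCoeff_hermTwist] at h1
        simpa [← apolarBilin_apply] using h1.symm
    refine eq_of_apolar_eq fun p => ?_
    obtain ⟨q, rfl⟩ := hermTwist_surjective b p
    rw [hadj, ← map_mul, hf _ (Ideal.mul_mem_right _ _ (posInv_subset_invIdeal ρ hu))]
    simp [← apolarBilin_apply]

theorem homogeneousComponent_mem_harmonics [Finite Γ] {f : MvPolynomial (Fin n) ℂ}
    (hf : f ∈ harmonics ρ) (k : ℕ) : homogeneousComponent k f ∈ harmonics ρ := by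
  obtain ⟨b, hb⟩ := exists_polyAct_hermTwist ρ
  rw [mem_harmonics_iff ρ hb] at hf ⊢
  intro p hp
  rw [apolar_homogeneousComponent, ← hermTwist_homogeneousComponent]
  exact hf _ (homogeneousComponent_mem_invIdeal ρ hp k)

theorem isCompl_harmonics_invIdeal [Finite Γ] :
    IsCompl (harmonics ρ) ((invIdeal ρ).restrictScalars ℂ) := by
  obtain ⟨b, hb⟩ := exists_polyAct_hermTwist ρ
  constructor
  · rw [Submodule.disjoint_def]
    intro f hf hfI
    exact eq_zero_of_apolar_hermTwist b ((mem_harmonics_iff ρ hb).1 hf f hfI)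
  · rw [codisjoint_iff, eq_top_iff]
    intro f _
    rw [← sum_homogeneousComponent f]
    refine Submodule.sum_mem _ fun k _ => ?_
    -- In each degree the ideal has finite dimension, so it has an orthogonal complement.
    let K : Submodule ℂ (MvPolynomial (Fin n) ℂ) :=
      (invIdeal ρ).restrictScalars ℂ ⊓ homogeneousSubmodule (Fin n) ℂ k
    have hfd : FiniteDimensional ℂ K := by
      have : FiniteDimensional ℂ (homogeneousSubmodule (Fin n) ℂ k) :=
        Module.Finite.iff_fg.2 (homogeneousSubmodule_fg (Fin n) ℂ k)
      exact Submodule.finiteDimensional_of_le inf_le_right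
    let β := Module.finBasis ℂ K
    let T : MvPolynomial (Fin n) ℂ →ₗ[ℂ] (Fin (Module.finrank ℂ K) → ℂ) :=
      LinearMap.pi fun i => apolarBilin.flip (hermTwist b (β i))
    have hT : ∀ q, T q = 0 → ∀ p ∈ K, apolar q (hermTwist b p) = 0 := by
      intro q hq p hp
      have h1 := congrArg Subtype.val (β.sum_repr ⟨p, hp⟩)
      rw [AddSubmonoidClass.coe_finsetSum] at h1
      rw [← show _ = p from h1, map_sum, ← apolarBilin_apply, map_sum]
      refine Finset.sum_eq_zero fun i _ => ?_
      rw [Submodule.coe_smul, hermTwist_smul, map_smul]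
      have : apolarBilin q (hermTwist b (β i)) = 0 := congrFun hq i
      rw [this, smul_zero]
    have hinj : Function.Injective (T ∘ₗ K.subtype) := by
      rw [← LinearMap.ker_eq_bot, LinearMap.ker_eq_bot']
      intro p hp
      exact Subtype.ext (eq_zero_of_apolar_hermTwist b (hT p hp p p.2))
    have hsurj : Function.Surjective (T ∘ₗ K.subtype) :=
      (LinearMap.injective_iff_surjective_of_finrank_eq_finrank
        (Module.finrank_fin_fun ℂ).symm).1 hinj
    obtain ⟨p, hp⟩ := hsurj (T (homogeneousComponent k f))
    rw [← sub_add_cancel (homogeneousComponent k f) p]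
    refine Submodule.add_mem_sup ?_ p.2.1
    rw [mem_harmonics_iff ρ hb]
    intro q hq
    have hdeg : homogeneousComponent k (homogeneousComponent k f - (p : MvPolynomial (Fin n) ℂ)) =
        homogeneousComponent k f - (p : MvPolynomial (Fin n) ℂ) :=
      homogeneousComponent_eq_self (sub_mem (homogeneousComponent_mem k f) p.2.2)
    rw [← hdeg, apolar_homogeneousComponent, ← hermTwist_homogeneousComponent]
    refine hT _ ?_ _ ⟨homogeneousComponent_mem_invIdeal ρ hq k, homogeneousComponent_mem k q⟩
    rw [map_sub, sub_eq_zero]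
    exact hp.symm

end Apolar

/-! ### Equivariant maps into `S(V*)` -/

/-- A set in which the independent families modulo `K` have bounded length contains one that spans
it modulo `K`. -/
theorem exists_maximal_indep_mod {V : Type*} [AddCommGroup V] [Module ℂ V] (K : Submodule ℂ V)
    (A : Set V) (m : ℕ) (hm : ∀ (t : ℕ) (b : Fin t → V), (∀ i, b i ∈ A) →
      (∀ α : Fin t → ℂ, ∑ i, α i • b i ∈ K → α = 0) → t ≤ m) :
    ∃ (t : ℕ) (b : Fin t → V), (∀ i, b i ∈ A) ∧
      (∀ α : Fin t → ℂ, ∑ i, α i • b i ∈ K → α = 0) ∧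
      ∀ f ∈ Submodule.span ℂ A, ∃ α : Fin t → ℂ, f - ∑ i, α i • b i ∈ K := by
  classical
  let P : ℕ → Prop := fun t => ∃ b : Fin t → V, (∀ i, b i ∈ A) ∧
    ∀ α : Fin t → ℂ, ∑ i, α i • b i ∈ K → α = 0
  have hle : ∀ t, P t → t ≤ m := fun t ⟨b, h1, h2⟩ => hm t b h1 h2
  have hP0 : P 0 := ⟨Fin.elim0, fun i => i.elim0, fun α _ => funext fun i => i.elim0⟩
  obtain ⟨b, hbA, hb⟩ : P (Nat.findGreatest P m) := Nat.findGreatest_spec (Nat.zero_le _) hP0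
  have hmax : ¬ P (Nat.findGreatest P m + 1) := fun h =>
    absurd (Nat.le_findGreatest (hle _ h) h) (by omega)
  refine ⟨_, b, hbA, hb, fun f hf => ?_⟩
  induction hf using Submodule.span_induction with
  | zero => exact ⟨0, by simp⟩
  | add f g _ _ hf hg =>
    obtain ⟨α, hα⟩ := hf
    obtain ⟨α', hα'⟩ := hg
    refine ⟨α + α', ?_⟩
    have := add_mem hα hα'
    simp only [Pi.add_apply, add_smul, Finset.sum_add_distrib]
    rwa [add_sub_add_comm]
  | smul c f _ hf =>
    obtain ⟨α, hα⟩ := hf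
    refine ⟨c • α, ?_⟩
    have := K.smul_mem c hα
    simpa [smul_sub, Finset.smul_sum, smul_smul] using this
  | mem f hf =>
    by_contra hcon
    push Not at hcon
    refine hmax ⟨Fin.cons f b, fun i => ?_, fun α hα => ?_⟩
    · refine Fin.cases ?_ (fun j => ?_) i
      · simpa using hf
      · simpa using hbA j
    · simp only [Fin.sum_univ_succ, Fin.cons_zero, Fin.cons_succ] at hα
      have h0 : α 0 = 0 := by
        by_contra h0
        refine hcon (fun i => -(α 0)⁻¹ * α i.succ) ?_
        have := K.smul_mem (α 0)⁻¹ hα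
        rw [smul_add, smul_smul, inv_mul_cancel₀ h0, one_smul, Finset.smul_sum] at this
        simpa [smul_smul, sub_eq_add_neg] using this
      have hs := hb (fun i => α i.succ) (by simpa [h0] using hα)
      exact funext fun i => Fin.cases h0 (fun j => congrFun hs j) i

section EquivariantMaps

variable {n : ℕ} {Γ : Type*} [Group Γ] (ρ : Γ →* GL (Fin n) ℂ)
  {M : Type*} [AddCommGroup M] [Module ℂ M] (μ : Representation ℂ Γ M)

/-- The covariants `Hom_Γ(M, S(V*))`, a module over `S(V*)^Γ`. -/
def equivHom : Submodule ℂ (M →ₗ[ℂ] MvPolynomial (Fin n) ℂ) := (μ.linHom (polyRep ρ)).invariants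

variable {ρ μ} in
theorem mem_equivHom {f : M →ₗ[ℂ] MvPolynomial (Fin n) ℂ} :
    f ∈ equivHom ρ μ ↔ ∀ g v, f (μ g v) = polyAct (ρ g) (f v) := by
  constructor
  · intro h g v
    have h1 := LinearMap.congr_fun (h g) (μ g v)
    rw [Representation.linHom_apply, LinearMap.comp_apply, LinearMap.comp_apply,
      ← Module.End.mul_apply, ← map_mul, inv_mul_cancel, map_one] at h1
    exact h1.symm
  · intro h g
    refine LinearMap.ext fun v => ?_
    rw [Representation.linHom_apply, LinearMap.comp_apply, LinearMap.comp_apply, polyRep_apply, ← h,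
      ← Module.End.mul_apply, ← map_mul, mul_inv_cancel, map_one, Module.End.one_apply]

/-- The homogeneous component of degree `k` of a map into `S(V*)`. -/
def homComp (k : ℕ) :
    (M →ₗ[ℂ] MvPolynomial (Fin n) ℂ) →ₗ[ℂ] (M →ₗ[ℂ] MvPolynomial (Fin n) ℂ) :=
  LinearMap.compRight ℂ (homogeneousComponent k)

@[simp] theorem homComp_apply (k : ℕ) (f : M →ₗ[ℂ] MvPolynomial (Fin n) ℂ) (v : M) :
    homComp k f v = homogeneousComponent k (f v) := rfl

theorem homComp_mem_equivHom (k : ℕ) {f : M →ₗ[ℂ] MvPolynomial (Fin n) ℂ}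
    (hf : f ∈ equivHom ρ μ) : homComp k f ∈ equivHom ρ μ := by
  rw [mem_equivHom] at hf ⊢
  intro g v
  rw [homComp_apply, homComp_apply, hf, polyAct_homogeneousComponent]

theorem exists_sum_homComp [FiniteDimensional ℂ M] (f : M →ₗ[ℂ] MvPolynomial (Fin n) ℂ) :
    ∃ K, f = ∑ k ∈ Finset.range K, homComp k f := by
  let β := Module.finBasis ℂ M
  refine ⟨Finset.univ.sup (fun i => (f (β i)).totalDegree) + 1, β.ext fun i => ?_⟩
  rw [LinearMap.sum_apply]
  conv_lhs => rw [← sum_homogeneousComponent (f (β i))]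
  refine Finset.sum_subset (Finset.range_subset_range.2 (Nat.succ_le_succ
    (Finset.le_sup (f := fun i => (f (β i)).totalDegree) (Finset.mem_univ i)))) fun k _ hk => ?_
  exact homogeneousComponent_eq_zero _ _ (by simpa using hk)

theorem homogeneousComponent_mul_of_isHomogeneous {i k : ℕ} {u : MvPolynomial (Fin n) ℂ}
    (hu : u.IsHomogeneous i) (p : MvPolynomial (Fin n) ℂ) :
    homogeneousComponent k (u * p) =
      if i ≤ k then u * homogeneousComponent (k - i) p else 0 := by
  classical
  have h : ∀ j, homogeneousComponent k (u * homogeneousComponent j p) =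
      if k = i + j then u * homogeneousComponent j p else 0 := fun j =>
    homogeneousComponent_of_mem (hu.mul (homogeneousComponent_isHomogeneous j p))
  conv_lhs => rw [← sum_homogeneousComponent p, Finset.mul_sum, map_sum]
  simp_rw [h]
  split_ifs with hik
  · rw [Finset.sum_eq_single (k - i)]
    · rw [if_pos (by omega)]
    · intro j _ hj
      rw [if_neg (by omega)]
    · intro hj
      rw [homogeneousComponent_eq_zero _ _ (by rw [Finset.mem_range] at hj; omega), mul_zero,
        ite_self]
  · exact Finset.sum_eq_zero fun j _ => if_neg (by omega)

theorem avg_smul_of_mem_equivHom [Finite Γ] {f : M →ₗ[ℂ] MvPolynomial (Fin n) ℂ}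
    (hf : f ∈ equivHom ρ μ) (p : MvPolynomial (Fin n) ℂ) :
    avg (μ.linHom (polyRep ρ)) (p • f) = avg (polyRep ρ) p • f := by
  refine (map_avg (polyRep ρ) (μ.linHom (polyRep ρ))
    ((LinearMap.toSpanSingleton (MvPolynomial (Fin n) ℂ) _ f).restrictScalars ℂ)
    (fun g q => ?_) p).symm
  refine LinearMap.ext fun v => ?_
  have h1 := mem_equivHom.1 hf g (μ g⁻¹ v)
  rw [← Module.End.mul_apply, ← map_mul, mul_inv_cancel, map_one, Module.End.one_apply] at h1
  simp [h1]

theorem avg_mem_equivHom [Finite Γ] (f : M →ₗ[ℂ] MvPolynomial (Fin n) ℂ) :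
    avg (μ.linHom (polyRep ρ)) f ∈ equivHom ρ μ := fun g => apply_avg _ g f

/-- A covariant with values in the invariant ideal is a combination of covariants whose coefficients
are invariants without constant term. -/
theorem mem_span_of_forall_mem_invIdeal [Finite Γ] [FiniteDimensional ℂ M]
    {f : M →ₗ[ℂ] MvPolynomial (Fin n) ℂ} (hf : f ∈ equivHom ρ μ)
    (hfI : ∀ v, f v ∈ invIdeal ρ) :
    f ∈ Submodule.span ℂ {y | ∃ u ∈ posInv ρ, ∃ s ∈ equivHom ρ μ, y = u • s} := by
  let Y : Submodule ℂ (M →ₗ[ℂ] MvPolynomial (Fin n) ℂ) :=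
    Submodule.span ℂ {y | ∃ u ∈ posInv ρ, ∃ s, y = u • s}
  have h1 : ∀ p ∈ invIdeal ρ, ∀ s : M →ₗ[ℂ] MvPolynomial (Fin n) ℂ, p • s ∈ Y := by
    intro p hp
    induction hp using Submodule.span_induction with
    | mem u hu => exact fun s => Submodule.subset_span ⟨u, hu, s, rfl⟩
    | zero => intro s; rw [zero_smul]; exact zero_mem _
    | add p q _ _ hp hq => intro s; rw [add_smul]; exact add_mem (hp s) (hq s)
    | smul a p _ hp =>
      intro s
      rw [smul_eq_mul, mul_comm, mul_smul]
      exact hp _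
  have h2 : f ∈ Y := by
    let β := Module.finBasis ℂ M
    have : f = ∑ i, f (β i) • (β.coord i).smulRight (1 : MvPolynomial (Fin n) ℂ) := by
      refine β.ext fun j => ?_
      rw [LinearMap.sum_apply, Finset.sum_eq_single j]
      · simp
      · intro i _ hij
        simp [hij.symm]
      · simp
    rw [this]
    exact sum_mem fun i _ => h1 _ (hfI _) _
  rw [← avg_eq_self (μ.linHom (polyRep ρ)) hf]
  have h3 : Y ≤ (Submodule.span ℂ {y | ∃ u ∈ posInv ρ, ∃ s ∈ equivHom ρ μ, y = u • s}).comap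
      (avg (μ.linHom (polyRep ρ))) := by
    refine Submodule.span_le.2 ?_
    rintro _ ⟨u, hu, s, rfl⟩
    refine Submodule.subset_span ⟨u, hu, avg (μ.linHom (polyRep ρ)) s, avg_mem_equivHom ρ μ s, ?_⟩
    refine (map_avg (μ.linHom (polyRep ρ)) (μ.linHom (polyRep ρ))
      ((LinearMap.lsmul (MvPolynomial (Fin n) ℂ) _ u).restrictScalars ℂ) (fun g x => ?_) s).symm
    refine LinearMap.ext fun v => ?_
    simp [hu.1 g]
  exact h3 h2

/-- Graded Nakayama lemma for covariants: a homogeneous family of covariants that spans all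
covariants modulo the invariant ideal spans them over the invariants. -/
theorem mem_span_of_span_mod_invIdeal [Finite Γ] [FiniteDimensional ℂ M] {ι : Type*} [Fintype ι]
    {b : ι → M →ₗ[ℂ] MvPolynomial (Fin n) ℂ}
    (hb : ∀ i, ∃ e, ∀ v, (b i v).IsHomogeneous e)
    (hbX : ∀ i, b i ∈ equivHom ρ μ)
    (hspan : ∀ f ∈ equivHom ρ μ, ∃ α : ι → ℂ, ∀ v, f v - ∑ i, α i • b i v ∈ invIdeal ρ)
    {f : M →ₗ[ℂ] MvPolynomial (Fin n) ℂ} (hf : f ∈ equivHom ρ μ) :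
    f ∈ Submodule.span (invariantRing ρ) (Set.range b) := by
  set P := Submodule.span (invariantRing ρ) (Set.range b) with hP
  have hsmulC : ∀ (c : ℂ) {x : M →ₗ[ℂ] MvPolynomial (Fin n) ℂ}, x ∈ P → c • x ∈ P := by
    intro c x hx
    have := P.smul_mem (algebraMap ℂ (invariantRing ρ) c) hx
    rwa [algebraMap_smul] at this
  have hom : ∀ k, ∀ f ∈ equivHom ρ μ, homComp k f ∈ P := by
    intro k
    induction k using Nat.strong_induction_on with
    | _ k ih =>
      intro f hf
      obtain ⟨α, hα⟩ := hspan f hf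
      set y := f - ∑ i, α i • b i with hy
      have hyX : y ∈ equivHom ρ μ :=
        sub_mem hf (sum_mem fun i _ => Submodule.smul_mem _ _ (hbX i))
      have hyI : ∀ v, y v ∈ invIdeal ρ := fun v => by simpa [hy] using hα v
      have hfy : f = ∑ i, α i • b i + y := by rw [hy]; abel
      rw [hfy, map_add, map_sum]
      refine add_mem (sum_mem fun i _ => ?_) ?_
      · rw [map_smul]
        refine hsmulC _ ?_
        obtain ⟨e, he⟩ := hb i
        have : homComp k (b i) = if k = e then b i else 0 := by
          refine LinearMap.ext fun v => ?_
          rw [homComp_apply, homogeneousComponent_of_mem (he v)]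
          split_ifs <;> rfl
        rw [this]
        split_ifs
        · exact Submodule.subset_span ⟨i, rfl⟩
        · exact zero_mem _
      · have := mem_span_of_forall_mem_invIdeal ρ μ hyX hyI
        clear_value y
        clear hy hfy hyX hyI
        induction this using Submodule.span_induction with
        | zero => rw [map_zero]; exact zero_mem _
        | add x z _ _ hx hz => rw [map_add]; exact add_mem hx hz
        | smul c x _ hx => rw [map_smul]; exact hsmulC _ hx
        | mem x hx =>
          obtain ⟨u, hu, s, hs, rfl⟩ := hx
          have h1 : homComp k (u • s) = ∑ i ∈ Finset.range (u.totalDegree + 1),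
              homComp k (homogeneousComponent i u • s) := by
            rw [← map_sum, ← Finset.sum_smul, sum_homogeneousComponent]
          rw [h1]
          refine sum_mem fun i _ => ?_
          have h2 : homComp k (homogeneousComponent i u • s) =
              if i ≤ k then homogeneousComponent i u • homComp (k - i) s else 0 := by
            refine LinearMap.ext fun v => ?_
            rw [homComp_apply, LinearMap.smul_apply, smul_eq_mul,
              homogeneousComponent_mul_of_isHomogeneous (homogeneousComponent_isHomogeneous i u)]
            split_ifs <;> rfl
          rw [h2]
          split_ifs with hik
          · rcases Nat.eq_zero_or_pos i with rfl | hi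
            · have : homogeneousComponent 0 u = 0 := by
                rw [homogeneousComponent_zero, ← constantCoeff_eq, hu.2, C_0]
              rw [this, zero_smul]
              exact zero_mem _
            · exact P.smul_mem ⟨_, homogeneousComponent_mem_invariantRing ρ hu.1 i⟩
                (ih (k - i) (by omega) s hs)
          · exact zero_mem _
  obtain ⟨K, hK⟩ := exists_sum_homComp f
  rw [hK]
  exact sum_mem fun k _ => hom k f hf

variable {ρ} in
/-- Covariants that are linearly independent modulo the invariant ideal are linearly independent
over `S(V*)`. A relation over `S(V*)` is multiplied by the remaining conjugates of one of its
coefficients; averaging then gives a nontrivial relation over the invariants. -/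
theorem linearIndependent_of_indep_mod_invIdeal [Finite Γ] (hflat : FlatOverInvariants ρ) {t : ℕ}
    {b : Fin t → M →ₗ[ℂ] MvPolynomial (Fin n) ℂ} (hbX : ∀ i, b i ∈ equivHom ρ μ)
    (hb : ∀ α : Fin t → ℂ, (∀ v, ∑ i, α i • b i v ∈ invIdeal ρ) → α = 0) :
    LinearIndependent (MvPolynomial (Fin n) ℂ) b := by
  classical
  have := Fintype.ofFinite Γ
  rw [Fintype.linearIndependent_iff]
  intro s hs i₀
  by_contra hi₀
  set q := ∏ g ∈ Finset.univ.erase (1 : Γ), polyAct (ρ g) (s i₀)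
  let r : Fin t → MvPolynomial (Fin n) ℂ := fun i => avg (polyRep ρ) (q * s i)
  have hrel : ∑ i, r i • b i = 0 := by
    have : avg (μ.linHom (polyRep ρ)) (∑ i, (q * s i) • b i) = 0 := by
      simp_rw [mul_smul, ← Finset.smul_sum, hs, smul_zero, map_zero]
    rw [map_sum] at this
    simpa only [avg_smul_of_mem_equivHom ρ μ (hbX _)] using this
  have hr₀ : r i₀ ≠ 0 := by
    have hq : q * s i₀ = ∏ g : Γ, polyAct (ρ g) (s i₀) := by
      rw [← Finset.prod_erase_mul _ _ (Finset.mem_univ (1 : Γ))]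
      simp [q]
    have hinv : ∀ g, polyRep ρ g (q * s i₀) = q * s i₀ := by
      intro g
      rw [hq, polyRep_apply, map_prod]
      exact Fintype.prod_equiv (Equiv.mulLeft g) _ _ fun h => by simp [map_mul]
    change avg (polyRep ρ) (q * s i₀) ≠ 0
    rw [avg_eq_self _ hinv, hq]
    exact Finset.prod_ne_zero_iff.2 fun g _ h =>
      hi₀ (polyAct_injective (ρ g) (h.trans (map_zero _).symm))
  obtain ⟨α, hα, hαI⟩ := hflat t r (fun i => avg_mem_invariantRing ρ _)
    (fun h => hr₀ (congrFun h i₀))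
  refine hα (hb α fun v => hαI _ ?_)
  simpa using LinearMap.congr_fun hrel v

theorem card_le_finrank_of_linearIndependent [FiniteDimensional ℂ M] {t : ℕ}
    {b : Fin t → M →ₗ[ℂ] MvPolynomial (Fin n) ℂ}
    (hb : LinearIndependent (MvPolynomial (Fin n) ℂ) b) : t ≤ Module.finrank ℂ M := by
  have := hb.fintype_card_le_finrank
  rwa [Fintype.card_fin, Module.finrank_linearMap_self] at this

theorem card_le_of_mem_span {ι κ : Type*} [Fintype ι]
    [Fintype κ] {x : ι → M →ₗ[ℂ] MvPolynomial (Fin n) ℂ}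
    (hx : LinearIndependent (MvPolynomial (Fin n) ℂ) x)
    {b : κ → M →ₗ[ℂ] MvPolynomial (Fin n) ℂ}
    (hxb : ∀ i, x i ∈ Submodule.span (MvPolynomial (Fin n) ℂ) (Set.range b)) :
    Fintype.card ι ≤ Fintype.card κ := by
  classical
  have h1 := linearIndependent_le_span' x hx (Set.range b) (by
    rintro _ ⟨i, rfl⟩
    exact hxb i)
  rw [Cardinal.mk_fintype, Nat.cast_le] at h1
  exact h1.trans (Fintype.card_range_le b)

theorem linearIndependent_iff_det_ne_zero {ι : Type*} [Fintype ι] [DecidableEq ι]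
    (β : Module.Basis ι ℂ M) (b : ι → M →ₗ[ℂ] MvPolynomial (Fin n) ℂ) :
    LinearIndependent (MvPolynomial (Fin n) ℂ) b ↔
      (Matrix.of fun i j => b i (β j)).det ≠ 0 := by
  rw [← not_iff_not, not_not, ← Matrix.exists_vecMul_eq_zero_iff,
    Fintype.not_linearIndependent_iff]
  have : ∀ s : ι → MvPolynomial (Fin n) ℂ, ∑ i, s i • b i = 0 ↔
      Matrix.vecMul s (Matrix.of fun i j => b i (β j)) = 0 := by
    intro s
    constructor
    · intro h
      ext1 j
      simpa [Matrix.vecMul, dotProduct] using LinearMap.congr_fun h (β j)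
    · intro h
      refine β.ext fun j => ?_
      simpa [Matrix.vecMul, dotProduct] using congrFun h j
  simp_rw [this, Function.ne_iff, Pi.zero_apply]
  exact ⟨fun ⟨s, h1, h2⟩ => ⟨s, h2, h1⟩, fun ⟨s, h1, h2⟩ => ⟨s, h2, h1⟩⟩

/-- A nonzero determinant has a nonvanishing term. -/
theorem exists_perm_of_linearIndependent {ι : Type*} [Fintype ι] [DecidableEq ι]
    (β : Module.Basis ι ℂ M) {b : ι → M →ₗ[ℂ] MvPolynomial (Fin n) ℂ}
    (hb : LinearIndependent (MvPolynomial (Fin n) ℂ) b) :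
    ∃ π : Equiv.Perm ι, ∀ i, b (π i) (β i) ≠ 0 := by
  have h := (linearIndependent_iff_det_ne_zero β b).1 hb
  rw [Matrix.det_apply] at h
  obtain ⟨π, -, hπ⟩ := Finset.exists_ne_zero_of_sum_ne_zero h
  refine ⟨π, fun i h0 => hπ ?_⟩
  rw [Finset.prod_eq_zero (Finset.mem_univ i) (by simpa using h0), smul_zero]

/-! ### Covariants with prescribed values at a generic point -/

variable [Finite Γ]

/-- A generic vector: it is moved in every coordinate in which the group element acts
nontrivially. -/
theorem exists_generic_vector : ∃ w : Fin n → ℂ, ∀ (g : Γ) (i : Fin n),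
    (ρ g).val.mulVec w i = w i → ∀ v, (ρ g).val.mulVec v i = v i := by
  classical
  have := Fintype.ofFinite Γ
  let l : Γ → Fin n → MvPolynomial (Fin n) ℂ := fun g i => polyAct (ρ g⁻¹) (X i) - X i
  have hl : ∀ g i v, eval v (l g i) = (ρ g).val.mulVec v i - v i := fun g i v => by
    simp [l, eval_polyAct]
  have hne : (∏ g : Γ, ∏ i, if l g i = 0 then 1 else l g i) ≠ 0 := by
    refine Finset.prod_ne_zero_iff.2 fun g _ => Finset.prod_ne_zero_iff.2 fun i _ => ?_
    split_ifs with h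
    · exact one_ne_zero
    · exact h
  obtain ⟨w, hw⟩ : ∃ w, eval w (∏ g : Γ, ∏ i, if l g i = 0 then 1 else l g i) ≠ 0 := by
    by_contra h
    push Not at h
    exact hne (MvPolynomial.funext fun w => by rw [h, map_zero])
  refine ⟨w, fun g i hgi v => ?_⟩
  have h0 : l g i = 0 := by
    by_contra h
    refine hw ?_
    rw [map_prod]
    refine Finset.prod_eq_zero (Finset.mem_univ g) ?_
    rw [map_prod]
    refine Finset.prod_eq_zero (Finset.mem_univ i) ?_
    rw [if_neg h, hl, hgi, sub_self]
  have := hl g i v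
  rwa [h0, map_zero, eq_comm, sub_eq_zero] at this

theorem eval_congr_of_supported {B : Set (Fin n)} {q : MvPolynomial (Fin n) ℂ}
    (hq : q ∈ supported ℂ B) {w w' : Fin n → ℂ} (h : ∀ i ∈ B, w i = w' i) :
    eval w q = eval w' q :=
  eval₂Hom_congr' rfl (fun i hi _ => h i (mem_supported.1 hq hi)) rfl

/-- A polynomial in the coordinates from `B` that separates the `B`-part of a generic vector from
the rest of its orbit. -/
theorem exists_separating_polynomial {w : Fin n → ℂ} (hw : ∀ (g : Γ) (i : Fin n),
    (ρ g).val.mulVec w i = w i → ∀ v, (ρ g).val.mulVec v i = v i) (B : Set (Fin n)) :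
    ∃ q ∈ supported ℂ B, eval w q = 1 ∧ ∀ g, eval ((ρ g).val.mulVec w) q = 0 ∨
      (eval ((ρ g).val.mulVec w) q = 1 ∧ ∀ i ∈ B, ∀ v, (ρ g).val.mulVec v i = v i) := by
  classical
  have := Fintype.ofFinite Γ
  let bad : Γ → Prop := fun g => ∃ i ∈ B, (ρ g).val.mulVec w i ≠ w i
  let F : Γ → MvPolynomial (Fin n) ℂ := fun g =>
    if h : bad g then C ((w h.choose - (ρ g).val.mulVec w h.choose)⁻¹) *
      (X h.choose - C ((ρ g).val.mulVec w h.choose)) else 1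
  have hFw : ∀ g, eval w (F g) = 1 := by
    intro g
    by_cases h : bad g
    · have h1 : w h.choose - (ρ g).val.mulVec w h.choose ≠ 0 :=
        sub_ne_zero.2 h.choose_spec.2.symm
      simp only [F, dif_pos h, map_mul, map_sub, eval_C, eval_X]
      exact inv_mul_cancel₀ h1
    · simp [F, dif_neg h]
  have hFB : ∏ g, F g ∈ supported ℂ B := by
    refine prod_mem fun g _ => ?_
    by_cases h : bad g
    · simp only [F, dif_pos h]
      exact mul_mem (Subalgebra.algebraMap_mem _ _)
        (sub_mem (Algebra.subset_adjoin ⟨_, h.choose_spec.1, rfl⟩) (Subalgebra.algebraMap_mem _ _))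
    · simp only [F, dif_neg h]
      exact one_mem _
  have h1 : eval w (∏ g, F g) = 1 := by
    rw [map_prod]
    exact Finset.prod_eq_one fun g _ => hFw g
  refine ⟨∏ g, F g, hFB, h1, fun g => ?_⟩
  by_cases h : bad g
  · left
    rw [map_prod]
    refine Finset.prod_eq_zero (Finset.mem_univ g) ?_
    simp [F, dif_pos h]
  · right
    simp only [bad, not_exists, not_and, not_not] at h
    exact ⟨(eval_congr_of_supported hFB h).trans h1, fun i hi => hw g i (h i hi)⟩

/-- Averaging `v ↦ φ(v) q`, for a polynomial `q` that takes only the values `0` and `1` on the orbit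
of `w`, gives a covariant whose value at `w` is a nonzero multiple of `φ`. -/
theorem exists_eval_avg_smulRight {w : Fin n → ℂ} {q : MvPolynomial (Fin n) ℂ}
    {φ : M →ₗ[ℂ] ℂ} (hqw : eval w q = 1)
    (hq : ∀ g, eval ((ρ g).val.mulVec w) q = 0 ∨
      (eval ((ρ g).val.mulVec w) q = 1 ∧ ∀ v, φ (μ g v) = φ v)) :
    ∃ c : ℂ, c ≠ 0 ∧
      ∀ v, eval w (avg (μ.linHom (polyRep ρ)) (φ.smulRight q) v) = c * φ v := by
  classical
  have := Fintype.ofFinite Γ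
  let A : Γ → ℕ := fun g => if eval ((ρ g⁻¹).val.mulVec w) q = 0 then 0 else 1
  refine ⟨(Nat.card Γ : ℂ)⁻¹ * (∑ g, A g : ℕ), ?_, fun v => ?_⟩
  · refine mul_ne_zero (inv_ne_zero natCard_ne_zero) (Nat.cast_ne_zero.2 ?_)
    have h1 : A 1 = 1 := by simp [A, hqw]
    have := Finset.single_le_sum (f := A) (fun _ _ => Nat.zero_le _) (Finset.mem_univ (1 : Γ))
    omega
  · rw [avg_apply, LinearMap.smul_apply, LinearMap.sum_apply, smul_eval, map_sum, mul_assoc]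
    congr 1
    rw [Nat.cast_sum, Finset.sum_mul]
    refine Finset.sum_congr rfl fun g _ => ?_
    simp only [Representation.linHom_apply, LinearMap.comp_apply, LinearMap.smulRight_apply,
      map_smul, polyRep_apply, smul_eval, eval_polyAct]
    rw [← map_inv]
    rcases hq g⁻¹ with h | ⟨h1, h2⟩
    · rw [h, show A g = 0 from if_pos h]
      simp
    · rw [h1, h2, show A g = 1 from if_neg (by rw [h1]; exact one_ne_zero)]
      simp

theorem linearIndependent_of_eval {ι : Type*} [Finite ι] (β : Module.Basis ι ℂ M)
    {x : ι → M →ₗ[ℂ] MvPolynomial (Fin n) ℂ} {w : Fin n → ℂ} {c : ι → ℂ} (hc : ∀ i, c i ≠ 0)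
    (hx : ∀ i v, eval w (x i v) = c i * β.coord i v) :
    LinearIndependent (MvPolynomial (Fin n) ℂ) x := by
  classical
  have := Fintype.ofFinite ι
  rw [linearIndependent_iff_det_ne_zero β]
  intro h
  have h1 := congrArg (eval w) h
  rw [RingHom.map_det, map_zero] at h1
  have h2 : (eval w).mapMatrix (Matrix.of fun i j => x i (β j)) = Matrix.diagonal c := by
    ext i j
    rw [RingHom.mapMatrix_apply, Matrix.map_apply, Matrix.of_apply, hx, Matrix.diagonal_apply]
    by_cases hij : i = j
    · subst hij; simp
    · simp [hij]
  rw [h2, Matrix.det_diagonal] at h1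
  exact Finset.prod_ne_zero_iff.2 (fun i _ => hc i) h1

/-- The number of independent covariants is the dimension of `M`. -/
theorem exists_linearIndependent_equivHom (hρ : Function.Injective ρ) {ι : Type*} [Finite ι]
    (β : Module.Basis ι ℂ M) : ∃ x : ι → M →ₗ[ℂ] MvPolynomial (Fin n) ℂ,
      (∀ i, x i ∈ equivHom ρ μ) ∧ LinearIndependent (MvPolynomial (Fin n) ℂ) x := by
  obtain ⟨w, hw⟩ := exists_generic_vector ρ
  obtain ⟨q, -, hqw, hq⟩ := exists_separating_polynomial ρ hw Set.univ
  have hq' : ∀ (φ : M →ₗ[ℂ] ℂ) (g : Γ), eval ((ρ g).val.mulVec w) q = 0 ∨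
      (eval ((ρ g).val.mulVec w) q = 1 ∧ ∀ v, φ (μ g v) = φ v) := by
    intro φ g
    refine (hq g).imp_right fun h => ⟨h.1, fun v => ?_⟩
    have : ρ g = 1 := Units.ext (Matrix.mulVec_injective (funext fun v => by
      rw [Units.val_one, Matrix.one_mulVec]
      exact funext fun i => h.2 i trivial v))
    rw [hρ (this.trans (map_one ρ).symm), map_one, Module.End.one_apply]
  choose c hc hx using fun i => exists_eval_avg_smulRight ρ μ (φ := β.coord i) hqw (hq' _)
  exact ⟨_, fun i => avg_mem_equivHom ρ μ _, linearIndependent_of_eval β hc hx⟩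

variable {ρ} in
/-- Covariants of a faithful group with the flatness property are free over the invariants, of rank
`dim M`, with a basis taken from any given set of homogeneous covariants that spans modulo the
invariant ideal. The basis is a largest family in that set that is independent modulo the ideal. -/
theorem exists_basis_equivHom [FiniteDimensional ℂ M] (hflat : FlatOverInvariants ρ)
    (hρ : Function.Injective ρ) (A : Set (M →ₗ[ℂ] MvPolynomial (Fin n) ℂ))
    (hAX : A ⊆ equivHom ρ μ) (hAhom : ∀ f ∈ A, ∃ k, ∀ v, (f v).IsHomogeneous k)
    (hA : ∀ f ∈ equivHom ρ μ, ∃ h ∈ Submodule.span ℂ A, ∀ v, f v - h v ∈ invIdeal ρ) :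
    ∃ b : Fin (Module.finrank ℂ M) → M →ₗ[ℂ] MvPolynomial (Fin n) ℂ, (∀ i, b i ∈ A) ∧
      LinearIndependent (MvPolynomial (Fin n) ℂ) b ∧
      ∀ f ∈ equivHom ρ μ, f ∈ Submodule.span (invariantRing ρ) (Set.range b) := by
  let K : Submodule ℂ (M →ₗ[ℂ] MvPolynomial (Fin n) ℂ) :=
    ⨅ v, ((invIdeal ρ).restrictScalars ℂ).comap (LinearMap.applyₗ v)
  have hK : ∀ f, f ∈ K ↔ ∀ v, f v ∈ invIdeal ρ := fun f => by
    rw [Submodule.mem_iInf]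
    rfl
  have hind : ∀ (t : ℕ) (b : Fin t → M →ₗ[ℂ] MvPolynomial (Fin n) ℂ), (∀ i, b i ∈ A) →
      (∀ α : Fin t → ℂ, ∑ i, α i • b i ∈ K → α = 0) →
      LinearIndependent (MvPolynomial (Fin n) ℂ) b := fun t b hbA hb =>
    linearIndependent_of_indep_mod_invIdeal μ hflat (fun i => hAX (hbA i)) fun α hα =>
      hb α ((hK _).2 fun v => by simpa using hα v)
  obtain ⟨t, b, hbA, hb, hmax⟩ := exists_maximal_indep_mod K A (Module.finrank ℂ M)
    fun t b hbA hb => card_le_finrank_of_linearIndependent (hind t b hbA hb)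
  have hbX : ∀ i, b i ∈ equivHom ρ μ := fun i => hAX (hbA i)
  have hbS := hind t b hbA hb
  have hspan : ∀ f ∈ equivHom ρ μ, f ∈ Submodule.span (invariantRing ρ) (Set.range b) := by
    intro f hf
    refine mem_span_of_span_mod_invIdeal ρ μ (fun i => hAhom _ (hbA i)) hbX (fun f hf => ?_) hf
    obtain ⟨h, hh, hfh⟩ := hA f hf
    obtain ⟨α, hα⟩ := hmax h hh
    refine ⟨α, fun v => ?_⟩
    have := add_mem (hfh v) ((hK _).1 hα v)
    simpa using this
  have hcard : t = Module.finrank ℂ M := by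
    refine le_antisymm (card_le_finrank_of_linearIndependent hbS) ?_
    obtain ⟨x, hxX, hx⟩ := exists_linearIndependent_equivHom ρ μ hρ (Module.finBasis ℂ M)
    have h1 := card_le_of_mem_span hx fun i => Submodule.span_le_restrictScalars (invariantRing ρ)
      (MvPolynomial (Fin n) ℂ) _ (hspan _ (hxX i))
    rwa [Fintype.card_fin, Fintype.card_fin] at h1
  subst hcard
  exact ⟨b, hbA, hbS, hspan⟩

end EquivariantMaps

/-! ### Exponents as degrees of a basis of the covariants -/

section Exponents

variable {n : ℕ} {Γ : Type*} [Group Γ] [Finite Γ] (ρ : Γ →* GL (Fin n) ℂ)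
  {M : Type*} [AddCommGroup M] [Module ℂ M] (μ : Representation ℂ Γ M)

/-- The projection of `S(V*)` onto the harmonic polynomials along the invariant ideal. -/
def harmonicProj : MvPolynomial (Fin n) ℂ →ₗ[ℂ] MvPolynomial (Fin n) ℂ :=
  (harmonics ρ).projection ((invIdeal ρ).restrictScalars ℂ) (isCompl_harmonics_invIdeal ρ)

theorem harmonicProj_mem (f : MvPolynomial (Fin n) ℂ) : harmonicProj ρ f ∈ harmonics ρ :=
  Submodule.projection_apply_mem _ _

theorem sub_harmonicProj_mem (f : MvPolynomial (Fin n) ℂ) : f - harmonicProj ρ f ∈ invIdeal ρ :=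
  Submodule.sub_projection_mem (isCompl_harmonics_invIdeal ρ) f

theorem eq_zero_of_mem_harmonics_of_mem_invIdeal {f : MvPolynomial (Fin n) ℂ}
    (hf : f ∈ harmonics ρ) (hfI : f ∈ invIdeal ρ) : f = 0 :=
  (Submodule.disjoint_def.1 (isCompl_harmonics_invIdeal ρ).disjoint) f hf hfI

theorem harmonicProj_eq {f c : MvPolynomial (Fin n) ℂ} (hc : c ∈ harmonics ρ)
    (hfc : f - c ∈ invIdeal ρ) : harmonicProj ρ f = c := by
  refine sub_eq_zero.1 (eq_zero_of_mem_harmonics_of_mem_invIdeal ρ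
    (sub_mem (harmonicProj_mem ρ f) hc) ?_)
  have := sub_mem hfc (sub_harmonicProj_mem ρ f)
  rwa [sub_sub_sub_cancel_left] at this

theorem harmonicProj_polyAct (g : Γ) (f : MvPolynomial (Fin n) ℂ) :
    harmonicProj ρ (polyAct (ρ g) f) = polyAct (ρ g) (harmonicProj ρ f) := by
  refine harmonicProj_eq ρ ?_ ?_
  · exact polyAct_mem_harmonics ρ (ρ g) (fun h => ⟨g * h * g⁻¹, by simp⟩) (harmonicProj_mem ρ f)
  · rw [← map_sub]
    exact polyAct_mem_invIdeal' ρ g (sub_harmonicProj_mem ρ f)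

theorem harmonicProj_homogeneousComponent (k : ℕ) (f : MvPolynomial (Fin n) ℂ) :
    harmonicProj ρ (homogeneousComponent k f) = homogeneousComponent k (harmonicProj ρ f) := by
  refine harmonicProj_eq ρ ?_ ?_
  · exact homogeneousComponent_mem_harmonics ρ (harmonicProj_mem ρ f) k
  · rw [← map_sub]
    exact homogeneousComponent_mem_invIdeal ρ (sub_harmonicProj_mem ρ f) k

theorem isHomogeneous_harmonicProj {k : ℕ} {f : MvPolynomial (Fin n) ℂ} (hf : f.IsHomogeneous k) :
    (harmonicProj ρ f).IsHomogeneous k := by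
  rw [← homogeneousComponent_eq_self hf, harmonicProj_homogeneousComponent]
  exact homogeneousComponent_isHomogeneous k _

theorem harmonicProj_comp_mem_equivHom {f : M →ₗ[ℂ] MvPolynomial (Fin n) ℂ}
    (hf : f ∈ equivHom ρ μ) : harmonicProj ρ ∘ₗ f ∈ equivHom ρ μ := by
  rw [mem_equivHom] at hf ⊢
  intro g v
  rw [LinearMap.comp_apply, hf, harmonicProj_polyAct, LinearMap.comp_apply]

theorem harmonicProj_mul {r : MvPolynomial (Fin n) ℂ} (hr : r ∈ invariantRing ρ)
    (f : MvPolynomial (Fin n) ℂ) :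
    harmonicProj ρ (r * f) = constantCoeff r • harmonicProj ρ f := by
  refine harmonicProj_eq ρ (Submodule.smul_mem _ _ (harmonicProj_mem ρ f)) ?_
  have : r * f - constantCoeff r • harmonicProj ρ f =
      (r - C (constantCoeff r)) * f + constantCoeff r • (f - harmonicProj ρ f) := by
    rw [smul_sub, smul_eq_C_mul f]; ring
  rw [this]
  exact add_mem (Ideal.mul_mem_right _ _
      (posInv_subset_invIdeal ρ (sub_C_mem_posInv ρ hr)))
    (Submodule.smul_mem ((invIdeal ρ).restrictScalars ℂ) _ (sub_harmonicProj_mem ρ f))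

variable {ρ μ}

omit [Finite Γ] in
theorem eq_sum_of_mem_span {ι : Type*} [Fintype ι] {b : ι → M →ₗ[ℂ] MvPolynomial (Fin n) ℂ}
    {f : M →ₗ[ℂ] MvPolynomial (Fin n) ℂ}
    (hf : f ∈ Submodule.span (invariantRing ρ) (Set.range b)) :
    ∃ r : ι → MvPolynomial (Fin n) ℂ, (∀ i, r i ∈ invariantRing ρ) ∧ f = ∑ i, r i • b i := by
  obtain ⟨c, hc⟩ := (Submodule.mem_span_range_iff_exists_fun _).1 hf
  exact ⟨fun i => c i, fun i => (c i).2, hc.symm⟩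

/-- A basis of the covariants over the invariants is linearly independent modulo the invariant
ideal. -/
theorem eq_zero_of_sum_mem_invIdeal [FiniteDimensional ℂ M] {ι : Type*} [Fintype ι]
    {b : ι → M →ₗ[ℂ] MvPolynomial (Fin n) ℂ} (hbX : ∀ i, b i ∈ equivHom ρ μ)
    (hli : LinearIndependent (MvPolynomial (Fin n) ℂ) b)
    (hspan : ∀ f ∈ equivHom ρ μ, f ∈ Submodule.span (invariantRing ρ) (Set.range b))
    {α : ι → ℂ} (hα : ∀ v, ∑ i, α i • b i v ∈ invIdeal ρ) : α = 0 := by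
  have h1 := mem_span_of_forall_mem_invIdeal ρ μ (f := ∑ i, α i • b i)
    (sum_mem fun i _ => Submodule.smul_mem _ _ (hbX i)) (fun v => by simpa using hα v)
  have h2 : ∀ y ∈ Submodule.span ℂ {y | ∃ u ∈ posInv ρ, ∃ s ∈ equivHom ρ μ, y = u • s},
      ∃ r : ι → MvPolynomial (Fin n) ℂ, (∀ i, constantCoeff (r i) = 0) ∧ y = ∑ i, r i • b i := by
    intro y hy
    induction hy using Submodule.span_induction with
    | zero => exact ⟨0, fun i => by simp, by simp⟩
    | add x y _ _ hx hy =>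
      obtain ⟨r, hr, rfl⟩ := hx
      obtain ⟨r', hr', rfl⟩ := hy
      exact ⟨r + r', fun i => by simp [hr, hr'], by simp [add_smul, Finset.sum_add_distrib]⟩
    | smul c x _ hx =>
      obtain ⟨r, hr, rfl⟩ := hx
      exact ⟨c • r, fun i => by simp [hr, constantCoeff_smul], by
        rw [Finset.smul_sum]
        exact Finset.sum_congr rfl fun i _ => (smul_assoc c (r i) (b i)).symm⟩
    | mem y hy =>
      obtain ⟨u, hu, s, hs, rfl⟩ := hy
      obtain ⟨r, -, rfl⟩ := eq_sum_of_mem_span (hspan s hs)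
      exact ⟨fun i => u * r i, fun i => by simp [hu.2], by simp [Finset.smul_sum, mul_smul]⟩
  obtain ⟨r, hr0, hr⟩ := h2 _ h1
  have h3 : ∑ i, (C (α i) - r i) • b i = 0 := by
    have : ∀ i, α i • b i = (C (α i) : MvPolynomial (Fin n) ℂ) • b i := fun i => by
      refine LinearMap.ext fun v => ?_
      rw [LinearMap.smul_apply, LinearMap.smul_apply, smul_eq_mul, smul_eq_C_mul]
    rw [Finset.sum_congr rfl fun i _ => sub_smul (C (α i)) (r i) (b i), Finset.sum_sub_distrib,
      ← hr, sub_eq_zero]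
    exact Finset.sum_congr rfl fun i _ => (this i).symm
  have h4 := Fintype.linearIndependent_iff.1 hli _ h3
  refine funext fun i => ?_
  have := congrArg constantCoeff (h4 i)
  simpa [hr0] using this

/-- The `M`-exponents are the degrees of any homogeneous basis of the covariants `Hom_Γ(M, S(V*))`
over the invariants. -/
theorem isExponents_of_basis [FiniteDimensional ℂ M] {m : ℕ} {e : Fin m → ℕ}
    {b : Fin m → M →ₗ[ℂ] MvPolynomial (Fin n) ℂ} (hbX : ∀ i, b i ∈ equivHom ρ μ)
    (hbe : ∀ i v, (b i v).IsHomogeneous (e i))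
    (hli : LinearIndependent (MvPolynomial (Fin n) ℂ) b)
    (hspan : ∀ f ∈ equivHom ρ μ, f ∈ Submodule.span (invariantRing ρ) (Set.range b)) :
    IsExponents ρ μ e := by
  classical
  ext k
  rw [fakeDegree, PowerSeries.coeff_mk, map_sum]
  simp_rw [PowerSeries.coeff_X_pow]
  rw [← Finset.sum_filter, Finset.sum_const, smul_eq_mul, mul_one, ← Fintype.card_subtype]
  let c : Fin m → M →ₗ[ℂ] MvPolynomial (Fin n) ℂ := fun i => harmonicProj ρ ∘ₗ b i
  have hce : ∀ i v, (c i v).IsHomogeneous (e i) := fun i v => isHomogeneous_harmonicProj ρ (hbe i v)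
  have hcli : LinearIndependent ℂ c := by
    rw [Fintype.linearIndependent_iff]
    intro α hα
    refine congrFun (eq_zero_of_sum_mem_invIdeal hbX hli hspan fun v => ?_)
    have h1 := sub_harmonicProj_mem ρ (∑ i, α i • b i v)
    have h2 : harmonicProj ρ (∑ i, α i • b i v) = 0 := by
      simpa [c] using LinearMap.congr_fun hα v
    rwa [h2, sub_zero] at h1
  let val : Representation.IntertwiningMap μ (harmonicPiece ρ k).toRepresentation →ₗ[ℂ]
      (M →ₗ[ℂ] MvPolynomial (Fin n) ℂ) :=
    { toFun := fun f => (harmonicPiece ρ k).toSubmodule.subtype ∘ₗ f.toLinearMap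
      map_add' := fun _ _ => rfl
      map_smul' := fun _ _ => rfl }
  have hval : Function.Injective val := fun f g h => Representation.IntertwiningMap.ext <|
    LinearMap.ext fun v => Subtype.ext (LinearMap.congr_fun h v)
  have hrange : LinearMap.range val =
      Submodule.span ℂ (Set.range fun i : {i // k = e i} => c i) := by
    refine le_antisymm ?_ (Submodule.span_le.2 ?_)
    · rintro _ ⟨f, rfl⟩
      have hf : val f ∈ equivHom ρ μ := mem_equivHom.2 fun g v =>
        congrArg Subtype.val (LinearMap.congr_fun (f.isIntertwining' g) v)
      obtain ⟨r, hr, hfr⟩ := eq_sum_of_mem_span (hspan _ hf)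
      have h1 : val f = ∑ i, constantCoeff (r i) • if k = e i then c i else 0 := by
        refine LinearMap.ext fun v => ?_
        have h2 : val f v = homogeneousComponent k (harmonicProj ρ (val f v)) := by
          rw [harmonicProj_eq ρ (f v).2.1 (by
            rw [show val f v - (f v : MvPolynomial (Fin n) ℂ) = 0 from sub_self _]
            exact zero_mem _)]
          exact (homogeneousComponent_eq_self (f v).2.2).symm
        rw [h2, hfr, LinearMap.sum_apply, map_sum, map_sum, LinearMap.sum_apply]
        refine Finset.sum_congr rfl fun i _ => ?_
        rw [LinearMap.smul_apply, smul_eq_mul, harmonicProj_mul ρ (hr _), map_smul,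
          LinearMap.smul_apply, ← LinearMap.comp_apply (harmonicProj ρ),
          homogeneousComponent_of_mem (hce i v)]
        split_ifs <;> rfl
      rw [h1]
      refine sum_mem fun i _ => Submodule.smul_mem _ _ ?_
      split_ifs with hi
      · exact Submodule.subset_span ⟨⟨i, hi⟩, rfl⟩
      · exact zero_mem _
    · rintro _ ⟨⟨i, rfl⟩, rfl⟩
      have hc : c i ∈ equivHom ρ μ := harmonicProj_comp_mem_equivHom ρ μ (hbX i)
      exact ⟨{ toLinearMap := LinearMap.codRestrict (harmonicPiece ρ (e i)).toSubmodule (c i)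
                  fun v => ⟨harmonicProj_mem ρ _, hce i v⟩
               isIntertwining' := fun g => LinearMap.ext fun v => Subtype.ext <|
                  mem_equivHom.1 hc g v }, rfl⟩
  rw [(LinearEquiv.ofInjective val hval).finrank_eq, hrange,
    finrank_span_eq_card (b := fun i : {i // k = e i} => c i)
      (hcli.comp _ Subtype.val_injective)]

end Exponents

/-! ### Gradients of invariants -/

section Gradients

variable {n : ℕ}

/-- The differential of a polynomial, as a map `v ↦ ∂_v f` from `V` to `S(V*)`. -/
def grad : MvPolynomial (Fin n) ℂ →ₗ[ℂ] (Fin n → ℂ) →ₗ[ℂ] MvPolynomial (Fin n) ℂ :=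
  ∑ i, (LinearMap.smulRightₗ (LinearMap.proj i : (Fin n → ℂ) →ₗ[ℂ] ℂ)) ∘ₗ
    (pderiv (R := ℂ) i).toLinearMap

theorem grad_apply (f : MvPolynomial (Fin n) ℂ) (v : Fin n → ℂ) :
    grad f v = ∑ i, v i • pderiv i f := by
  simp [grad, LinearMap.sum_apply]

theorem grad_single (f : MvPolynomial (Fin n) ℂ) (i : Fin n) :
    grad f (Pi.single i 1) = pderiv i f := by
  rw [grad_apply, Finset.sum_eq_single i]
  · simp
  · intro j _ hj; simp [hj]
  · simp

theorem grad_C (c : ℂ) : grad (C c : MvPolynomial (Fin n) ℂ) = 0 :=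
  LinearMap.ext fun v => by simp [grad_apply]

theorem grad_mul (f h : MvPolynomial (Fin n) ℂ) : grad (f * h) = f • grad h + h • grad f := by
  refine LinearMap.ext fun v => ?_
  simp only [LinearMap.add_apply, LinearMap.smul_apply, grad_apply, Derivation.leibniz, smul_add,
    Finset.sum_add_distrib, smul_eq_mul, Finset.mul_sum, mul_smul_comm]

theorem grad_aeval {ι : Type*} [Fintype ι] (F : ι → MvPolynomial (Fin n) ℂ) (P : MvPolynomial ι ℂ) :
    grad (aeval F P) = ∑ i, aeval F (pderiv i P) • grad (F i) := by
  classical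
  induction P using MvPolynomial.induction_on with
  | C c => rw [aeval_C, algebraMap_eq, grad_C]; simp
  | add p q hp hq =>
    simp_rw [map_add, add_smul, Finset.sum_add_distrib]
    rw [hp, hq]
  | mul_X p i hp =>
    have h : ∀ j, aeval F (pderiv j (p * X i)) • grad (F j) =
        (F i) • (aeval F (pderiv j p) • grad (F j)) +
          if j = i then aeval F p • grad (F j) else 0 := by
      intro j
      rw [Derivation.leibniz, pderiv_X, map_add, add_smul, add_comm]
      congr 1
      · simp [mul_smul]
      · by_cases hij : i = j
        · subst hij; simp
        · simp [hij, Ne.symm hij]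
    rw [Finset.sum_congr rfl fun j _ => h j, Finset.sum_add_distrib, Finset.sum_ite_eq',
      if_pos (Finset.mem_univ i), ← Finset.smul_sum, ← hp, map_mul, aeval_X, grad_mul, add_comm]

theorem grad_mem_span_of_mem_adjoin {T : Set (MvPolynomial (Fin n) ℂ)}
    {f : MvPolynomial (Fin n) ℂ} (hf : f ∈ Algebra.adjoin ℂ T) :
    grad f ∈ Submodule.span (MvPolynomial (Fin n) ℂ) (grad '' T) := by
  induction hf using Algebra.adjoin_induction with
  | mem x hx => exact Submodule.subset_span ⟨x, hx, rfl⟩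
  | algebraMap c => rw [algebraMap_eq, grad_C]; exact zero_mem _
  | add x y _ _ hx hy => rw [map_add]; exact add_mem hx hy
  | mul x y _ _ hx hy =>
    rw [grad_mul]
    exact add_mem (Submodule.smul_mem _ _ hy) (Submodule.smul_mem _ _ hx)

theorem eq_C_of_pderiv_eq_zero {ι : Type*} {P : MvPolynomial ι ℂ} (h : ∀ i, pderiv i P = 0) :
    P = C (constantCoeff P) := by
  classical
  ext m
  rw [coeff_C]
  split_ifs with hm
  · rw [← hm]; rfl
  · obtain ⟨i, hi⟩ : ∃ i, m i ≠ 0 := by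
      by_contra hcon
      push Not at hcon
      exact hm (Finsupp.ext fun i => by simp [hcon i])
    have h1 := congrArg (coeff (m - Finsupp.single i 1)) (h i)
    rw [coeff_pderiv, coeff_zero, tsub_add_cancel_of_le (by
      rw [Finsupp.single_le_iff]; omega)] at h1
    refine (mul_eq_zero.1 h1).resolve_right ?_
    norm_cast

theorem totalDegree_pderiv_lt {ι : Type*} {P : MvPolynomial ι ℂ} {i : ι}
    (h : pderiv i P ≠ 0) : (pderiv i P).totalDegree < P.totalDegree := by
  classical
  obtain ⟨m, hm, hdeg⟩ : ∃ m ∈ (pderiv i P).support,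
      (pderiv i P).totalDegree = m.degree := by
    have := Finset.exists_mem_eq_sup (pderiv i P).support (support_nonempty.2 h)
      (fun s : ι →₀ ℕ => s.sum fun _ e => e)
    exact this
  rw [hdeg]
  rw [mem_support_iff, coeff_pderiv] at hm
  have h1 := le_totalDegree (mem_support_iff.2 (left_ne_zero_of_mul hm))
  have h2 : (m + Finsupp.single i 1).degree ≤ P.totalDegree := h1
  rw [map_add, Finsupp.degree_single] at h2
  omega

/-- Polynomials with independent differentials are algebraically independent. -/
theorem algebraicIndependent_of_grad {ι : Type*} [Fintype ι] {F : ι → MvPolynomial (Fin n) ℂ}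
    (hF : LinearIndependent (MvPolynomial (Fin n) ℂ) fun i => grad (F i)) :
    AlgebraicIndependent ℂ F := by
  rw [algebraicIndependent_iff]
  suffices H : ∀ d, ∀ P : MvPolynomial ι ℂ, P.totalDegree < d → aeval F P = 0 → P = 0 from
    fun P => H _ P (Nat.lt_succ_self _)
  intro d
  induction d with
  | zero => exact fun P h => absurd h (Nat.not_lt_zero _)
  | succ d ih =>
    intro P hP hFP
    have h1 := grad_aeval F P
    rw [hFP, map_zero] at h1
    have h2 := Fintype.linearIndependent_iff.1 hF _ h1.symm
    have h3 : ∀ i, pderiv i P = 0 := by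
      intro i
      by_contra hne
      have := totalDegree_pderiv_lt hne
      exact hne (ih _ (by omega) (h2 i))
    rw [eq_C_of_pderiv_eq_zero h3, ← algebraMap_eq, AlgHom.commutes, algebraMap_eq,
      C_eq_zero] at hFP
    rw [eq_C_of_pderiv_eq_zero h3, hFP, C_0]

variable {Γ : Type*} [Group Γ] (ρ : Γ →* GL (Fin n) ℂ)

theorem grad_polyAct (a : GL (Fin n) ℂ) (f : MvPolynomial (Fin n) ℂ) (v : Fin n → ℂ) :
    grad (polyAct a f) (a.val.mulVec v) = polyAct a (grad f v) := by
  have hv : ∀ j, ∑ i, (a.val.mulVec v) i * (a⁻¹).val j i = v j := by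
    intro j
    have : (a⁻¹).val.mulVec (a.val.mulVec v) j = v j := by
      rw [Matrix.mulVec_mulVec, ← Units.val_mul, inv_mul_cancel, Units.val_one, Matrix.one_mulVec]
    rw [← this]
    exact Finset.sum_congr rfl fun i _ => mul_comm _ _
  rw [grad_apply, grad_apply]
  simp_rw [pderiv_polyAct, ← map_smul]
  rw [← map_sum]
  congr 1
  simp_rw [Finset.smul_sum, smul_smul]
  rw [Finset.sum_comm]
  refine Finset.sum_congr rfl fun j _ => ?_
  rw [← Finset.sum_smul, hv]

theorem linHom_grad (g : Γ) (f : MvPolynomial (Fin n) ℂ) :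
    grad (polyAct (ρ g) f) = (matrixModule ρ).linHom (polyRep ρ) g (grad f) := by
  refine LinearMap.ext fun v => ?_
  have h : v = (ρ g).val.mulVec ((ρ g⁻¹).val.mulVec v) := by
    rw [Matrix.mulVec_mulVec, ← Units.val_mul, ← map_mul, mul_inv_cancel, map_one, Units.val_one,
      Matrix.one_mulVec]
  conv_lhs => rw [h, grad_polyAct]
  rfl

theorem grad_mem_equivHom {f : MvPolynomial (Fin n) ℂ} (hf : f ∈ invariantRing ρ) :
    grad f ∈ equivHom ρ (matrixModule ρ) := by
  intro g
  rw [← linHom_grad, hf g]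

theorem grad_avg [Finite Γ] (f : MvPolynomial (Fin n) ℂ) :
    grad (avg (polyRep ρ) f) = avg ((matrixModule ρ).linHom (polyRep ρ)) (grad f) :=
  map_avg _ _ grad (fun g x => linHom_grad ρ g x) f

/-! ### Fundamental invariants -/

theorem mem_posInv_mul_posInv [Finite Γ] {y : MvPolynomial (Fin n) ℂ} (hy : y ∈ invariantRing ρ)
    {p : Fin n → MvPolynomial (Fin n) ℂ} (hp : ∀ i, p i ∈ invIdeal ρ)
    (hyp : y = ∑ i, X i * p i) : y ∈ posInv ρ * posInv ρ := by
  have key : ∀ q ∈ invIdeal ρ, ∀ s, constantCoeff s = 0 →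
      avg (polyRep ρ) (s * q) ∈ posInv ρ * posInv ρ := by
    intro q hq
    induction hq using Submodule.span_induction with
    | zero => intro s _; rw [mul_zero, map_zero]; exact zero_mem _
    | add p q _ _ hp hq => intro s hs; rw [mul_add, map_add]; exact add_mem (hp s hs) (hq s hs)
    | smul a p _ hp =>
      intro s hs
      rw [smul_eq_mul, ← mul_assoc]
      exact hp _ (by rw [map_mul, hs, zero_mul])
    | mem u hu =>
      intro s hs
      rw [mul_comm s u, avg_mul_of_mem ρ hu.1]
      exact Submodule.mul_mem_mul hu
        ⟨avg_mem_invariantRing ρ s, (constantCoeff_avg ρ s).trans hs⟩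
  rw [← avg_eq_self (polyRep ρ) hy, hyp, map_sum]
  exact sum_mem fun i _ => key _ (hp i) _ (constantCoeff_X _ i)

variable {ρ}

/-- Homogeneous invariants of positive degree that are independent modulo products have independent
differentials. This is Euler's identity. -/
theorem linearIndependent_grad [Finite Γ] (hflat : FlatOverInvariants ρ) {t : ℕ}
    {F : Fin t → MvPolynomial (Fin n) ℂ} {d : Fin t → ℕ} (hF : ∀ i, F i ∈ invariantRing ρ)
    (hd : ∀ i, (F i).IsHomogeneous (d i)) (hd0 : ∀ i, d i ≠ 0)
    (hind : ∀ α : Fin t → ℂ, ∑ i, α i • F i ∈ posInv ρ * posInv ρ → α = 0) :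
    LinearIndependent (MvPolynomial (Fin n) ℂ) fun i => grad (F i) := by
  refine linearIndependent_of_indep_mod_invIdeal (matrixModule ρ) hflat
    (fun i => grad_mem_equivHom ρ (hF i)) fun α hα => ?_
  have h1 := hind (fun i => α i * d i) (mem_posInv_mul_posInv ρ
    (sum_mem fun i _ => Subalgebra.smul_mem _ (hF i) _)
    (p := fun l => ∑ i, α i • pderiv l (F i)) (fun l => ?_) ?_)
  · refine funext fun i => ?_
    exact (mul_eq_zero.1 (congrFun h1 i)).resolve_right (Nat.cast_ne_zero.2 (hd0 i))
  · have := hα (Pi.single l 1)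
    simpa only [grad_single] using this
  · simp_rw [Finset.mul_sum]
    rw [Finset.sum_comm]
    refine Finset.sum_congr rfl fun i _ => ?_
    simp_rw [mul_smul_comm]
    rw [← Finset.smul_sum, (hd i).sum_X_mul_pderiv, ← Nat.cast_smul_eq_nsmul ℂ, smul_smul]

/-- Homogeneous invariants that span all invariants modulo products generate the ring of
invariants. -/
theorem adjoin_eq_invariantRing {ι : Type*} [Fintype ι]
    {F : ι → MvPolynomial (Fin n) ℂ} {d : ι → ℕ} (hF : ∀ i, F i ∈ invariantRing ρ)
    (hd : ∀ i, (F i).IsHomogeneous (d i))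
    (hspan : ∀ u ∈ posInv ρ, ∃ α : ι → ℂ, u - ∑ i, α i • F i ∈ posInv ρ * posInv ρ) :
    Algebra.adjoin ℂ (Set.range F) = invariantRing ρ := by
  refine le_antisymm (Algebra.adjoin_le (by rintro _ ⟨i, rfl⟩; exact hF i)) ?_
  set A := Algebra.adjoin ℂ (Set.range F)
  have hom : ∀ k, ∀ u ∈ invariantRing ρ, homogeneousComponent k u ∈ A := by
    intro k
    induction k using Nat.strong_induction_on with
    | _ k ih =>
      intro u hu
      rcases Nat.eq_zero_or_pos k with rfl | hk
      · rw [homogeneousComponent_zero]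
        exact A.algebraMap_mem _
      have h1 : homogeneousComponent k u = homogeneousComponent k (u - C (constantCoeff u)) := by
        rw [map_sub, homogeneousComponent_of_mem (isHomogeneous_C (Fin n) (constantCoeff u)),
          if_neg hk.ne', sub_zero]
      rw [h1]
      obtain ⟨α, hα⟩ := hspan _ (sub_C_mem_posInv ρ hu)
      set y := u - C (constantCoeff u)
      have h2 : homogeneousComponent k y = ∑ i, α i • homogeneousComponent k (F i) +
          homogeneousComponent k (y - ∑ i, α i • F i) := by
        simp [map_sub, map_sum]
      rw [h2]
      refine add_mem (sum_mem fun i _ => A.smul_mem ?_ _) ?_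
      · rw [homogeneousComponent_of_mem (hd i)]
        split_ifs
        · exact Algebra.subset_adjoin ⟨i, rfl⟩
        · exact zero_mem _
      · generalize y - ∑ i, α i • F i = z at hα
        induction hα using Submodule.mul_induction_on' with
        | add a _ b _ ha hb => rw [map_add]; exact add_mem ha hb
        | mem_mul_mem a ha b hb =>
          rw [show a * b = _ from congrArg (· * b) (sum_homogeneousComponent a).symm,
            Finset.sum_mul, map_sum]
          refine sum_mem fun i _ => ?_
          rw [homogeneousComponent_mul_of_isHomogeneous (homogeneousComponent_isHomogeneous i a)]
          split_ifs with hik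
          · have hz : ∀ {u}, u ∈ posInv ρ → homogeneousComponent 0 u = 0 := fun {u} hu => by
              rw [homogeneousComponent_zero, ← constantCoeff_eq, hu.2, C_0]
            rcases Nat.eq_zero_or_pos i with rfl | hi
            · rw [hz ha, zero_mul]; exact zero_mem _
            · rcases hik.lt_or_eq with hlt | rfl
              · exact mul_mem (ih i hlt a ha.1) (ih (k - i) (by omega) b hb.1)
              · rw [Nat.sub_self, hz hb, mul_zero]; exact zero_mem _
          · exact zero_mem _
  intro u hu
  rw [← sum_homogeneousComponent u]
  exact sum_mem fun k _ => hom k u hu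

end Gradients

/-! ### Multihomogeneous polynomials -/

section Blocks

variable {n : ℕ} {D : Type*}

/-- The multidegree of the variables of `S(V*)` for a partition of the coordinates of `V` into
blocks, labelled by `δ`. -/
def blockWeight (δ : Fin n → D) (i : Fin n) : D →₀ ℕ := Finsupp.single (δ i) 1

theorem IsWeightedHomogeneous.aeval_of_addMonoidHom {σ τ A B : Type*} [AddCommMonoid A]
    [AddCommMonoid B] {w : σ → A} {w' : τ → B} (θ : A →+ B) {p : MvPolynomial σ ℂ} {a : A}
    (hp : IsWeightedHomogeneous w p a) {F : σ → MvPolynomial τ ℂ}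
    (hF : ∀ i, IsWeightedHomogeneous w' (F i) (θ (w i))) :
    IsWeightedHomogeneous w' (aeval F p) (θ a) := by
  rw [aeval_def, eval₂_eq]
  refine IsWeightedHomogeneous.sum _ _ _ fun m hm => ?_
  rw [algebraMap_eq]
  refine IsWeightedHomogeneous.C_mul ?_ _
  have h1 : θ a = ∑ i ∈ m.support, m i • θ (w i) := by
    rw [← hp (mem_support_iff.1 hm), Finsupp.weight_apply, Finsupp.sum, map_sum]
    simp
  rw [h1]
  exact IsWeightedHomogeneous.prod _ _ _ fun i _ => (hF i).pow _

theorem isHomogeneous_of_blockWeight {δ : Fin n → D} {p : MvPolynomial (Fin n) ℂ} {a : D →₀ ℕ}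
    (hp : IsWeightedHomogeneous (blockWeight δ) p a) : p.IsHomogeneous a.degree := by
  have := IsWeightedHomogeneous.aeval_of_addMonoidHom (w' := (1 : Fin n → ℕ))
    (Finsupp.degree : (D →₀ ℕ) →+ ℕ) hp
    (F := X) (fun i => by
      rw [blockWeight, Finsupp.degree_single]
      exact isWeightedHomogeneous_X ℂ _ i)
  rwa [aeval_X_left_apply] at this

theorem polyAct_isWeightedHomogeneous {δ : Fin n → D} {a : GL (Fin n) ℂ}
    (ha : ∀ i j, (a⁻¹).val i j ≠ 0 → δ i = δ j) {p : MvPolynomial (Fin n) ℂ} {b : D →₀ ℕ}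
    (hp : IsWeightedHomogeneous (blockWeight δ) p b) :
    IsWeightedHomogeneous (blockWeight δ) (polyAct a p) b := by
  refine IsWeightedHomogeneous.aeval_of_addMonoidHom (AddMonoidHom.id _) hp fun i => ?_
  refine IsWeightedHomogeneous.sum _ _ _ fun j _ => ?_
  by_cases hij : (a⁻¹).val i j = 0
  · rw [hij, zero_smul]
    exact isWeightedHomogeneous_zero _ _ _
  · rw [smul_eq_C_mul]
    refine IsWeightedHomogeneous.C_mul ?_ _
    have := isWeightedHomogeneous_X ℂ (blockWeight δ) j
    rwa [blockWeight, ← ha i j hij] at this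

theorem exists_sum_weightedHomogeneousComponent {A : Type*} [AddCommMonoid A] (w : Fin n → A)
    (p : MvPolynomial (Fin n) ℂ) :
    ∃ s : Finset A, (∀ b ∉ s, weightedHomogeneousComponent w b p = 0) ∧
      ∀ s', s ⊆ s' → p = ∑ b ∈ s', weightedHomogeneousComponent w b p := by
  classical
  have hs : ∀ b ∉ (weightedHomogeneousComponent_finsupp (w := w) p).toFinset,
      weightedHomogeneousComponent w b p = 0 := fun b hb => by
    by_contra h
    exact hb ((Set.Finite.mem_toFinset _).2 h)
  refine ⟨_, hs, fun s' hs' => ?_⟩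
  have h1 := sum_weightedHomogeneousComponent w p
  rw [finsum_eq_sum _ (weightedHomogeneousComponent_finsupp p)] at h1
  conv_lhs => rw [← h1]
  exact Finset.sum_subset hs' fun b _ hb => hs b hb

theorem map_weightedHomogeneousComponent {A : Type*} [AddCommMonoid A] {w : Fin n → A}
    (T : MvPolynomial (Fin n) ℂ →ₗ[ℂ] MvPolynomial (Fin n) ℂ)
    (hT : ∀ b p, IsWeightedHomogeneous w p b → IsWeightedHomogeneous w (T p) b)
    (b : A) (p : MvPolynomial (Fin n) ℂ) :
    T (weightedHomogeneousComponent w b p) = weightedHomogeneousComponent w b (T p) := by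
  classical
  obtain ⟨s, hs, hsum⟩ := exists_sum_weightedHomogeneousComponent w p
  conv_rhs => rw [hsum s subset_rfl, map_sum, map_sum]
  have h : ∀ c, weightedHomogeneousComponent w b (T (weightedHomogeneousComponent w c p)) =
      if b = c then T (weightedHomogeneousComponent w c p) else 0 := fun c =>
    weightedHomogeneousComponent_of_mem
      (hT c _ (weightedHomogeneousComponent_isWeightedHomogeneous c p))
  simp_rw [h]
  rw [Finset.sum_ite_eq]
  split_ifs with hb
  · rfl
  · rw [hs b hb, map_zero]

theorem weight_blockWeight_apply [DecidableEq D] (δ : Fin n → D) (m : Fin n →₀ ℕ) (d : D) :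
    Finsupp.weight (blockWeight δ) m d = ∑ i, if δ i = d then m i else 0 := by
  rw [Finsupp.weight_apply, Finsupp.sum_fintype _ _ (by simp), Finsupp.finsetSum_apply]
  refine Finset.sum_congr rfl fun i _ => ?_
  simp [blockWeight, Finsupp.single_apply]

/-- The polynomials in the variables of one block. -/
abbrev blockSupported (δ : Fin n → D) (d : D) : Subalgebra ℂ (MvPolynomial (Fin n) ℂ) :=
  supported ℂ {l | δ l = d}

theorem mem_blockSupported {δ : Fin n → D} {p : MvPolynomial (Fin n) ℂ} {d : D} {k : ℕ}
    (hp : IsWeightedHomogeneous (blockWeight δ) p (Finsupp.single d k)) :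
    p ∈ blockSupported δ d := by
  classical
  rw [mem_supported]
  intro i hi
  obtain ⟨m, hm, hmi⟩ := (mem_vars_iff_mem_support i).1 hi
  by_contra hne
  have h1 := DFunLike.congr_fun (hp (mem_support_iff.1 hm)) (δ i)
  rw [weight_blockWeight_apply, Finsupp.single_eq_of_ne hne] at h1
  have h2 := Finset.sum_eq_zero_iff.1 h1 i (Finset.mem_univ i)
  rw [if_pos rfl] at h2
  exact Finsupp.mem_support_iff.1 hmi h2

open Classical in
/-- The restriction of polynomial functions to one block. -/
def restrictBlock (δ : Fin n → D) (d : D) :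
    MvPolynomial (Fin n) ℂ →ₐ[ℂ] MvPolynomial (Fin n) ℂ :=
  aeval fun l => if δ l = d then X l else 0

theorem restrictBlock_of_mem {δ : Fin n → D} {d : D} {p : MvPolynomial (Fin n) ℂ}
    (hp : p ∈ blockSupported δ d) : restrictBlock δ d p = p := by
  classical
  have : (restrictBlock δ d).toRingHom p = (RingHom.id _) p := by
    refine hom_congr_vars ?_ ?_ rfl
    · ext c; simp [restrictBlock]
    · intro i hi _
      have : δ i = d := mem_supported.1 hp hi
      simp [restrictBlock, this]
  exact this

theorem restrictBlock_eq_zero {δ : Fin n → D} {d d' : D} (hd : d' ≠ d) {a : D →₀ ℕ}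
    (had : a d' ≠ 0) {p : MvPolynomial (Fin n) ℂ}
    (hp : IsWeightedHomogeneous (blockWeight δ) p a) : restrictBlock δ d p = 0 := by
  classical
  rw [restrictBlock, aeval_def, eval₂_eq]
  refine Finset.sum_eq_zero fun m hm => ?_
  have h1 := hp (mem_support_iff.1 hm)
  rw [← h1, weight_blockWeight_apply] at had
  obtain ⟨i, -, hi⟩ := Finset.exists_ne_zero_of_sum_ne_zero had
  have hi' : δ i = d' := by
    by_contra h
    exact hi (if_neg h)
  rw [if_pos hi'] at hi
  rw [Finset.prod_eq_zero (Finsupp.mem_support_iff.2 hi), mul_zero]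
  rw [if_neg (hi' ▸ hd), zero_pow hi]

/-- The restriction of a multihomogeneous polynomial to a block is the polynomial itself or zero. -/
theorem restrictBlock_eq_or (δ : Fin n → D) (d : D) {a : D →₀ ℕ} {p : MvPolynomial (Fin n) ℂ}
    (hp : IsWeightedHomogeneous (blockWeight δ) p a) :
    restrictBlock δ d p = 0 ∨ (restrictBlock δ d p = p ∧ ∃ k, a = Finsupp.single d k) := by
  classical
  by_cases h : ∃ d', d' ≠ d ∧ a d' ≠ 0
  · obtain ⟨d', h1, h2⟩ := h
    exact Or.inl (restrictBlock_eq_zero h1 h2 hp)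
  · push Not at h
    have ha : a = Finsupp.single d (a d) := by
      ext d'
      by_cases hd : d' = d
      · subst hd; simp
      · rw [h d' hd, Finsupp.single_eq_of_ne hd]
    rw [ha] at hp
    exact Or.inr ⟨restrictBlock_of_mem (mem_blockSupported hp), _, ha⟩

end Blocks

/-! ### Fundamental invariants adapted to a block decomposition -/

section BlockInvariants

variable {n : ℕ} {Γ : Type*} [Group Γ] {ρ : Γ →* GL (Fin n) ℂ} {D : Type*}
  {δ : Fin n → D}

theorem polyAct_mem_blockSupported (hδ : ∀ g i j, (ρ g).val i j ≠ 0 → δ i = δ j) (g : Γ) {d : D}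
    {p : MvPolynomial (Fin n) ℂ} (hp : p ∈ blockSupported δ d) :
    polyAct (ρ g) p ∈ blockSupported δ d := by
  have : blockSupported δ d ≤ (blockSupported δ d).comap (polyAct (ρ g)) := by
    refine Algebra.adjoin_le ?_
    rintro _ ⟨i, hi, rfl⟩
    change polyAct (ρ g) (X i) ∈ blockSupported δ d
    rw [polyAct_X]
    refine sum_mem fun j _ => ?_
    by_cases hij : ((ρ g)⁻¹).val i j = 0
    · rw [hij, zero_smul]; exact zero_mem _
    · rw [← map_inv] at hij
      have hj : j ∈ {l | δ l = d} := (hδ _ _ _ hij).symm.trans hi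
      exact (blockSupported δ d).smul_mem (Algebra.subset_adjoin (Set.mem_image_of_mem X hj)) _
  exact this hp

variable [Finite Γ]

theorem eval_avg_congr {M : Type*} [AddCommGroup M] [Module ℂ M] {μ : Representation ℂ Γ M}
    {w : Fin n → ℂ} {f f' : M →ₗ[ℂ] MvPolynomial (Fin n) ℂ}
    (h : ∀ g v, eval ((ρ g).val.mulVec w) (f v) = eval ((ρ g).val.mulVec w) (f' v)) (v : M) :
    eval w (avg (μ.linHom (polyRep ρ)) f v) = eval w (avg (μ.linHom (polyRep ρ)) f' v) := by
  have := Fintype.ofFinite Γ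
  simp only [avg_apply, LinearMap.smul_apply, LinearMap.sum_apply, smul_eval, map_sum,
    Representation.linHom_apply, LinearMap.comp_apply, polyRep_apply, eval_polyAct, ← map_inv, h]

/-- There are invariants in the coordinates of each block whose differentials at a generic point are
multiples of the coordinates. -/
theorem exists_block_invariants (ρ : Γ →* GL (Fin n) ℂ) {δ : Fin n → D}
    (hδ : ∀ g i j, (ρ g).val i j ≠ 0 → δ i = δ j) :
    ∃ y : Fin n → MvPolynomial (Fin n) ℂ, (∀ j, y j ∈ invariantRing ρ) ∧
      (∀ j, y j ∈ blockSupported δ (δ j)) ∧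
      LinearIndependent (MvPolynomial (Fin n) ℂ) fun j => grad (y j) := by
  obtain ⟨w, hw⟩ := exists_generic_vector ρ
  choose q hqB hqw hq using fun d => exists_separating_polynomial ρ hw {l | δ l = d}
  let p : Fin n → MvPolynomial (Fin n) ℂ := fun j => q (δ j) ^ 2 * (X j - C (w j))
  have hpB : ∀ j, p j ∈ blockSupported δ (δ j) := fun j =>
    mul_mem (pow_mem (hqB _) 2) (sub_mem (Algebra.subset_adjoin ⟨j, rfl, rfl⟩)
      (Subalgebra.algebraMap_mem _ _))
  -- At each point of the orbit of `w`, the differential of `p j` agrees with `v ↦ v j • q ^ 2`.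
  have hgrad : ∀ j g v, eval ((ρ g).val.mulVec w) (grad (p j) v) = eval ((ρ g).val.mulVec w)
      ((LinearMap.proj j : (Fin n → ℂ) →ₗ[ℂ] ℂ).smulRight (q (δ j) ^ 2) v) := by
    intro j g v
    have h1 : grad (X j - C (w j) : MvPolynomial (Fin n) ℂ) v = C (v j) := by
      rw [map_sub, grad_C, sub_zero, grad_apply, Finset.sum_eq_single j]
      · rw [pderiv_X_self, smul_eq_C_mul, mul_one]
      · intro i _ hij; rw [pderiv_X_of_ne hij.symm, smul_zero]
      · simp
    rw [show p j = q (δ j) ^ 2 * (X j - C (w j)) from rfl, grad_mul, LinearMap.add_apply,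
      LinearMap.smul_apply, LinearMap.smul_apply, h1]
    simp only [grad_mul, LinearMap.add_apply, LinearMap.smul_apply, smul_eq_mul, map_add, map_mul,
      map_sub, eval_C, eval_X, LinearMap.smulRight_apply, smul_eval, pow_two,
      LinearMap.proj_apply]
    rcases hq (δ j) g with h | ⟨h, h'⟩
    · rw [h]; ring
    · rw [h, h' j rfl]; ring
  have hq' : ∀ j g, eval ((ρ g).val.mulVec w) (q (δ j) ^ 2) = 0 ∨
      (eval ((ρ g).val.mulVec w) (q (δ j) ^ 2) = 1 ∧
        ∀ v, (LinearMap.proj j : (Fin n → ℂ) →ₗ[ℂ] ℂ) (matrixModule ρ g v) =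
          (LinearMap.proj j : (Fin n → ℂ) →ₗ[ℂ] ℂ) v) := by
    intro j g
    rcases hq (δ j) g with h | ⟨h, h'⟩
    · left; rw [map_pow, h]; norm_num
    · right; rw [map_pow, h]; exact ⟨one_pow 2, h' j rfl⟩
  choose c hc hx using fun j => exists_eval_avg_smulRight ρ (matrixModule ρ)
    (show eval w (q (δ j) ^ 2) = 1 by rw [map_pow, hqw, one_pow]) (hq' j)
  refine ⟨fun j => avg (polyRep ρ) (p j), fun j => avg_mem_invariantRing ρ _, fun j => ?_,
    linearIndependent_of_eval (Pi.basisFun ℂ (Fin n)) (w := w) hc fun j v => ?_⟩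
  · exact avg_mem (polyRep ρ) (Subalgebra.toSubmodule (blockSupported δ (δ j)))
      fun g => polyAct_mem_blockSupported hδ g (hpB j)
  · rw [grad_avg, eval_avg_congr (hgrad j), hx]
    simp

theorem isHomogeneous_degree_ne_zero {p : MvPolynomial (Fin n) ℂ} {d : ℕ} (hp : p.IsHomogeneous d)
    (hp0 : p ≠ 0) (hpc : constantCoeff p = 0) : d ≠ 0 := by
  rintro rfl
  refine hp0 ?_
  rw [← homogeneousComponent_eq_self hp, homogeneousComponent_zero, ← constantCoeff_eq, hpc, C_0]

/-- A faithful group with the flatness property that preserves a decomposition of the coordinates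
into blocks has fundamental invariants each of which only involves the coordinates of one block, the
`i`-th those of the block of `i`. -/
theorem exists_block_fundamental_invariants (hflat : FlatOverInvariants ρ)
    (hδ : ∀ g i j, (ρ g).val i j ≠ 0 → δ i = δ j) :
    ∃ (F : Fin n → MvPolynomial (Fin n) ℂ) (k : Fin n → ℕ), AlgebraicIndependent ℂ F ∧
      Algebra.adjoin ℂ (Set.range F) = invariantRing ρ ∧
      ∀ i, IsWeightedHomogeneous (blockWeight δ) (F i) (Finsupp.single (δ i) (k i)) := by
  classical
  have hδ' : ∀ g i j, ((ρ g)⁻¹).val i j ≠ 0 → δ i = δ j := fun g i j h =>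
    hδ g⁻¹ i j (by rwa [map_inv])
  let A : Set (MvPolynomial (Fin n) ℂ) :=
    {f | f ∈ posInv ρ ∧ ∃ a, IsWeightedHomogeneous (blockWeight δ) f a}
  have hgradInd : ∀ (t : ℕ) (b : Fin t → MvPolynomial (Fin n) ℂ), (∀ i, b i ∈ A) →
      (∀ α : Fin t → ℂ, ∑ i, α i • b i ∈ posInv ρ * posInv ρ → α = 0) →
      LinearIndependent (MvPolynomial (Fin n) ℂ) fun i => grad (b i) := by
    intro t b hbA hb
    choose a ha using fun i => (hbA i).2
    refine linearIndependent_grad hflat (fun i => (hbA i).1.1)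
      (fun i => isHomogeneous_of_blockWeight (ha i)) (fun i => ?_) hb
    refine isHomogeneous_degree_ne_zero (isHomogeneous_of_blockWeight (ha i)) (fun h0 => ?_)
      (hbA i).1.2
    have := congrFun (hb (Pi.single i 1) (by simp [Pi.single_apply, h0])) i
    simp at this
  obtain ⟨t, F, hFA, hF, hmax⟩ := exists_maximal_indep_mod (posInv ρ * posInv ρ) A n
    (fun t b hbA hb => by
      have := card_le_finrank_of_linearIndependent (hgradInd t b hbA hb)
      rwa [Module.finrank_fin_fun] at this)
  have hgF := hgradInd t F hFA hF
  choose a ha using fun i => (hFA i).2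
  have hFadj : Algebra.adjoin ℂ (Set.range F) = invariantRing ρ := by
    refine adjoin_eq_invariantRing (fun i => (hFA i).1.1)
      (fun i => isHomogeneous_of_blockWeight (ha i)) fun u hu => hmax u ?_
    obtain ⟨s, -, hs⟩ := exists_sum_weightedHomogeneousComponent (blockWeight δ) u
    rw [hs s subset_rfl]
    refine sum_mem fun b _ => Submodule.subset_span ⟨⟨fun g => ?_, ?_⟩, b,
      weightedHomogeneousComponent_isWeightedHomogeneous b u⟩
    · have := map_weightedHomogeneousComponent (polyAct (ρ g)).toLinearMap
        (fun b p hp => polyAct_isWeightedHomogeneous (hδ' g) hp) b u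
      refine this.trans ?_
      rw [AlgHom.toLinearMap_apply, hu.1 g]
    · have h0 := hu.2
      rw [constantCoeff_eq] at h0 ⊢
      rw [coeff_weightedHomogeneousComponent, h0, ite_self]
  obtain ⟨y, hyR, hyB, hy⟩ := exists_block_invariants ρ hδ
  obtain rfl : t = n := by
    refine le_antisymm ?_ ?_
    · have := card_le_finrank_of_linearIndependent hgF
      rwa [Module.finrank_fin_fun] at this
    · have := card_le_of_mem_span hy (b := fun i => grad (F i)) fun j => by
        have := grad_mem_span_of_mem_adjoin (hFadj ▸ hyR j)
        rwa [← Set.range_comp] at this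
      simpa using this
  -- An invariant that involves several blocks would be superfluous for generating the `y j`.
  have hblock : ∀ i, ∃ d k, a i = Finsupp.single d k := by
    intro i₀
    by_contra hcon
    push Not at hcon
    have hyF : ∀ j, y j ∈ Algebra.adjoin ℂ (Set.range fun i : {i // i ≠ i₀} => F i) := by
      intro j
      have h1 : restrictBlock δ (δ j) (y j) ∈
          (Algebra.adjoin ℂ (Set.range F)).map (restrictBlock δ (δ j)) :=
        ⟨y j, by rw [SetLike.mem_coe, hFadj]; exact hyR j, rfl⟩
      rw [restrictBlock_of_mem (hyB j), AlgHom.map_adjoin] at h1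
      refine Algebra.adjoin_le ?_ h1
      rintro _ ⟨_, ⟨i, rfl⟩, rfl⟩
      rcases restrictBlock_eq_or δ (δ j) (ha i) with h | ⟨h, k, hk⟩
      · rw [h]; exact zero_mem _
      · rw [h]
        exact Algebra.subset_adjoin ⟨⟨i, fun hi => hcon _ k (hi ▸ hk)⟩, rfl⟩
    have := card_le_of_mem_span hy (b := fun i : {i // i ≠ i₀} => grad (F i)) fun j => by
      have := grad_mem_span_of_mem_adjoin (hyF j)
      rwa [← Set.range_comp] at this
    rw [Fintype.card_subtype_compl, Fintype.card_subtype_eq, Fintype.card_fin] at this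
    have := i₀.pos
    omega
  choose d k hdk using hblock
  obtain ⟨π, hπ⟩ := exists_perm_of_linearIndependent (Pi.basisFun ℂ (Fin t)) hgF
  have hd : ∀ i, d (π i) = δ i := by
    intro i
    have h1 := hπ i
    rw [Pi.basisFun_apply, grad_single] at h1
    have h2 : i ∈ (F (π i)).vars := by
      by_contra h
      exact h1 (pderiv_eq_zero_of_notMem_vars h)
    exact (mem_supported.1 (mem_blockSupported (hdk (π i) ▸ ha (π i))) h2).symm
  refine ⟨fun i => F (π i), fun i => k (π i),
    (algebraicIndependent_of_grad hgF).comp π π.injective, ?_, fun i => ?_⟩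
  · rw [← hFadj, ← π.surjective.range_comp F]
    rfl
  · rw [← hd i, ← hdk]
    exact ha _

end BlockInvariants

/-! ### Linear parts with respect to fundamental invariants -/

section FundamentalInvariants

variable {n : ℕ} {Γ : Type*} [Group Γ] {ρ : Γ →* GL (Fin n) ℂ}
  {F : Fin n → MvPolynomial (Fin n) ℂ} {d : Fin n → ℕ}

namespace IsFundamentalInvariants

variable (hF : IsFundamentalInvariants ρ F d)
include hF

theorem aeval_injective : Function.Injective (aeval F : MvPolynomial (Fin n) ℂ →ₐ[ℂ] _) :=
  hF.2.1

theorem mem_iff {f : MvPolynomial (Fin n) ℂ} :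
    f ∈ invariantRing ρ ↔ ∃ p : MvPolynomial (Fin n) ℂ, aeval F p = f := by
  rw [← hF.2.2, Algebra.adjoin_range_eq_range_aeval]
  rfl

theorem mem_invariantRing (i : Fin n) : F i ∈ invariantRing ρ :=
  hF.mem_iff.2 ⟨X i, aeval_X _ _⟩

theorem degree_ne_zero (i : Fin n) : d i ≠ 0 := by
  intro h
  have h1 := hF.1 i
  rw [h] at h1
  have h2 : F i = C (constantCoeff (F i)) := by
    conv_lhs => rw [← homogeneousComponent_eq_self h1, homogeneousComponent_zero]
    rw [← constantCoeff_eq]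
  have h3 : (X i : MvPolynomial (Fin n) ℂ) = C (constantCoeff (F i)) :=
    hF.aeval_injective (by rw [aeval_X, aeval_C, algebraMap_eq, ← h2])
  have h4 := congrArg (pderiv i) h3
  rw [pderiv_X_self, pderiv_C] at h4
  exact one_ne_zero h4

theorem constantCoeff_eq_zero (i : Fin n) : constantCoeff (F i) = 0 := by
  rw [MvPolynomial.constantCoeff_eq]
  by_contra h
  have := hF.1 i h
  rw [map_zero] at this
  exact hF.degree_ne_zero i this.symm

theorem mem_posInv (i : Fin n) : F i ∈ posInv ρ :=
  ⟨hF.mem_invariantRing i, hF.constantCoeff_eq_zero i⟩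

theorem constantCoeff_aeval (p : MvPolynomial (Fin n) ℂ) :
    constantCoeff (aeval F p) = constantCoeff p := by
  induction p using MvPolynomial.induction_on with
  | C c => simp
  | add p q hp hq => rw [map_add, map_add, map_add, hp, hq]
  | mul_X p i hp => simp [hF.constantCoeff_eq_zero]

/-- A polynomial that becomes homogeneous on substituting the fundamental invariants is weighted
homogeneous for their degrees. -/
theorem isWeightedHomogeneous_of_aeval {p : MvPolynomial (Fin n) ℂ} {e : ℕ}
    (hp : (aeval F p).IsHomogeneous e) : IsWeightedHomogeneous d p e := by
  classical
  obtain ⟨s, hs0, hs⟩ := exists_sum_weightedHomogeneousComponent d p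
  have hc : ∀ b, homogeneousComponent e (aeval F (weightedHomogeneousComponent d b p)) =
      if e = b then aeval F (weightedHomogeneousComponent d b p) else 0 := by
    intro b
    refine homogeneousComponent_of_mem ?_
    exact IsWeightedHomogeneous.aeval_of_addMonoidHom (AddMonoidHom.id ℕ)
      (weightedHomogeneousComponent_isWeightedHomogeneous b p) hF.1
  have h1 : aeval F p = aeval F (weightedHomogeneousComponent d e p) := by
    conv_lhs => rw [← homogeneousComponent_eq_self hp, hs s subset_rfl, map_sum, map_sum]
    simp_rw [hc]
    rw [Finset.sum_ite_eq]
    split_ifs with h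
    · rfl
    · rw [hs0 e h, map_zero]
  rw [hF.aeval_injective h1]
  exact weightedHomogeneousComponent_isWeightedHomogeneous e p

/-- The fundamental invariants span the invariants without constant term modulo products; the
coefficients are those of the linear part. -/
theorem aeval_sub_mem (p : MvPolynomial (Fin n) ℂ) :
    aeval F p - C (constantCoeff p) - ∑ j, constantCoeff (pderiv j p) • F j ∈
      posInv ρ * posInv ρ := by
  have hR : ∀ q : MvPolynomial (Fin n) ℂ, aeval F q - C (constantCoeff q) ∈ posInv ρ := by
    intro q
    rw [← hF.constantCoeff_aeval]
    exact sub_C_mem_posInv ρ (hF.mem_iff.2 ⟨q, rfl⟩)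
  induction p using MvPolynomial.induction_on with
  | C c => simp
  | add p q hp hq =>
    have := add_mem hp hq
    simp only [map_add, add_smul, Finset.sum_add_distrib]
    convert this using 1
    abel
  | mul_X p i hp =>
    have h1 : ∑ j, constantCoeff (pderiv j (p * X i)) • F j = constantCoeff p • F i := by
      rw [Finset.sum_eq_single i]
      · simp [Derivation.leibniz]
      · intro j _ hj
        simp [Derivation.leibniz, pderiv_X_of_ne hj.symm]
      · simp
    rw [h1]
    have : aeval F (p * X i) - C (constantCoeff (p * X i)) - constantCoeff p • F i =
        (aeval F p - C (constantCoeff p)) * F i := by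
      rw [smul_eq_C_mul]
      simp
      ring
    rw [this]
    exact Submodule.mul_mem_mul (hR p) (hF.mem_posInv i)

/-- The fundamental invariants are independent modulo products: products have no linear part. -/
theorem eq_zero_of_sum_mem {α : Fin n → ℂ} (hα : ∑ i, α i • F i ∈ posInv ρ * posInv ρ) :
    α = 0 := by
  have key : ∀ u ∈ posInv ρ * posInv ρ, ∃ p : MvPolynomial (Fin n) ℂ, aeval F p = u ∧
      ∀ i, constantCoeff (pderiv i p) = 0 := by
    intro u hu
    induction hu using Submodule.mul_induction_on' with
    | add a _ b _ ha hb =>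
      obtain ⟨p, rfl, hp⟩ := ha
      obtain ⟨q, rfl, hq⟩ := hb
      exact ⟨p + q, map_add _ _ _, fun i => by rw [map_add, map_add, hp, hq, add_zero]⟩
    | mem_mul_mem a ha b hb =>
      obtain ⟨p, rfl⟩ := hF.mem_iff.1 ha.1
      obtain ⟨q, rfl⟩ := hF.mem_iff.1 hb.1
      have hp := ha.2
      have hq := hb.2
      rw [hF.constantCoeff_aeval] at hp hq
      exact ⟨p * q, map_mul _ _ _, fun i => by simp [Derivation.leibniz, hp, hq]⟩
  obtain ⟨p, hp, hp0⟩ := key _ hα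
  have h1 : p = ∑ i, α i • X i := hF.aeval_injective (hp.trans (by simp))
  funext j
  have h2 := hp0 j
  rw [h1, map_sum, map_sum, Finset.sum_eq_single j] at h2
  · simpa [Derivation.map_smul] using h2
  · intro i _ hij
    rw [Derivation.map_smul, pderiv_X_of_ne hij, smul_zero, map_zero]
  · simp

end IsFundamentalInvariants

/-- A faithful group with the flatness property has fundamental invariants. -/
theorem exists_isFundamentalInvariants [Finite Γ] (hflat : FlatOverInvariants ρ) :
    ∃ F d, IsFundamentalInvariants ρ F d := by
  obtain ⟨F, k, h1, h2, h3⟩ := exists_block_fundamental_invariants (δ := fun _ : Fin n => ())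
    hflat (fun _ _ _ _ => rfl)
  refine ⟨F, k, fun i => ?_, h1, h2⟩
  have := isHomogeneous_of_blockWeight (h3 i)
  rwa [Finsupp.degree_single] at this

/-- Changing fundamental invariants by products of invariants, without changing the degrees, gives
fundamental invariants. -/
theorem IsFundamentalInvariants.congr [Finite Γ] (hF : IsFundamentalInvariants ρ F d)
    (hflat : FlatOverInvariants ρ) {F' : Fin n → MvPolynomial (Fin n) ℂ}
    (hd : ∀ i, (F' i).IsHomogeneous (d i)) (hF' : ∀ i, F' i ∈ invariantRing ρ)
    (hFF' : ∀ i, F i - F' i ∈ posInv ρ * posInv ρ) : IsFundamentalInvariants ρ F' d := by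
  have hsum : ∀ α : Fin n → ℂ, ∑ i, α i • F i - ∑ i, α i • F' i ∈ posInv ρ * posInv ρ := by
    intro α
    rw [← Finset.sum_sub_distrib]
    refine sum_mem fun i _ => ?_
    rw [← smul_sub]
    exact Submodule.smul_mem _ _ (hFF' i)
  refine ⟨hd, algebraicIndependent_of_grad (linearIndependent_grad hflat hF' hd hF.degree_ne_zero
    fun α hα => hF.eq_zero_of_sum_mem ?_), adjoin_eq_invariantRing hF' hd fun u hu => ?_⟩
  · simpa using add_mem (hsum α) hα
  · obtain ⟨p, rfl⟩ := hF.mem_iff.1 hu.1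
    have hp := hu.2
    rw [hF.constantCoeff_aeval] at hp
    have h1 := hF.aeval_sub_mem p
    rw [hp, C_0, sub_zero] at h1
    refine ⟨fun j => constantCoeff (pderiv j p), ?_⟩
    simpa using add_mem h1 (hsum fun j => constantCoeff (pderiv j p))

end FundamentalInvariants

/-! ### Existence of linear coordinates on the quotient by a normal subgroup -/

section LinearQuotientExistence

variable {n : ℕ} {Γ : Type*} [Group Γ] (ρ : Γ →* GL (Fin n) ℂ) (N : Subgroup Γ) [hN : N.Normal]

theorem polyAct_mem_invariantRing_normal (g : Γ) {f : MvPolynomial (Fin n) ℂ}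
    (hf : f ∈ invariantRing (ρ.comp N.subtype)) :
    polyAct (ρ g) f ∈ invariantRing (ρ.comp N.subtype) := by
  intro h
  have h1 := hf ⟨g⁻¹ * h * g, by simpa using hN.conj_mem h h.2 g⁻¹⟩
  have h2 : polyAct (ρ g) (polyAct (ρ (g⁻¹ * h * g)) f) = polyAct (ρ h) (polyAct (ρ g) f) := by
    rw [← AlgHom.mul_apply, ← AlgHom.mul_apply, ← map_mul, ← map_mul, ← map_mul, ← map_mul]
    congr 3
    group
  exact h2.symm.trans (congrArg _ h1)

theorem polyAct_mem_posInv_mul_posInv (g : Γ) {f : MvPolynomial (Fin n) ℂ}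
    (hf : f ∈ posInv (ρ.comp N.subtype) * posInv (ρ.comp N.subtype)) :
    polyAct (ρ g) f ∈ posInv (ρ.comp N.subtype) * posInv (ρ.comp N.subtype) := by
  have hpos : ∀ u ∈ posInv (ρ.comp N.subtype),
      polyAct (ρ g) u ∈ posInv (ρ.comp N.subtype) := fun u hu =>
    ⟨polyAct_mem_invariantRing_normal ρ N g hu.1, (constantCoeff_polyAct _ _).trans hu.2⟩
  induction hf using Submodule.mul_induction_on' with
  | add a _ b _ ha hb => rw [map_add]; exact add_mem ha hb
  | mem_mul_mem a ha b hb =>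
    rw [map_mul]
    exact Submodule.mul_mem_mul (hpos a ha) (hpos b hb)

variable {ρ N} {F : Fin n → MvPolynomial (Fin n) ℂ} {d : Fin n → ℕ}
  (hF : IsFundamentalInvariants (ρ.comp N.subtype) F d)
include hF

/-- The action of `g` on `S(V*)^N`, as an endomorphism of the polynomial ring in the fundamental
invariants; it need not be linear. -/
theorem exists_conjugate_action (g : Γ) :
    ∃ T : MvPolynomial (Fin n) ℂ →ₐ[ℂ] MvPolynomial (Fin n) ℂ,
      ∀ p, aeval F (T p) = polyAct (ρ g) (aeval F p) := by
  choose t ht using fun i => hF.mem_iff.1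
    (polyAct_mem_invariantRing_normal ρ N g (hF.mem_invariantRing i))
  refine ⟨aeval t, fun p => ?_⟩
  have : (aeval F).comp (aeval t) = (polyAct (ρ g)).comp (aeval F) :=
    MvPolynomial.algHom_ext fun i => by
      rw [AlgHom.comp_apply, AlgHom.comp_apply, aeval_X, aeval_X, ht]
  exact DFunLike.congr_fun this p

/-- The linear part of the action on the fundamental invariants: an antihomomorphism to matrices,
whose entries vanish between invariants of different degrees. -/
theorem exists_linear_part : ∃ a : Γ → Matrix (Fin n) (Fin n) ℂ,
    (∀ g h, a (g * h) = a h * a g) ∧ (∀ g ∈ N, a g = 1) ∧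
    (∀ g i j, a g i j ≠ 0 → d i = d j) ∧
    ∀ g i, polyAct (ρ g) (F i) - ∑ j, a g i j • F j ∈
      posInv (ρ.comp N.subtype) * posInv (ρ.comp N.subtype) := by
  choose T hT using exists_conjugate_action hF
  have hTmul : ∀ g h p, T (g * h) p = T g (T h p) := fun g h p => hF.aeval_injective (by
    rw [hT, hT, hT, map_mul, map_mul, AlgHom.mul_apply])
  have hTN : ∀ g ∈ N, ∀ p, T g p = p := fun g hg p => hF.aeval_injective (by
    rw [hT]; exact hF.mem_iff.2 ⟨p, rfl⟩ ⟨g, hg⟩)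
  have hTc : ∀ g p, constantCoeff (T g p) = constantCoeff p := fun g p => by
    rw [← hF.constantCoeff_aeval, hT, constantCoeff_polyAct, hF.constantCoeff_aeval]
  -- This is the chain rule at the origin.
  have hchain : ∀ g j p, constantCoeff (pderiv j (T g p)) =
      ∑ k, constantCoeff (pderiv j (T g (X k))) * constantCoeff (pderiv k p) := by
    intro g j p
    induction p using MvPolynomial.induction_on with
    | C c =>
      rw [← algebraMap_eq, AlgHom.commutes, algebraMap_eq]
      simp
    | add p q hp hq => simp only [map_add, hp, hq, mul_add, Finset.sum_add_distrib]
    | mul_X p i hp =>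
      have h1 : ∀ k, constantCoeff (pderiv k (p * X i)) =
          if i = k then constantCoeff p else 0 := by
        intro k
        rw [Derivation.leibniz, pderiv_X]
        by_cases hik : i = k
        · subst hik; simp
        · simp [hik]
      simp_rw [h1]
      rw [map_mul, Derivation.leibniz]
      simp [hTc, mul_comm]
  obtain ⟨a, ha⟩ : ∃ a : Γ → Matrix (Fin n) (Fin n) ℂ,
      ∀ g i j, a g i j = constantCoeff (pderiv j (T g (X i))) :=
    ⟨fun g => Matrix.of fun i j => _, fun _ _ _ => rfl⟩
  refine ⟨a, fun g h => ?_, fun g hg => ?_, fun g i j hij => ?_, fun g i => ?_⟩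
  · ext i j
    rw [ha, hTmul, hchain, Matrix.mul_apply]
    exact Finset.sum_congr rfl fun k _ => by rw [ha, ha, mul_comm]
  · ext i j
    rw [ha, hTN g hg, pderiv_X, Matrix.one_apply]
    by_cases hij : i = j
    · subst hij; simp
    · simp [hij]
  · have h1 : IsWeightedHomogeneous d (T g (X i)) (d i) := by
      refine hF.isWeightedHomogeneous_of_aeval ?_
      rw [hT, aeval_X]
      exact polyAct_mem_homogeneous (ρ g) (d i) (hF.1 i)
    rw [ha, MvPolynomial.constantCoeff_eq, coeff_pderiv, zero_add] at hij
    have h2 := h1 (left_ne_zero_of_mul hij)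
    rw [Finsupp.weight_single, one_smul] at h2
    exact h2.symm
  · have h1 := hF.aeval_sub_mem (T g (X i))
    rw [hT, hTc, aeval_X, constantCoeff_X, C_0, sub_zero] at h1
    simpa only [ha] using h1

end LinearQuotientExistence

/-- Averaging over the group corrects fundamental invariants of `N` by products of invariants so
that their span becomes stable. -/
theorem exists_isLinearQuotient {n : ℕ} {Γ : Type*} [Group Γ] [Finite Γ] (ρ : Γ →* GL (Fin n) ℂ)
    (N : Subgroup Γ) [N.Normal] (hflat : FlatOverInvariants (ρ.comp N.subtype)) :
    ∃ F η, IsLinearQuotient ρ N F η := by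
  classical
  obtain ⟨F, d, hF⟩ := exists_isFundamentalInvariants hflat
  obtain ⟨a, hmul, hone, hdeg, hlin⟩ := exists_linear_part hF
  have ha1 : a 1 = 1 := hone 1 N.one_mem
  let ν : Representation ℂ Γ (Fin n → ℂ) :=
    { toFun := fun g => (a g).transpose.mulVecLin
      map_one' := by rw [ha1, Matrix.transpose_one, Matrix.mulVecLin_one]; rfl
      map_mul' := fun g h => by
        rw [hmul, Matrix.transpose_mul, Matrix.mulVecLin_mul]; rfl }
  -- Average the inclusion of the span of the `F i` over the group, acting through the linear part.
  let κ₀ : (Fin n → ℂ) →ₗ[ℂ] MvPolynomial (Fin n) ℂ := Fintype.linearCombination ℂ F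
  have hκ₀ : ∀ i, κ₀ (Pi.single i 1) = F i := fun i => by
    simp [κ₀, Fintype.linearCombination_apply_single]
  have hν : ∀ (κ : (Fin n → ℂ) →ₗ[ℂ] MvPolynomial (Fin n) ℂ) g i,
      κ (ν g (Pi.single i 1)) = ∑ j, a g i j • κ (Pi.single j 1) := by
    intro κ g i
    rw [LinearMap.pi_apply_eq_sum_univ κ]
    refine Finset.sum_congr rfl fun j _ => ?_
    congr 1
    · change (a g).transpose.mulVec (Pi.single i 1) j = _
      simp
    · congr 1
      ext k
      simp [Pi.single_apply, eq_comm]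
  let κ := avg (ν.linHom (polyRep ρ)) κ₀
  have hκ : ∀ g i, polyAct (ρ g) (κ (Pi.single i 1)) = ∑ j, a g i j • κ (Pi.single j 1) := by
    intro g i
    rw [← hν κ, mem_equivHom.1 (avg_mem_equivHom ρ ν κ₀)]
  have hlinHom : ∀ g i, ν.linHom (polyRep ρ) g κ₀ (Pi.single i 1) =
      polyAct (ρ g) (∑ j, a g⁻¹ i j • F j) := by
    intro g i
    rw [Representation.linHom_apply, LinearMap.comp_apply, LinearMap.comp_apply, hν, polyRep_apply]
    simp_rw [hκ₀]
  have hF' : IsFundamentalInvariants (ρ.comp N.subtype) (fun i => κ (Pi.single i 1)) d := by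
    refine hF.congr hflat (fun i => ?_) (fun i => ?_) fun i => ?_
    · refine avg_mem (ν.linHom (polyRep ρ)) ((homogeneousSubmodule (Fin n) ℂ (d i)).comap
        (LinearMap.applyₗ (Pi.single i 1))) fun g => ?_
      change ν.linHom (polyRep ρ) g κ₀ (Pi.single i 1) ∈ homogeneousSubmodule (Fin n) ℂ (d i)
      rw [hlinHom]
      refine polyAct_mem_homogeneous _ _ (sum_mem fun j _ => ?_)
      by_cases hij : a g⁻¹ i j = 0
      · rw [hij, zero_smul]; exact zero_mem _
      · refine Submodule.smul_mem _ _ ?_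
        rw [hdeg _ _ _ hij]
        exact hF.1 j
    · intro h
      refine (hκ h i).trans ?_
      simp_rw [hone h h.2, Matrix.one_apply]
      simp
    · rw [← hκ₀]
      refine sub_avg_mem (ν.linHom (polyRep ρ))
        ((posInv (ρ.comp N.subtype) * posInv (ρ.comp N.subtype)).comap
          (LinearMap.applyₗ (Pi.single i 1))) fun g => ?_
      change κ₀ (Pi.single i 1) - ν.linHom (polyRep ρ) g κ₀ (Pi.single i 1) ∈
        posInv (ρ.comp N.subtype) * posInv (ρ.comp N.subtype)
      rw [hlinHom, hκ₀]
      have h1 := polyAct_mem_posInv_mul_posInv ρ N g (hlin g⁻¹ i)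
      rwa [map_sub, map_inv, polyAct_apply_inv] at h1
  let φ : Γ →* GL (Fin n) ℂ := MonoidHom.toHomUnits
    { toFun := fun g => a g⁻¹
      map_one' := by rw [inv_one, ha1]
      map_mul' := fun g h => by rw [mul_inv_rev, hmul] }
  have hφ : ∀ g, (φ g).val = a g⁻¹ := fun g => rfl
  have hker : ∀ g ∈ N, φ g = 1 := fun g hg => Units.ext (by
    rw [hφ, hone _ (N.inv_mem hg)]; rfl)
  refine ⟨fun i => κ (Pi.single i 1), QuotientGroup.lift N φ hker, ⟨d, hF'⟩, fun g i => ?_⟩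
  have hη : QuotientGroup.lift N φ hker (g : Γ ⧸ N) = φ g := rfl
  rw [hκ, hη, polyAct_X, map_sum, ← map_inv, hφ, inv_inv]
  exact Finset.sum_congr rfl fun j _ => by rw [map_smul, aeval_X]

/-! ### The quotient group acting on the quotient space -/

section LinearQuotient

variable {n : ℕ} {Γ : Type*} [Group Γ] {ρ : Γ →* GL (Fin n) ℂ} {N : Subgroup Γ} [N.Normal]
  {F : Fin n → MvPolynomial (Fin n) ℂ} {d : Fin n → ℕ} {η : Γ ⧸ N →* GL (Fin n) ℂ}
  (hF : IsFundamentalInvariants (ρ.comp N.subtype) F d)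
  (hη : ∀ (g : Γ) (i : Fin n), polyAct (ρ g) (F i) = aeval F (polyAct (η (g : Γ ⧸ N)) (X i)))
include hη

theorem aeval_polyAct_quotient (g : Γ) (p : MvPolynomial (Fin n) ℂ) :
    aeval F (polyAct (η (g : Γ ⧸ N)) p) = polyAct (ρ g) (aeval F p) := by
  have : (aeval F).comp (polyAct (η (g : Γ ⧸ N))) = (polyAct (ρ g)).comp (aeval F) :=
    MvPolynomial.algHom_ext fun i => by
      rw [AlgHom.comp_apply, AlgHom.comp_apply, aeval_X, hη]
  exact DFunLike.congr_fun this p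

include hF

theorem aeval_mem_invariantRing_iff {p : MvPolynomial (Fin n) ℂ} :
    aeval F p ∈ invariantRing ρ ↔ p ∈ invariantRing η := by
  constructor
  · intro h g
    obtain ⟨g, rfl⟩ := QuotientGroup.mk_surjective g
    refine hF.aeval_injective ?_
    rw [aeval_polyAct_quotient hη, h g]
  · intro h g
    rw [← aeval_polyAct_quotient hη, h]

theorem mem_invariantRing_iff_exists_aeval {f : MvPolynomial (Fin n) ℂ} :
    f ∈ invariantRing ρ ↔ ∃ p ∈ invariantRing η, aeval F p = f := by
  constructor
  · intro h
    obtain ⟨p, rfl⟩ := hF.mem_iff.1 fun g => h g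
    exact ⟨p, (aeval_mem_invariantRing_iff hF hη).1 h, rfl⟩
  · rintro ⟨p, hp, rfl⟩
    exact (aeval_mem_invariantRing_iff hF hη).2 hp

theorem quotient_apply_ne_zero (g : Γ ⧸ N) (i j : Fin n) (hij : (η g).val i j ≠ 0) :
    d i = d j := by
  obtain ⟨g, rfl⟩ := QuotientGroup.mk_surjective g
  have h1 : IsWeightedHomogeneous d (polyAct (η ((g⁻¹ : Γ) : Γ ⧸ N)) (X i)) (d i) := by
    refine hF.isWeightedHomogeneous_of_aeval ?_
    rw [← hη]
    exact polyAct_mem_homogeneous _ _ (hF.1 i)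
  have h2 : coeff (Finsupp.single j 1) (polyAct (η ((g⁻¹ : Γ) : Γ ⧸ N)) (X i)) ≠ 0 := by
    classical
    rw [polyAct_X, ← map_inv, QuotientGroup.mk_inv, inv_inv, coeff_sum, Finset.sum_eq_single j]
    · rwa [coeff_smul, coeff_X, if_pos rfl, smul_eq_mul, mul_one]
    · intro k _ hk
      rw [coeff_smul, coeff_X, if_neg, smul_zero]
      exact fun h => hk (Finsupp.single_left_injective one_ne_zero h)
    · simp
  have h3 := h1 h2
  rw [Finsupp.weight_single, one_smul] at h3
  exact h3.symm

variable [Finite Γ]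

/-- The invariant ideal of the whole group contracts to that of the quotient group: average over
the normal subgroup. -/
theorem mem_invIdeal_quotient {p : MvPolynomial (Fin n) ℂ} (hp : aeval F p ∈ invIdeal ρ) :
    p ∈ invIdeal η := by
  have key : ∀ z ∈ invIdeal ρ, ∀ s, ∃ q ∈ invIdeal η,
      aeval F q = avg (polyRep (ρ.comp N.subtype)) (s * z) := by
    intro z hz
    induction hz using Submodule.span_induction with
    | zero => exact fun s => ⟨0, zero_mem _, by rw [mul_zero, map_zero, map_zero]⟩
    | add x y _ _ hx hy =>
      intro s
      obtain ⟨q, hq, hq'⟩ := hx s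
      obtain ⟨q', h1, h2⟩ := hy s
      exact ⟨q + q', add_mem hq h1, by rw [map_add, hq', h2, mul_add, map_add]⟩
    | smul a x _ hx =>
      intro s
      rw [smul_eq_mul, ← mul_assoc]
      exact hx _
    | mem u hu =>
      intro s
      obtain ⟨q, hq, rfl⟩ := (mem_invariantRing_iff_exists_aeval hF hη).1 hu.1
      obtain ⟨s', hs'⟩ := hF.mem_iff.1 (avg_mem_invariantRing (ρ.comp N.subtype) s)
      refine ⟨s' * q, Ideal.mul_mem_left _ _ (posInv_subset_invIdeal η ⟨hq, ?_⟩), ?_⟩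
      · rw [← hF.constantCoeff_aeval]; exact hu.2
      · rw [mul_comm s, avg_mul_of_mem (ρ.comp N.subtype) (hF.mem_iff.2 ⟨q, rfl⟩), map_mul, hs',
          mul_comm]
  obtain ⟨q, hq, hq'⟩ := key _ hp 1
  rw [one_mul, avg_eq_self (polyRep (ρ.comp N.subtype))
    fun h => (hF.mem_iff.2 ⟨p, rfl⟩ : aeval F p ∈ invariantRing (ρ.comp N.subtype)) h] at hq'
  rwa [← hF.aeval_injective hq']

theorem flatOverInvariants_quotient (hflat : FlatOverInvariants ρ) : FlatOverInvariants η := by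
  intro t r hr hr0
  have hr0' : (fun j => aeval F (r j)) ≠ 0 := by
    intro h
    refine hr0 (funext fun j => hF.aeval_injective ?_)
    rw [Pi.zero_apply, map_zero]
    exact congrFun h j
  obtain ⟨α, hα, hαI⟩ := hflat t (fun j => aeval F (r j))
    (fun j => (aeval_mem_invariantRing_iff hF hη).2 (hr j)) hr0'
  refine ⟨α, hα, fun h hh => mem_invIdeal_quotient hF hη ?_⟩
  have := hαI (fun j => aeval F (h j)) (by simp_rw [← map_mul, ← map_sum, hh, map_zero])
  rw [map_sum]
  simp_rw [map_smul]
  exact this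

/-- The quotient group acts faithfully on the quotient space: elements outside `N` move a generic
`N`-orbit, and the `N`-invariants separate it. -/
theorem quotient_injective (hρ : Function.Injective ρ) : Function.Injective η := by
  rw [injective_iff_map_eq_one]
  intro g
  obtain ⟨g, rfl⟩ := QuotientGroup.mk_surjective g
  intro hg
  rw [QuotientGroup.eq_one_iff]
  have := Fintype.ofFinite N
  obtain ⟨w, hw⟩ := exists_generic_vector ρ
  obtain ⟨q, -, hqw, hq⟩ := exists_separating_polynomial ρ hw Set.univ
  have hq' : ∀ g, eval ((ρ g).val.mulVec w) q ≠ 0 → g = 1 := by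
    intro g hg
    have h := ((hq g).resolve_left hg).2
    refine hρ (Units.ext (Matrix.mulVec_injective (funext fun v => ?_)))
    rw [map_one, Units.val_one, Matrix.one_mulVec]
    exact funext fun i => h i trivial v
  let u := avg (polyRep (ρ.comp N.subtype)) q
  obtain ⟨p, hp⟩ := hF.mem_iff.1 (avg_mem_invariantRing (ρ.comp N.subtype) q)
  have hu : polyAct (ρ g) u = u := by
    rw [show u = aeval F p from hp.symm, ← aeval_polyAct_quotient hη, hg, map_one,
      AlgHom.one_apply]
  have heval : ∀ v, eval v u = (Nat.card N : ℂ)⁻¹ *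
      ∑ h : N, eval ((ρ (h : Γ)⁻¹).val.mulVec v) q := by
    intro v
    simp only [u, avg_apply, smul_eval, map_sum, polyRep_apply, eval_polyAct, MonoidHom.comp_apply,
      Subgroup.subtype_apply, map_inv]
  have h1 : eval w u ≠ 0 := by
    rw [heval, Finset.sum_eq_single 1]
    · simp [hqw]
    · intro h _ h1
      by_contra hne
      exact h1 (Subtype.ext (by simpa using hq' _ hne))
    · simp
  rw [← hu, eval_polyAct, heval] at h1
  obtain ⟨h, -, hh⟩ := Finset.exists_ne_zero_of_sum_ne_zero (right_ne_zero_of_mul h1)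
  rw [Matrix.mulVec_mulVec, ← map_inv, ← Units.val_mul, ← map_mul] at hh
  have h2 := hq' _ hh
  rw [← mul_inv_rev, inv_eq_one, mul_eq_one_iff_eq_inv] at h2
  rw [h2]
  exact N.inv_mem h.2

end LinearQuotient

/-! ### Covariants adapted to a block decomposition -/

section BlockCovariants

variable {n : ℕ} {D : Type*} {δ : Fin n → D}

open Classical in
/-- The projection of `ℂⁿ` onto one block of coordinates. -/
def blockProj (δ : Fin n → D) (d : D) : (Fin n → ℂ) →ₗ[ℂ] (Fin n → ℂ) :=
  LinearMap.pi fun l => if δ l = d then LinearMap.proj l else 0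

open Classical in
theorem blockProj_apply (d : D) (v : Fin n → ℂ) (l : Fin n) :
    blockProj δ d v l = if δ l = d then v l else 0 := by
  rw [blockProj, LinearMap.pi_apply]
  split_ifs <;> rfl

open Classical in
theorem blockProj_single (d : D) (l : Fin n) :
    blockProj δ d (Pi.single l 1) = if δ l = d then Pi.single l 1 else 0 := by
  funext i
  rw [blockProj_apply]
  by_cases hil : i = l
  · subst hil
    split_ifs <;> rfl
  · rw [Pi.single_eq_of_ne hil, ite_self]
    split_ifs
    · rw [Pi.single_eq_of_ne hil]
    · rfl

variable {Γ : Type*} [Group Γ] {ρ ρ' : Γ →* GL (Fin n) ℂ}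

theorem matrixModule_blockProj (hδ : ∀ g i j, (ρ g).val i j ≠ 0 → δ i = δ j) (d : D) (g : Γ)
    (v : Fin n → ℂ) :
    matrixModule ρ g (blockProj δ d v) = blockProj δ d (matrixModule ρ g v) := by
  classical
  funext i
  rw [blockProj_apply]
  change ∑ j, (ρ g).val i j * blockProj δ d v j = if δ i = d then ∑ j, (ρ g).val i j * v j else 0
  have h : ∀ j, (ρ g).val i j * blockProj δ d v j =
      if δ i = d then (ρ g).val i j * v j else 0 := by
    intro j
    by_cases hij : (ρ g).val i j = 0
    · rw [hij, zero_mul, zero_mul, ite_self]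
    · rw [blockProj_apply, hδ g i j hij, mul_ite, mul_zero]
  simp_rw [h]
  split_ifs
  · rfl
  · exact Finset.sum_const_zero

variable [Finite Γ]

/-- A faithful group with the flatness property that preserves a decomposition of the coordinates
into blocks, and a module `ℂⁿ` on which it also preserves the blocks and acts trivially on the
blocks where the group is trivial: there is a basis of the covariants whose `i`-th member only
involves the block of `i`, both in the argument and in the values. -/
theorem exists_block_basis_equivHom (hflat : FlatOverInvariants ρ) (hρ : Function.Injective ρ)
    (hδ : ∀ g i j, (ρ g).val i j ≠ 0 → δ i = δ j)
    (hδ' : ∀ g i j, (ρ' g).val i j ≠ 0 → δ i = δ j)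
    (htriv : ∀ g i, (∀ v, (ρ g).val.mulVec v i = v i) → ∀ v, (ρ' g).val.mulVec v i = v i) :
    ∃ (b : Fin n → (Fin n → ℂ) →ₗ[ℂ] MvPolynomial (Fin n) ℂ) (k : Fin n → ℕ),
      (∀ i, b i ∈ equivHom ρ (matrixModule ρ')) ∧ LinearIndependent (MvPolynomial (Fin n) ℂ) b ∧
      (∀ f ∈ equivHom ρ (matrixModule ρ'),
        f ∈ Submodule.span (invariantRing ρ) (Set.range b)) ∧
      ∀ i v, IsWeightedHomogeneous (blockWeight δ) (b i v) (Finsupp.single (δ i) (k i)) := by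
  classical
  have hδinv : ∀ g i j, ((ρ g)⁻¹).val i j ≠ 0 → δ i = δ j := fun g i j h =>
    hδ g⁻¹ i j (by rwa [map_inv])
  let A : Set ((Fin n → ℂ) →ₗ[ℂ] MvPolynomial (Fin n) ℂ) :=
    {f | f ∈ equivHom ρ (matrixModule ρ') ∧ ∃ d a, f ∘ₗ blockProj δ d = f ∧
      ∀ v, IsWeightedHomogeneous (blockWeight δ) (f v) a}
  have hA : ∀ f ∈ equivHom ρ (matrixModule ρ'), f ∈ Submodule.span ℂ A := by
    intro f hf
    have h1 : f = ∑ d ∈ Finset.univ.image δ, f ∘ₗ blockProj δ d := by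
      refine (Pi.basisFun ℂ (Fin n)).ext fun l => ?_
      simp only [Pi.basisFun_apply, LinearMap.sum_apply, LinearMap.comp_apply, blockProj_single,
        apply_ite f, map_zero]
      rw [Finset.sum_ite_eq, if_pos (Finset.mem_image_of_mem δ (Finset.mem_univ l))]
    rw [h1]
    refine sum_mem fun d _ => ?_
    set f' := f ∘ₗ blockProj δ d with hf'
    have hf'X : f' ∈ equivHom ρ (matrixModule ρ') := by
      rw [mem_equivHom] at hf ⊢
      intro g v
      rw [hf', LinearMap.comp_apply, LinearMap.comp_apply, ← matrixModule_blockProj hδ', hf]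
    have hf'P : f' ∘ₗ blockProj δ d = f' := by
      refine (Pi.basisFun ℂ (Fin n)).ext fun l => ?_
      simp only [hf', Pi.basisFun_apply, LinearMap.comp_apply, blockProj_single]
      split_ifs with h
      · rw [blockProj_single, if_pos h]
      · rw [map_zero]
    choose s _ hs using fun l =>
      exists_sum_weightedHomogeneousComponent (blockWeight δ) (f' (Pi.single l 1))
    have h2 : f' = ∑ a ∈ Finset.univ.biUnion s,
        (weightedHomogeneousComponent (blockWeight δ) a) ∘ₗ f' := by
      refine (Pi.basisFun ℂ (Fin n)).ext fun l => ?_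
      rw [LinearMap.sum_apply, Pi.basisFun_apply]
      exact hs l _ (Finset.subset_biUnion_of_mem s (Finset.mem_univ l))
    rw [h2]
    refine sum_mem fun a _ => Submodule.subset_span ⟨?_, d, a, ?_, fun v =>
      weightedHomogeneousComponent_isWeightedHomogeneous a _⟩
    · rw [mem_equivHom] at hf'X ⊢
      intro g v
      change weightedHomogeneousComponent (blockWeight δ) a (f' (matrixModule ρ' g v)) =
        polyAct (ρ g) (weightedHomogeneousComponent (blockWeight δ) a (f' v))
      rw [hf'X]
      exact (map_weightedHomogeneousComponent (polyAct (ρ g)).toLinearMap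
        (fun b p hp => polyAct_isWeightedHomogeneous (hδinv g) hp) a (f' v)).symm
    · rw [LinearMap.comp_assoc, hf'P]
  have hbasis := exists_basis_equivHom (matrixModule ρ') hflat hρ A (fun f hf => hf.1)
    (fun f hf => by
      obtain ⟨-, d, a, -, ha⟩ := hf
      exact ⟨_, fun v => isHomogeneous_of_blockWeight (ha v)⟩)
    (fun f hf => ⟨f, hA f hf, fun v => by rw [sub_self]; exact zero_mem _⟩)
  rw [Module.finrank_fin_fun] at hbasis
  obtain ⟨b, hbA, hli, hspan⟩ := hbasis
  choose hbX d a hbd hba using hbA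
  -- Enough covariants that only involve one block: averages of `v ↦ v j • q` with `q` in the
  -- coordinates of the block of `j`.
  obtain ⟨x, hxX, hx, hxP, hxB⟩ : ∃ x : Fin n → (Fin n → ℂ) →ₗ[ℂ] MvPolynomial (Fin n) ℂ,
      (∀ j, x j ∈ equivHom ρ (matrixModule ρ')) ∧ LinearIndependent (MvPolynomial (Fin n) ℂ) x ∧
      (∀ j v, x j (blockProj δ (δ j) v) = x j v) ∧ ∀ j v, x j v ∈ blockSupported δ (δ j) := by
    obtain ⟨w, hw⟩ := exists_generic_vector ρ
    choose q hqB hqw hq using fun d => exists_separating_polynomial ρ hw {l | δ l = d}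
    have hq' : ∀ j g, eval ((ρ g).val.mulVec w) (q (δ j)) = 0 ∨
        (eval ((ρ g).val.mulVec w) (q (δ j)) = 1 ∧
          ∀ v, (LinearMap.proj j : (Fin n → ℂ) →ₗ[ℂ] ℂ) (matrixModule ρ' g v) =
            (LinearMap.proj j : (Fin n → ℂ) →ₗ[ℂ] ℂ) v) := fun j g =>
      (hq (δ j) g).imp_right fun h => ⟨h.1, htriv g j (h.2 j rfl)⟩
    choose c hc hx using fun j => exists_eval_avg_smulRight ρ (matrixModule ρ') (hqw (δ j)) (hq' j)
    have hlin : ∀ j g v, (matrixModule ρ').linHom (polyRep ρ) g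
        ((LinearMap.proj j : (Fin n → ℂ) →ₗ[ℂ] ℂ).smulRight (q (δ j))) v =
        (matrixModule ρ' g⁻¹ v j) • polyAct (ρ g) (q (δ j)) := fun j g v => by
      rw [Representation.linHom_apply, LinearMap.comp_apply, LinearMap.comp_apply, polyRep_apply,
        LinearMap.smulRight_apply, map_smul]
      rfl
    refine ⟨_, fun j => avg_mem_equivHom ρ _ _,
      linearIndependent_of_eval (Pi.basisFun ℂ (Fin n)) (w := w) (c := c) hc
        fun j v => (hx j v).trans (by simp), fun j v => ?_, fun j v => ?_⟩
    · refine avg_mem ((matrixModule ρ').linHom (polyRep ρ))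
        (LinearMap.eqLocus (LinearMap.applyₗ (blockProj δ (δ j) v)) (LinearMap.applyₗ v))
        fun g => ?_
      change _ = _
      rw [LinearMap.applyₗ_apply_apply, LinearMap.applyₗ_apply_apply, hlin, hlin,
        matrixModule_blockProj hδ', blockProj_apply, if_pos rfl]
    · refine avg_mem ((matrixModule ρ').linHom (polyRep ρ))
        ((Subalgebra.toSubmodule (blockSupported δ (δ j))).comap (LinearMap.applyₗ v)) fun g => ?_
      rw [Submodule.mem_comap, LinearMap.applyₗ_apply_apply, hlin]
      exact Submodule.smul_mem _ _ (polyAct_mem_blockSupported hδ g (hqB (δ j)))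
  -- A basis element that involves several blocks would be superfluous for generating the `x j`.
  have hblock : ∀ i, ∃ k, a i = Finsupp.single (d i) k := by
    intro i₀
    by_contra hcon
    push Not at hcon
    have hxb : ∀ j, x j ∈ Submodule.span (MvPolynomial (Fin n) ℂ)
        (Set.range fun i : {i // i ≠ i₀} => b i) := by
      intro j
      obtain ⟨r, -, hr⟩ := eq_sum_of_mem_span (hspan _ (hxX j))
      have h1 : x j = ∑ i, restrictBlock δ (δ j) (r i) •
          ((restrictBlock δ (δ j)).toLinearMap ∘ₗ b i ∘ₗ blockProj δ (δ j)) := by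
        refine LinearMap.ext fun v => ?_
        rw [← hxP, ← restrictBlock_of_mem (hxB j (blockProj δ (δ j) v)), hr]
        simp [LinearMap.sum_apply]
      rw [h1]
      refine sum_mem fun i _ => Submodule.smul_mem _ _ ?_
      by_cases hd : d i = δ j
      · rw [← hd, hbd]
        by_cases hk : ∃ k, a i = Finsupp.single (d i) k
        · obtain ⟨k, hk⟩ := hk
          have h2 : (restrictBlock δ (d i)).toLinearMap ∘ₗ b i = b i :=
            LinearMap.ext fun v => restrictBlock_of_mem (mem_blockSupported (hk ▸ hba i v))
          rw [h2]
          exact Submodule.subset_span ⟨⟨i, fun hi => hcon k (hi ▸ hk)⟩, rfl⟩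
        · have h2 : (restrictBlock δ (d i)).toLinearMap ∘ₗ b i = 0 := LinearMap.ext fun v =>
            (restrictBlock_eq_or δ (d i) (hba i v)).resolve_right fun h => hk h.2
          rw [h2]
          exact zero_mem _
      · have h2 : b i ∘ₗ blockProj δ (δ j) = 0 := by
          rw [← hbd i]
          refine (Pi.basisFun ℂ (Fin n)).ext fun l => ?_
          simp only [Pi.basisFun_apply, LinearMap.comp_apply, blockProj_single,
            LinearMap.zero_apply]
          split_ifs with hl
          · rw [blockProj_single, if_neg fun h => hd (h.symm.trans hl), map_zero]
          · rw [map_zero, map_zero]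
        rw [h2, LinearMap.comp_zero]
        exact zero_mem _
    have := card_le_of_mem_span hx hxb
    rw [Fintype.card_subtype_compl, Fintype.card_subtype_eq, Fintype.card_fin] at this
    have := i₀.pos
    omega
  choose k hk using hblock
  obtain ⟨π, hπ⟩ := exists_perm_of_linearIndependent (Pi.basisFun ℂ (Fin n)) hli
  have hd : ∀ i, d (π i) = δ i := by
    intro i
    by_contra h
    refine hπ i ?_
    rw [Pi.basisFun_apply, ← hbd, LinearMap.comp_apply, blockProj_single,
      if_neg fun h' => h h'.symm, map_zero]
  refine ⟨fun i => b (π i), fun i => k (π i), fun i => hbX _, hli.comp π π.injective,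
    fun f hf => ?_, fun i v => ?_⟩
  · have := hspan f hf
    rwa [← π.surjective.range_comp b] at this
  · rw [← hd i, ← hk]
    exact hba _ v

end BlockCovariants

/-! ### Degrees and exponents of the quotient group -/

theorem galoisTwist_apply (τ : ℂ ≃+* ℂ) {n : ℕ} {Γ : Type*} [Group Γ] (ρ : Γ →* GL (Fin n) ℂ)
    (g : Γ) (i j : Fin n) : (galoisTwist τ ρ g).val i j = τ ((ρ g).val i j) := rfl

section QuotientIdentities

variable {n : ℕ} {Γ : Type*} [Group Γ] {ρ : Γ →* GL (Fin n) ℂ} {N : Subgroup Γ} [N.Normal]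
  {F : Fin n → MvPolynomial (Fin n) ℂ} {d : Fin n → ℕ} {η : Γ ⧸ N →* GL (Fin n) ℂ}

theorem IsFundamentalInvariants.isHomogeneous_aeval (hF : IsFundamentalInvariants ρ F d)
    {p : MvPolynomial (Fin n) ℂ} {e k : ℕ}
    (hp : IsWeightedHomogeneous (blockWeight d) p (Finsupp.single e k)) :
    (aeval F p).IsHomogeneous (e * k) := by
  have h := IsWeightedHomogeneous.aeval_of_addMonoidHom
    (Finsupp.weight (fun e : ℕ => e) : (ℕ →₀ ℕ) →+ ℕ) hp (F := F) (w' := (1 : Fin n → ℕ))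
    fun i => by
      rw [blockWeight, Finsupp.weight_single, one_smul]
      exact hF.1 i
  rwa [Finsupp.weight_single, smul_eq_mul, mul_comm] at h

variable (hF : IsFundamentalInvariants (ρ.comp N.subtype) F d)
  (hη : ∀ (g : Γ) (i : Fin n), polyAct (ρ g) (F i) = aeval F (polyAct (η (g : Γ ⧸ N)) (X i)))
  [Finite Γ]
include hF hη

/-- The degrees of the quotient group multiply those of the normal subgroup. -/
theorem exists_isDegrees_quotient (hflat : FlatOverInvariants ρ) :
    ∃ k : Fin n → ℕ, IsDegrees η k ∧ IsDegrees ρ fun i => d i * k i := by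
  obtain ⟨P, k, hP, hPadj, hPk⟩ := exists_block_fundamental_invariants (δ := d)
    (flatOverInvariants_quotient hF hη hflat) (quotient_apply_ne_zero hF hη)
  refine ⟨k, ⟨P, fun i => ?_, hP, hPadj⟩, fun i => aeval F (P i),
    fun i => hF.isHomogeneous_aeval (hPk i), hP.map' hF.aeval_injective, ?_⟩
  · have := isHomogeneous_of_blockWeight (hPk i)
    rwa [Finsupp.degree_single] at this
  · have h1 : Set.range (fun i => aeval F (P i)) = aeval F '' Set.range P := by
      rw [← Set.range_comp]; rfl
    rw [h1, ← AlgHom.map_adjoin, hPadj]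
    ext f
    rw [mem_invariantRing_iff_exists_aeval hF hη]
    rfl

/-- The exponents of a Galois twist of the quotient space: a basis of the covariants of the quotient
group pulls back to a basis of those of the whole group. -/
theorem exists_isExponents_quotient (hflat : FlatOverInvariants ρ) (hρ : Function.Injective ρ)
    (τ : ℂ ≃+* ℂ) :
    ∃ k : Fin n → ℕ, IsExponents η (matrixModule (galoisTwist τ η)) k ∧
      IsExponents ρ (matrixModule (galoisTwist τ (η.comp (QuotientGroup.mk' N))))
        fun i => d i * k i := by
  classical
  have hblock := quotient_apply_ne_zero hF hη
  obtain ⟨b, k, hbX, hli, hspan, hbk⟩ := exists_block_basis_equivHom (δ := d)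
    (ρ' := galoisTwist τ η)
    (flatOverInvariants_quotient hF hη hflat) (quotient_injective hF hη hρ) hblock
    (fun g i j h => hblock g i j fun h0 => h (by rw [galoisTwist_apply, h0, map_zero]))
    (fun g i h v => by
      have hrow : ∀ j, (η g).val i j = (1 : Matrix (Fin n) (Fin n) ℂ) i j := fun j => by
        have := h (Pi.single j 1)
        simpa [Matrix.one_apply, Pi.single_apply] using this
      have h1 : ∀ j, (galoisTwist τ η g).val i j = (1 : Matrix (Fin n) (Fin n) ℂ) i j := fun j => by
        rw [galoisTwist_apply, hrow, Matrix.one_apply]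
        split_ifs
        · exact map_one τ
        · exact map_zero τ
      calc _ = ∑ j, (galoisTwist τ η g).val i j * v j := rfl
        _ = _ := by simp_rw [h1, Matrix.one_apply]; simp)
  refine ⟨k, isExponents_of_basis hbX (fun i v => ?_) hli hspan,
    isExponents_of_basis (b := fun i => (aeval F).toLinearMap ∘ₗ b i) (fun i => ?_)
      (fun i v => hF.isHomogeneous_aeval (hbk i v)) ?_ fun f hf => ?_⟩
  · have := isHomogeneous_of_blockWeight (hbk i v)
    rwa [Finsupp.degree_single] at this
  · refine mem_equivHom.2 fun g v => ?_
    rw [LinearMap.comp_apply, LinearMap.comp_apply, AlgHom.toLinearMap_apply,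
      AlgHom.toLinearMap_apply, ← aeval_polyAct_quotient hη, ← mem_equivHom.1 (hbX i)]
    rfl
  · rw [linearIndependent_iff_det_ne_zero (Pi.basisFun ℂ (Fin n))] at hli ⊢
    intro h
    refine hli (hF.aeval_injective ?_)
    rw [map_zero, AlgHom.map_det, ← h]
    rfl
  · have hfN : ∀ v, f v ∈ invariantRing (ρ.comp N.subtype) := by
      intro v h
      have h1 := mem_equivHom.1 hf h v
      have h2 : galoisTwist τ (η.comp (QuotientGroup.mk' N)) h = 1 := by
        have : QuotientGroup.mk' N h = 1 := (QuotientGroup.eq_one_iff _).2 h.2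
        rw [galoisTwist, MonoidHom.comp_apply, MonoidHom.comp_apply, this, map_one, map_one]
      have h3 : matrixModule (galoisTwist τ (η.comp (QuotientGroup.mk' N))) h v = v := by
        change (galoisTwist τ (η.comp (QuotientGroup.mk' N)) h).val.mulVec v = v
        rw [h2, Units.val_one, Matrix.one_mulVec]
      rw [h3] at h1
      exact h1.symm
    choose p hp using fun l => hF.mem_iff.1 (hfN (Pi.single l 1))
    let f' : (Fin n → ℂ) →ₗ[ℂ] MvPolynomial (Fin n) ℂ := Fintype.linearCombination ℂ p
    have hff' : ∀ v, aeval F (f' v) = f v := by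
      have : (aeval F).toLinearMap ∘ₗ f' = f := by
        refine (Pi.basisFun ℂ (Fin n)).ext fun l => ?_
        rw [Pi.basisFun_apply, LinearMap.comp_apply, Fintype.linearCombination_apply_single,
          one_smul, AlgHom.toLinearMap_apply, hp]
      exact fun v => LinearMap.congr_fun this v
    have hf' : f' ∈ equivHom η (matrixModule (galoisTwist τ η)) := by
      refine mem_equivHom.2 fun g v => ?_
      obtain ⟨g, rfl⟩ := QuotientGroup.mk_surjective g
      refine hF.aeval_injective ?_
      rw [aeval_polyAct_quotient hη, hff', hff', ← mem_equivHom.1 hf]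
      rfl
    obtain ⟨r, hr, hrf⟩ := eq_sum_of_mem_span (hspan _ hf')
    have h1 : f = ∑ i, aeval F (r i) • ((aeval F).toLinearMap ∘ₗ b i) := by
      refine LinearMap.ext fun v => ?_
      rw [← hff', hrf]
      simp only [LinearMap.sum_apply, LinearMap.smul_apply, smul_eq_mul, map_sum, map_mul,
        LinearMap.comp_apply, AlgHom.toLinearMap_apply]
    rw [h1]
    exact sum_mem fun i _ => Submodule.smul_mem _
      (⟨_, (aeval_mem_invariantRing_iff hF hη).2 (hr i)⟩ : invariantRing ρ)
      (Submodule.subset_span ⟨i, rfl⟩)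

end QuotientIdentities

/-! ### Covariants of a group from those of a normal subgroup -/

section Contraction

variable {n : ℕ} {M U : Type*} [AddCommGroup M] [Module ℂ M] [AddCommGroup U] [Module ℂ U]
  {ι : Type*} [Fintype ι]

/-- The map `u ↦ ∑ᵢ u(εᵢ) bᵢ` from `Hom(U, S(V*))` to `Hom(M, S(V*))` given by elements `εᵢ` of `U`
and maps `bᵢ` from `M` to `S(V*)`. -/
def contraction (ε : ι → U) (b : ι → M →ₗ[ℂ] MvPolynomial (Fin n) ℂ) :
    (U →ₗ[ℂ] MvPolynomial (Fin n) ℂ) →ₗ[MvPolynomial (Fin n) ℂ]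
      (M →ₗ[ℂ] MvPolynomial (Fin n) ℂ) where
  toFun u := ∑ i, u (ε i) • b i
  map_add' u u' := by simp only [LinearMap.add_apply, add_smul, Finset.sum_add_distrib]
  map_smul' p u := by
    simp only [LinearMap.smul_apply, smul_eq_mul, mul_smul, Finset.smul_sum, RingHom.id_apply]

theorem contraction_apply (ε : ι → U) (b : ι → M →ₗ[ℂ] MvPolynomial (Fin n) ℂ)
    (u : U →ₗ[ℂ] MvPolynomial (Fin n) ℂ) : contraction ε b u = ∑ i, u (ε i) • b i := rfl

theorem contraction_injective (ε : Module.Basis ι ℂ U) {b : ι → M →ₗ[ℂ] MvPolynomial (Fin n) ℂ}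
    (hli : LinearIndependent (MvPolynomial (Fin n) ℂ) b) :
    Function.Injective (contraction ε b) := by
  rw [injective_iff_map_eq_zero]
  intro u hu
  exact ε.ext (Fintype.linearIndependent_iff.1 hli _ hu)

variable {Γ : Type*} [Group Γ] {ρ : Γ →* GL (Fin n) ℂ} {μ : Representation ℂ Γ M}
  {μU : Representation ℂ Γ U}

/-- If the `bᵢ` transform contragrediently to the `εᵢ`, contraction matches the covariants. -/
theorem contraction_mem_equivHom_iff (ε : Module.Basis ι ℂ U)
    {b : ι → M →ₗ[ℂ] MvPolynomial (Fin n) ℂ} (hli : LinearIndependent (MvPolynomial (Fin n) ℂ) b)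
    {a : Γ → ι → ι → ℂ} (hb : ∀ g i, μ.linHom (polyRep ρ) g (b i) = ∑ k, a g k i • b k)
    (hε : ∀ g k, μU g⁻¹ (ε k) = ∑ i, a g k i • ε i) {u : U →ₗ[ℂ] MvPolynomial (Fin n) ℂ} :
    contraction ε b u ∈ equivHom ρ μ ↔ u ∈ equivHom ρ μU := by
  have key : ∀ g, contraction ε b (μU.linHom (polyRep ρ) g u) =
      μ.linHom (polyRep ρ) g (contraction ε b u) := by
    intro g
    have h1 : ∀ k, μU.linHom (polyRep ρ) g u (ε k) =
        ∑ i, a g k i • polyAct (ρ g) (u (ε i)) := by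
      intro k
      rw [Representation.linHom_apply, LinearMap.comp_apply, LinearMap.comp_apply, hε,
        polyRep_apply]
      simp only [map_sum, map_smul]
    have h2 : ∀ i, μ.linHom (polyRep ρ) g (u (ε i) • b i) =
        polyAct (ρ g) (u (ε i)) • μ.linHom (polyRep ρ) g (b i) := by
      intro i
      refine LinearMap.ext fun v => ?_
      simp [Representation.linHom_apply]
    rw [contraction_apply, contraction_apply, map_sum]
    simp_rw [h1, h2, hb, Finset.sum_smul, Finset.smul_sum]
    rw [Finset.sum_comm]
    exact Finset.sum_congr rfl fun i _ => Finset.sum_congr rfl fun k _ => by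
      rw [smul_assoc, smul_comm]
  constructor
  · intro h g
    exact contraction_injective ε hli ((key g).trans (h g))
  · intro h g
    rw [← key, h g]

variable [Finite Γ]

/-- Suppose that every covariant of `M` is a combination of homogeneous independent `bᵢ`, which
transform contragrediently to a basis of `U`. Then the exponents of `M` are the sums of the degrees
of the `bᵢ` and the exponents of `U`. -/
theorem exists_isExponents_add [FiniteDimensional ℂ M] [FiniteDimensional ℂ U]
    (hflat : FlatOverInvariants ρ)
    (hρ : Function.Injective ρ) {m : ℕ} (ε : Module.Basis (Fin m) ℂ U)
    {b : Fin m → M →ₗ[ℂ] MvPolynomial (Fin n) ℂ} {e : Fin m → ℕ}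
    (hbe : ∀ i v, (b i v).IsHomogeneous (e i))
    (hli : LinearIndependent (MvPolynomial (Fin n) ℂ) b)
    (hspan : ∀ f ∈ equivHom ρ μ, ∃ r : Fin m → MvPolynomial (Fin n) ℂ, f = ∑ i, r i • b i)
    {a : Γ → Fin m → Fin m → ℂ} (hb : ∀ g i, μ.linHom (polyRep ρ) g (b i) = ∑ k, a g k i • b k)
    (hε : ∀ g k, μU g⁻¹ (ε k) = ∑ i, a g k i • ε i) :
    ∃ eU eM : Fin m → ℕ, IsExponents ρ μU eU ∧ IsExponents ρ μ eM ∧ ∀ i, e i + eU i = eM i := by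
  classical
  have hiff {u} := contraction_mem_equivHom_iff ε hli hb hε (u := u)
  let A : Set (U →ₗ[ℂ] MvPolynomial (Fin n) ℂ) :=
    {u | u ∈ equivHom ρ μU ∧ ∃ k j, (∀ v, (u v).IsHomogeneous k) ∧ ∀ i, e i ≠ j → u (ε i) = 0}
  -- For `u` of degree `k`, the part of `u` on the `εᵢ` with `e i = j` contracts to the component of
  -- degree `k + j` of the contraction of `u`; so it is a covariant again.
  have hA : ∀ u ∈ equivHom ρ μU, u ∈ Submodule.span ℂ A := by
    intro u hu
    obtain ⟨K, hK⟩ := exists_sum_homComp u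
    rw [hK]
    refine sum_mem fun k _ => ?_
    have hku := homComp_mem_equivHom ρ μU k hu
    have hkh : ∀ v, (homComp k u v).IsHomogeneous k := fun v =>
      homogeneousComponent_isHomogeneous k (u v)
    generalize homComp k u = u at hku hkh
    let uj : ℕ → U →ₗ[ℂ] MvPolynomial (Fin n) ℂ := fun j =>
      ε.constr ℂ fun i => if e i = j then u (ε i) else 0
    have huj : ∀ j i, uj j (ε i) = if e i = j then u (ε i) else 0 := fun j i =>
      ε.constr_basis ℂ _ i
    have h1 : u = ∑ j ∈ Finset.univ.image e, uj j := by
      refine ε.ext fun i => ?_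
      simp_rw [LinearMap.sum_apply, huj]
      rw [Finset.sum_ite_eq, if_pos (Finset.mem_image_of_mem e (Finset.mem_univ i))]
    rw [h1]
    refine sum_mem fun j _ => Submodule.subset_span ⟨?_, k, j, fun v => ?_, fun i hij => ?_⟩
    · rw [← hiff]
      have h2 : contraction ε b (uj j) = homComp (k + j) (contraction ε b u) := by
        refine LinearMap.ext fun v => ?_
        simp only [contraction_apply, homComp_apply, LinearMap.sum_apply, LinearMap.smul_apply,
          map_sum, huj, smul_eq_mul]
        refine Finset.sum_congr rfl fun i _ => ?_
        rw [homogeneousComponent_of_mem ((hkh (ε i)).mul (hbe i v))]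
        by_cases hij : e i = j
        · rw [if_pos hij, if_pos (by rw [hij])]
        · rw [if_neg hij, if_neg (by omega), zero_mul]
      rw [h2]
      exact homComp_mem_equivHom ρ μ _ (hiff.2 hku)
    · rw [← ε.sum_repr v, map_sum]
      refine IsHomogeneous.sum _ _ _ fun i _ => ?_
      rw [map_smul, huj]
      refine Submodule.smul_mem (homogeneousSubmodule (Fin n) ℂ k) _ ?_
      split_ifs
      · exact hkh _
      · exact zero_mem _
    · rw [huj, if_neg hij]
  have hbasis := exists_basis_equivHom μU hflat hρ A (fun f hf => hf.1)
    (fun f hf => by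
      obtain ⟨-, k, j, hk, -⟩ := hf
      exact ⟨k, hk⟩)
    (fun f hf => ⟨f, hA f hf, fun v => by rw [sub_self]; exact zero_mem _⟩)
  rw [Module.finrank_eq_card_basis ε, Fintype.card_fin] at hbasis
  obtain ⟨u, huA, huli, huspan⟩ := hbasis
  choose huX k j huk huj using huA
  obtain ⟨π, hπ⟩ := exists_perm_of_linearIndependent ε huli
  have hj : ∀ i, j (π i) = e i := by
    intro i
    by_contra h
    exact hπ i (huj (π i) i fun h' => h h'.symm)
  have hrange : Set.range (fun i => u (π i)) = Set.range u := π.surjective.range_comp u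
  refine ⟨fun i => k (π i), fun i => e i + k (π i),
    isExponents_of_basis (b := fun i => u (π i)) (fun i => huX _) (fun i v => huk _ v)
      (huli.comp π π.injective) (fun f hf => hrange ▸ huspan f hf),
    isExponents_of_basis (b := fun i => contraction ε b (u (π i))) (fun i => hiff.2 (huX _))
      (fun i v => ?_) ?_ fun f hf => ?_, fun i => rfl⟩
  · rw [contraction_apply, LinearMap.sum_apply]
    refine IsHomogeneous.sum _ _ _ fun l _ => ?_
    rw [LinearMap.smul_apply, smul_eq_mul]
    by_cases hl : e l = j (π i)
    · rw [← hj i, ← hl, add_comm]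
      exact (huk _ _).mul (hbe l v)
    · rw [huj _ _ hl, zero_mul]
      exact isHomogeneous_zero _ _ _
  · exact (huli.comp π π.injective).map' (contraction ε b)
      (LinearMap.ker_eq_bot.2 (contraction_injective ε hli))
  · obtain ⟨r, hr⟩ := hspan f hf
    have hf' : f = contraction ε b (ε.constr ℂ r) := by
      rw [contraction_apply, hr]
      simp_rw [ε.constr_basis]
    rw [hf', hiff] at hf
    have h1 := huspan _ hf
    rw [← hrange] at h1
    obtain ⟨s, hs, hsu⟩ := eq_sum_of_mem_span h1
    rw [hf', hsu, map_sum]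
    simp_rw [map_smul]
    exact sum_mem fun i _ => Submodule.smul_mem _ (⟨_, hs i⟩ : invariantRing ρ)
      (Submodule.subset_span ⟨i, rfl⟩)

end Contraction

/-! ### The Orlik-Solomon space -/

section HarmonicBasis

variable {n : ℕ} {Γ : Type*} [Group Γ] [Finite Γ] {ρ : Γ →* GL (Fin n) ℂ} {N : Subgroup Γ}
  {M : Type*} [AddCommGroup M] [Module ℂ M] [FiniteDimensional ℂ M] (μ : Representation ℂ Γ M)

/-- The covariants have a homogeneous basis with harmonic values. -/
theorem exists_harmonic_basis (hflat : FlatOverInvariants ρ) (hρ : Function.Injective ρ) :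
    ∃ (b : Fin (Module.finrank ℂ M) → M →ₗ[ℂ] MvPolynomial (Fin n) ℂ)
      (e : Fin (Module.finrank ℂ M) → ℕ), (∀ i, b i ∈ equivHom ρ μ) ∧
      (∀ i v, (b i v).IsHomogeneous (e i)) ∧ (∀ i v, b i v ∈ harmonics ρ) ∧
      LinearIndependent (MvPolynomial (Fin n) ℂ) b ∧
      ∀ f ∈ equivHom ρ μ, f ∈ Submodule.span (invariantRing ρ) (Set.range b) := by
  obtain ⟨b, hbA, hli, hspan⟩ := exists_basis_equivHom μ hflat hρ
    {f | f ∈ equivHom ρ μ ∧ (∃ k, ∀ v, (f v).IsHomogeneous k) ∧ ∀ v, f v ∈ harmonics ρ}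
    (fun f hf => hf.1) (fun f hf => hf.2.1) fun f hf => by
      refine ⟨harmonicProj ρ ∘ₗ f, ?_, fun v => sub_harmonicProj_mem ρ (f v)⟩
      obtain ⟨K, hK⟩ := exists_sum_homComp (harmonicProj ρ ∘ₗ f)
      rw [hK]
      exact sum_mem fun k _ => Submodule.subset_span
        ⟨homComp_mem_equivHom ρ μ k (harmonicProj_comp_mem_equivHom ρ μ hf),
          ⟨k, fun v => homogeneousComponent_isHomogeneous k _⟩,
          fun v => homogeneousComponent_mem_harmonics ρ (harmonicProj_mem ρ (f v)) k⟩
  choose hbX hbe hbh using hbA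
  choose e hbe using hbe
  exact ⟨b, e, hbX, hbe, hbh, hli, hspan⟩

/-- The exponents of `M` for the whole group are the sums of those for the normal subgroup and those
of the dual of any model `W` of the harmonic covariants of the normal subgroup. -/
theorem exists_isExponents_dual (hflat : FlatOverInvariants ρ)
    (hflatN : FlatOverInvariants (ρ.comp N.subtype)) (hρ : Function.Injective ρ)
    {W : Type*} [AddCommMonoid W] [Module ℂ W] (ν : Representation ℂ Γ W)
    (T : W →ₗ[ℂ] (M →ₗ[ℂ] MvPolynomial (Fin n) ℂ)) (hT : Function.Injective T)
    (hTν : ∀ g x, T (ν g x) = μ.linHom (polyRep ρ) g (T x))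
    (hTX : ∀ x, T x ∈ equivHom (ρ.comp N.subtype) (μ.comp N.subtype))
    (hTh : ∀ x v, T x v ∈ harmonics (ρ.comp N.subtype))
    (hTsurj : ∀ f ∈ equivHom (ρ.comp N.subtype) (μ.comp N.subtype),
      (∀ v, f v ∈ harmonics (ρ.comp N.subtype)) → ∃ x, T x = f) :
    ∃ eN eU eM : Fin (Module.finrank ℂ M) → ℕ,
      IsExponents (ρ.comp N.subtype) (μ.comp N.subtype) eN ∧
      IsExponents ρ ν.dual eU ∧ IsExponents ρ μ eM ∧ ∀ i, eN i + eU i = eM i := by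
  let _ : AddCommGroup W := Module.addCommMonoidToAddCommGroup ℂ
  obtain ⟨b, e, hbX, hbe, hbh, hli, hspan⟩ := exists_harmonic_basis (μ.comp N.subtype) hflatN
    (hρ.comp Subtype.val_injective)
  choose w hw using fun i => hTsurj (b i) (hbX i) (hbh i)
  have hwli : LinearIndependent ℂ w := by
    refine LinearIndependent.of_comp T ?_
    have : T ∘ w = b := funext hw
    rw [this, Fintype.linearIndependent_iff]
    intro α hα i
    have h1 := Fintype.linearIndependent_iff.1 hli (fun i => C (α i)) (by
      rw [← hα]
      refine Finset.sum_congr rfl fun i _ => LinearMap.ext fun v => ?_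
      rw [LinearMap.smul_apply, LinearMap.smul_apply, smul_eq_mul, smul_eq_C_mul]) i
    exact C_eq_zero.1 h1
  -- Modulo the invariant ideal, invariant coefficients may be replaced by their constant terms.
  have hwspan : ⊤ ≤ Submodule.span ℂ (Set.range w) := by
    intro x _
    obtain ⟨r, hr, hrx⟩ := eq_sum_of_mem_span (hspan _ (hTX x))
    have h1 : T x = T (∑ i, constantCoeff (r i) • w i) := by
      rw [map_sum]
      refine LinearMap.ext fun v => ?_
      have h2 : ∀ p ∈ harmonics (ρ.comp N.subtype), harmonicProj (ρ.comp N.subtype) p = p :=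
        fun p hp => harmonicProj_eq _ hp (by rw [sub_self]; exact zero_mem _)
      rw [← h2 (T x v) (hTh x v), hrx]
      simp only [LinearMap.sum_apply, LinearMap.smul_apply, smul_eq_mul, map_sum, map_smul, hw]
      exact Finset.sum_congr rfl fun i _ => by
        rw [harmonicProj_mul _ (hr i), h2 _ (hbh i v)]
    rw [hT h1]
    exact sum_mem fun i _ => Submodule.smul_mem _ _ (Submodule.subset_span ⟨i, rfl⟩)
  let β := Module.Basis.mk hwli hwspan
  have hβ : ∀ i, T (β i) = b i := fun i => by rw [Module.Basis.mk_apply, hw]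
  have : FiniteDimensional ℂ W := β.finiteDimensional_of_finite
  have hb : ∀ g i, μ.linHom (polyRep ρ) g (b i) = ∑ k, β.coord k (ν g (β i)) • b k := by
    intro g i
    rw [← hβ, ← hTν]
    conv_lhs => rw [← β.sum_repr (ν g (β i)), map_sum]
    exact Finset.sum_congr rfl fun k _ => by rw [map_smul, hβ]; rfl
  have hε : ∀ g k, ν.dual g⁻¹ (β.dualBasis k) =
      ∑ i, β.coord k (ν g (β i)) • β.dualBasis i := by
    intro g k
    rw [Representation.dual_apply, inv_inv, β.coe_dualBasis]
    exact (β.sum_dual_apply_smul_coord (β.coord k ∘ₗ ν g)).symm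
  obtain ⟨eU, eM, h1, h2, h3⟩ := exists_isExponents_add (μU := ν.dual) hflat hρ β.dualBasis hbe hli
    (fun f hf => by
      obtain ⟨r, -, hr⟩ := eq_sum_of_mem_span (hspan f fun h => hf h)
      exact ⟨r, hr⟩) hb hε
  exact ⟨e, eU, eM, isExponents_of_basis hbX hbe hli hspan, h1, h2, h3⟩

end HarmonicBasis

section OrlikSolomon

variable {n : ℕ} {Γ : Type*} [Group Γ] (ρ : Γ →* GL (Fin n) ℂ) (N : Subgroup Γ) [N.Normal]
  {M : Type*} [AddCommGroup M] [Module ℂ M] (μ : Representation ℂ Γ M)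

/-- The map `𝒞_N ⊗ M* → Hom(M, S(V*))` that sends `c ⊗ φ` to `v ↦ φ(v) c`. -/
def tensorToHom (M : Type*) [AddCommGroup M] [Module ℂ M] :
    TensorProduct ℂ (normalHarmonics ρ N).toSubmodule (Module.Dual ℂ M) →ₗ[ℂ]
      (M →ₗ[ℂ] MvPolynomial (Fin n) ℂ) :=
  LinearMap.compRight ℂ (normalHarmonics ρ N).toSubmodule.subtype ∘ₗ
    dualTensorHom ℂ M (normalHarmonics ρ N).toSubmodule ∘ₗ
      (TensorProduct.comm ℂ (normalHarmonics ρ N).toSubmodule (Module.Dual ℂ M)).toLinearMap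

theorem tensorToHom_tmul (c : (normalHarmonics ρ N).toSubmodule) (φ : Module.Dual ℂ M) (v : M) :
    tensorToHom ρ N M (TensorProduct.tmul ℂ c φ) v = φ v • (c : MvPolynomial (Fin n) ℂ) := rfl

theorem tensorToHom_equivariant (g : Γ)
    (x : TensorProduct ℂ (normalHarmonics ρ N).toSubmodule (Module.Dual ℂ M)) :
    tensorToHom ρ N M (harmonicTensorDual ρ N μ g x) =
      μ.linHom (polyRep ρ) g (tensorToHom ρ N M x) := by
  induction x using TensorProduct.induction_on with
  | zero => simp only [map_zero]
  | add x y hx hy => rw [map_add, map_add, hx, hy, map_add, map_add]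
  | tmul c φ =>
    refine LinearMap.ext fun v => ?_
    rw [Representation.linHom_apply, LinearMap.comp_apply, LinearMap.comp_apply, tensorToHom_tmul,
      map_smul]
    rfl

theorem tensorToHom_mem (x : TensorProduct ℂ (normalHarmonics ρ N).toSubmodule (Module.Dual ℂ M))
    (v : M) : tensorToHom ρ N M x v ∈ harmonics (ρ.comp N.subtype) :=
  (dualTensorHom ℂ M (normalHarmonics ρ N).toSubmodule
    (TensorProduct.comm ℂ (normalHarmonics ρ N).toSubmodule (Module.Dual ℂ M) x) v).2

variable [FiniteDimensional ℂ M]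

theorem tensorToHom_injective : Function.Injective (tensorToHom ρ N M) := by
  intro x y h
  have h1 : dualTensorHom ℂ M (normalHarmonics ρ N).toSubmodule
        (TensorProduct.comm ℂ (normalHarmonics ρ N).toSubmodule (Module.Dual ℂ M) x) =
      dualTensorHom ℂ M (normalHarmonics ρ N).toSubmodule
        (TensorProduct.comm ℂ (normalHarmonics ρ N).toSubmodule (Module.Dual ℂ M) y) :=
    LinearMap.ext fun v => Subtype.ext (LinearMap.congr_fun h v)
  exact (TensorProduct.comm ℂ (normalHarmonics ρ N).toSubmodule (Module.Dual ℂ M)).injective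
    ((dualTensorHomEquiv ℂ M (normalHarmonics ρ N).toSubmodule).injective h1)

theorem exists_tensorToHom_eq {f : M →ₗ[ℂ] MvPolynomial (Fin n) ℂ}
    (hf : ∀ v, f v ∈ harmonics (ρ.comp N.subtype)) : ∃ x, tensorToHom ρ N M x = f := by
  let f' : M →ₗ[ℂ] (normalHarmonics ρ N).toSubmodule := f.codRestrict _ hf
  refine ⟨(TensorProduct.comm ℂ (normalHarmonics ρ N).toSubmodule (Module.Dual ℂ M)).symm
    ((dualTensorHomEquiv ℂ M (normalHarmonics ρ N).toSubmodule).symm f'), ?_⟩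
  refine LinearMap.ext fun v => ?_
  have h1 : dualTensorHom ℂ M (normalHarmonics ρ N).toSubmodule
      ((dualTensorHomEquiv ℂ M (normalHarmonics ρ N).toSubmodule).symm f') = f' :=
    (dualTensorHomEquiv ℂ M (normalHarmonics ρ N).toSubmodule).apply_symm_apply f'
  have h2 : tensorToHom ρ N M
      ((TensorProduct.comm ℂ (normalHarmonics ρ N).toSubmodule (Module.Dual ℂ M)).symm
        ((dualTensorHomEquiv ℂ M (normalHarmonics ρ N).toSubmodule).symm f')) v =
      (dualTensorHom ℂ M (normalHarmonics ρ N).toSubmodule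
        ((dualTensorHomEquiv ℂ M (normalHarmonics ρ N).toSubmodule).symm f') v :
          MvPolynomial (Fin n) ℂ) := by
    simp only [tensorToHom, LinearMap.comp_apply, LinearEquiv.coe_coe, LinearEquiv.apply_symm_apply]
    rfl
  rw [h2, h1]
  rfl

theorem mem_normalInvariants_iff
    {x : TensorProduct ℂ (normalHarmonics ρ N).toSubmodule (Module.Dual ℂ M)} :
    x ∈ (normalInvariants N (harmonicTensorDual ρ N μ)).toSubmodule ↔
      tensorToHom ρ N M x ∈ equivHom (ρ.comp N.subtype) (μ.comp N.subtype) := by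
  constructor
  · intro h g
    exact (tensorToHom_equivariant ρ N μ g x).symm.trans (congrArg _ (h g g.2))
  · intro h g hg
    exact tensorToHom_injective ρ N ((tensorToHom_equivariant ρ N μ g x).trans (h ⟨g, hg⟩))

variable [Finite Γ]

/-- The exponents of `M` for the whole group are the sums of those for the normal subgroup and those
of the Orlik-Solomon space. -/
theorem exists_isExponents_orlikSolomon (hflat : FlatOverInvariants ρ)
    (hflatN : FlatOverInvariants (ρ.comp N.subtype)) (hρ : Function.Injective ρ) :
    ∃ eN eU eM : Fin (Module.finrank ℂ M) → ℕ,
      IsExponents (ρ.comp N.subtype) (μ.comp N.subtype) eN ∧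
      IsExponents ρ (orlikSolomon ρ N μ) eU ∧ IsExponents ρ μ eM ∧
      ∀ i, eN i + eU i = eM i := by
  refine exists_isExponents_dual μ hflat hflatN hρ
    (normalInvariants N (harmonicTensorDual ρ N μ)).toRepresentation
    (tensorToHom ρ N M ∘ₗ (normalInvariants N (harmonicTensorDual ρ N μ)).toSubmodule.subtype)
    ?_ ?_ ?_ ?_ ?_
  · exact (tensorToHom_injective ρ N).comp Subtype.val_injective
  · exact fun g x => tensorToHom_equivariant ρ N μ g x
  · intro x
    rw [LinearMap.comp_apply]
    exact (mem_normalInvariants_iff ρ N μ).1 x.2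
  · intro x v
    rw [LinearMap.comp_apply]
    exact tensorToHom_mem ρ N _ v
  · intro f hf hfh
    obtain ⟨x, hx⟩ := exists_tensorToHom_eq ρ N hfh
    exact ⟨⟨x, (mem_normalInvariants_iff ρ N μ).2 (hx ▸ hf)⟩, hx⟩

end OrlikSolomon

end ReflectionNumerology

end

open ReflectionNumerology in
theorem theorem1p3 (r : ℕ) (G : Subgroup (GL (Fin r) ℂ)) [Finite G]
    (hG : IsGeneratedByReflections G)
    (N : Subgroup G) [N.Normal] (hN : IsGeneratedByReflections (N.map G.subtype))
    (ζ : ℂ) (hζ : IsPrimitiveRoot ζ (Nat.card G))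
    (σ : IntermediateField.adjoin ℚ {ζ} ≃ₐ[ℚ] IntermediateField.adjoin ℚ {ζ})
    (τ : ℂ ≃+* ℂ) (hτ : ∀ x : IntermediateField.adjoin ℚ {ζ}, τ (x : ℂ) = (σ x : ℂ)) :
    (∃ (F : Fin r → MvPolynomial (Fin r) ℂ) (η : G ⧸ N →* GL (Fin r) ℂ),
      IsLinearQuotient G.subtype N F η) ∧
    ∀ (F : Fin r → MvPolynomial (Fin r) ℂ) (η : G ⧸ N →* GL (Fin r) ℂ),
      IsLinearQuotient G.subtype N F η →
      ∃ eNV eGU eGV dN eHE eGE dH dG : Fin r → ℕ,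
        IsExponents (G.subtype.comp N.subtype)
          (matrixModule (galoisTwist τ (G.subtype.comp N.subtype))) eNV ∧
        IsExponents G.subtype
          (orlikSolomon G.subtype N (matrixModule (galoisTwist τ G.subtype))) eGU ∧
        IsExponents G.subtype (matrixModule (galoisTwist τ G.subtype)) eGV ∧
        IsExponents η (matrixModule (galoisTwist τ η)) eHE ∧
        IsExponents G.subtype
          (matrixModule (galoisTwist τ (η.comp (QuotientGroup.mk' N)))) eGE ∧
        IsDegrees (G.subtype.comp N.subtype) dN ∧
        IsDegrees η dH ∧
        IsDegrees G.subtype dG ∧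
        ∀ i, eNV i + eGU i = eGV i ∧ dN i * eHE i = eGE i ∧ dN i * dH i = dG i := by
  have hinj : Function.Injective G.subtype := G.subtype_injective
  have hflat : FlatOverInvariants G.subtype :=
    flatOverInvariants (by rwa [Subgroup.range_subtype])
  have hflatN : FlatOverInvariants (G.subtype.comp N.subtype) :=
    flatOverInvariants (by rwa [MonoidHom.range_comp, Subgroup.range_subtype])
  refine ⟨exists_isLinearQuotient G.subtype N hflatN, ?_⟩
  rintro F η ⟨⟨dN, hF⟩, hη⟩
  have hadd := exists_isExponents_orlikSolomon G.subtype N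
    (matrixModule (galoisTwist τ G.subtype)) hflat hflatN hinj
  rw [Module.finrank_fin_fun] at hadd
  obtain ⟨eNV, eGU, eGV, hNV, hGU, hGV, hsum⟩ := hadd
  obtain ⟨eHE, hHE, hGE⟩ := exists_isExponents_quotient hF hη hflat hinj τ
  obtain ⟨dH, hdH, hdG⟩ := exists_isDegrees_quotient hF hη hflat
  exact ⟨eNV, eGU, eGV, dN, eHE, _, dH, _, hNV, hGU, hGV, hHE, hGE, ⟨F, hF⟩, hdH, hdG,
    fun i => ⟨hsum i, rfl, rfl⟩⟩
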